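/- Let $\mathcal G$ be a three-dimensional nilpotent Lie group with Lie algebra $\mathfrak g$, let $M$ be a compact one-dimensional smooth manifold (without boundary), and let $\pi:P\to M$ be a smooth principal $\mathcal G$-bundle (right action) with a $\mathcal G$-invariant Riemannian metric $\bar g$ and a $\mathcal G$-invariant, smooth, closed three-form $\bar H$ on $P$. Notation. Let $\mathfrak G=P\times_{\mathrm{Ad}}\mathfrak g$ be the adjoint bundle. An element $\{p,x\}$ of $\mathfrak G|_{\pi(p)}$ is identified with the vertical vector at $p$ generated by $x$, and $v\in TM$ with its $\bar g$-horizontal lift. In this way $\bar g$ gives a fibre metric $G$ on $\mathfrak G$ and a metric $g$ on $M$, $\bar H$ gives a section $H$ of $\Lambda^3(\mathfrak G\oplus TM)^*$, and the Lie bracket of invariant vertical vector fields gives a bracket $[\,,]$ on the fibres of $\mathfrak G$, namely $[\{p,x\},\{p,y\}]=-\{p,[x,y]\}$. Let $Z(\mathfrak G)$ be the bundle of centres of the fibres, $Z(\mathfrak G)^\perp$ its $G$-orthogonal complement, $H^{\mathfrak G}$ the restriction of $H$ to $\mathfrak G$, and $D$ the connection on $\mathfrak G$ (and its tensor bundles)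 induced by the principal connection whose horizontal spaces are the $\bar g$-orthogonal complements of the fibres, combined with the Levi-Civita connection of $g$ on $TM$. A repeated dot $\cdot_i$ denotes a trace with respect to $G$ or $g$, stars denote free arguments, and norms of tensors are full contractions. Let $v$ be a local vector field on $M$ with $g(v,v)=1$ and put $$|DG|^2=D_vG(\cdot_1,\cdot_2)D_vG(\cdot_1,\cdot_2),\quad \mathrm{tr}_gH^2=H(v,\cdot_1,\cdot_2)H(v,\cdot_1,\cdot_2),\quad H^2(v,\eta)=H(v,\cdot_1,\cdot_2)H(\eta,\cdot_1,\cdot_2),$$ $$DG(\cdot,\cdot)=\mathrm{tr}_G\,DG .$$ With $\eta_3\in Z(\mathfrak G)$ a $G$-unit vector, define $$\begin{aligned}S_B=\;&2\,|(D_\cdot DG)_\cdot(*_1,*_2)-D_{\cdot_1}G(*_1,\cdot_2)D_{\cdot_1}G(*_2,\cdot_2)+H(v,*_1,\cdot)H(v,*_2,\cdot)|^2\\&+2\,|D_\cdot H(\cdot,*_1,*_2)+H(v,\cdot,*_1)D_vG(\cdot,*_2)-H(v,\cdot,*_2)D_vG(\cdot,*_1)|^2\\&+|[,]|^2\big(D_vG(\cdot,\cdot)-2D_vG(\eta_3,\eta_3)\big)^2+2|[,]|^2\big(D_vG(\cdot,\eta_3)D_vG(\cdot,\eta_3)-D_vG(\eta_3,\eta_3)^2\big)\\&+2\,|D_vG([\cdot,*],\cdot)|^2+2\,|D_vG([\cdot,*],\cdot)+H^2(v,*)|^2+2\,|H(v,\cdot_1,\cdot_2)[\cdot_1,\cdot_2]|^2+\tfrac13|H^{\mathfrak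 G}|^2\,|DG(\cdot,\cdot)|^2,\end{aligned}$$ where the free arguments $*$ are in $\mathfrak G$. (This does not depend on the choice of $v$ and $\eta_3$; when $[\,,]=0$ the terms with the factor $|[,]|^2$ vanish.) Suppose $S_B=0$ on $M$. Then: 1. With respect to the $G$-orthogonal splitting $\mathfrak G=Z(\mathfrak G)^\perp\oplus Z(\mathfrak G)$, $D$ preserves sections of each summand, and $DG(\eta,\eta')=0$ for $\eta\in Z(\mathfrak G)^\perp$, $\eta'\in Z(\mathfrak G)$. 2. $DG(\cdot,\cdot)=0$. 3. $\mathrm{tr}_gH^2=0$. 4. $(D_\cdot DG)_\cdot(\eta,\eta')=D_{\cdot_1}G(\eta,\cdot_2)D_{\cdot_1}G(\eta',\cdot_2)$ for all $\eta,\eta'\in\mathfrak G$. 5. $D|[,]|^2=0$, $D|DG|^2=0$ and $D|H^{\mathfrak G}|^2=0$. If moreover the identity component of $\mathcal G$ is nonabelian (for connected $\mathcal G$: if $\mathcal G$ is nonabelian), then also 6. $DG(\eta,\eta')=0$ for all $\eta,\eta'\in Z(\mathfrak G)$. 7. $(D_\cdot DG)_\cdot(\eta,\eta')=\tfrac12|DG|^2G(\eta,\eta')$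 for all $\eta,\eta'\in Z(\mathfrak G)^\perp$. -/

import Mathlib

open scoped Manifold ContDiff

noncomputable section

namespace NilBundle

/-- The Lie algebra `𝔤 = T₁𝒢` of a three-dimensional Lie group, with the bracket of Mathlib
(the bracket of left-invariant vector fields). -/
abbrev Lie3 (𝒢 : Type*) [TopologicalSpace 𝒢] [ChartedSpace (EuclideanSpace ℝ (Fin 3)) 𝒢]
    [Group 𝒢] : Type _ :=
  GroupLieAlgebra (𝓡 3) 𝒢

/-- A smooth principal bundle `π : P → M` with three-dimensional structure group `𝒢`
(acting on the right) over a one-dimensional base; the total space has dimension four. -/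
structure PrincipalBundle (𝒢 P M : Type*)
    [TopologicalSpace 𝒢] [ChartedSpace (EuclideanSpace ℝ (Fin 3)) 𝒢] [Group 𝒢]
    [TopologicalSpace P] [ChartedSpace (EuclideanSpace ℝ (Fin 4)) P]
    [TopologicalSpace M] [ChartedSpace (EuclideanSpace ℝ (Fin 1)) M] where
  /-- the projection -/
  proj : P → M
  /-- the right action `(p, a) ↦ p · a` -/
  act : P → 𝒢 → P
  act_one : ∀ p, act p 1 = p
  act_mul : ∀ p a b, act p (a * b) = act (act p a) b
  proj_act : ∀ p a, proj (act p a) = proj p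
  contMDiff_proj : ContMDiff (𝓡 4) (𝓡 1) ∞ proj
  contMDiff_act : ContMDiff ((𝓡 4).prod (𝓡 3)) (𝓡 4) ∞ (fun z : P × 𝒢 => act z.1 z.2)
  /-- smooth equivariant local triviality -/
  locallyTrivial : ∀ m : M, ∃ (U : Set M) (e : OpenPartialHomeomorph P (M × 𝒢)),
    IsOpen U ∧ m ∈ U ∧ e.source = proj ⁻¹' U ∧ e.target = U ×ˢ Set.univ ∧
    ContMDiffOn (𝓡 4) ((𝓡 1).prod (𝓡 3)) ∞ e e.source ∧
    ContMDiffOn ((𝓡 1).prod (𝓡 3)) (𝓡 4) ∞ e.symm e.target ∧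
    (∀ p ∈ e.source, (e p).1 = proj p) ∧
    (∀ p ∈ e.source, ∀ a, e (act p a) = ((e p).1, (e p).2 * a))

/-- Smooth Riemannian metrics on a four-manifold. -/
abbrev Metric4 (P : Type*) [TopologicalSpace P] [ChartedSpace (EuclideanSpace ℝ (Fin 4)) P]
    [IsManifold (𝓡 4) ∞ P] : Type _ :=
  Bundle.ContMDiffRiemannianMetric (𝓡 4) ∞ (EuclideanSpace ℝ (Fin 4))
    (fun p : P => TangentSpace (𝓡 4) p)

/-- (Not necessarily smooth) three-forms on a four-manifold. -/
abbrev ThreeForm (P : Type*) [TopologicalSpace P] [ChartedSpace (EuclideanSpace ℝ (Fin 4)) P] :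
    Type _ :=
  ∀ p : P, (TangentSpace (𝓡 4) p) [⋀^Fin 3]→L[ℝ] ℝ

section Forms

variable {P : Type*} [TopologicalSpace P] [ChartedSpace (EuclideanSpace ℝ (Fin 4)) P]

/-- The expression of a three-form in the preferred chart at `p₀`: its pullback under the inverse
of the chart. -/
def chartForm (H : ThreeForm P) (p₀ : P) (x : EuclideanSpace ℝ (Fin 4)) :
    (EuclideanSpace ℝ (Fin 4)) [⋀^Fin 3]→L[ℝ] ℝ :=
  (H ((extChartAt (𝓡 4) p₀).symm x)).compContinuousLinearMap
    (mfderiv 𝓘(ℝ, EuclideanSpace ℝ (Fin 4)) (𝓡 4) (extChartAt (𝓡 4) p₀).symm x)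

/-- A smooth three-form: smooth in charts. -/
def IsSmoothForm (H : ThreeForm P) : Prop :=
  ∀ p₀ : P, ContDiffOn ℝ ∞ (chartForm H p₀) (extChartAt (𝓡 4) p₀).target

/-- `dH = 0`, in charts. -/
def IsClosedForm (H : ThreeForm P) : Prop :=
  ∀ p₀ : P, ∀ x ∈ (extChartAt (𝓡 4) p₀).target, extDeriv (chartForm H p₀) x = 0

end Forms

section Bundle

variable {𝒢 P M : Type*}
  [TopologicalSpace 𝒢] [ChartedSpace (EuclideanSpace ℝ (Fin 3)) 𝒢] [Group 𝒢]
  [TopologicalSpace P] [ChartedSpace (EuclideanSpace ℝ (Fin 4)) P] [IsManifold (𝓡 4) ∞ P]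
  [TopologicalSpace M] [ChartedSpace (EuclideanSpace ℝ (Fin 1)) M]

/-- The differential at `p` of right translation `R_a : q ↦ q · a`. -/
def rightTrans (B : PrincipalBundle 𝒢 P M) (a : 𝒢) (p : P) :
    TangentSpace (𝓡 4) p →L[ℝ] TangentSpace (𝓡 4) (B.act p a) :=
  mfderiv (𝓡 4) (𝓡 4) (fun q => B.act q a) p

/-- The metric is `𝒢`-invariant. -/
def InvariantMetric (B : PrincipalBundle 𝒢 P M) (g : Metric4 P) : Prop :=
  ∀ (a : 𝒢) (p : P) (u w : TangentSpace (𝓡 4) p),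
    g.inner (B.act p a) (rightTrans B a p u) (rightTrans B a p w) = g.inner p u w

/-- The three-form is `𝒢`-invariant. -/
def InvariantForm (B : PrincipalBundle 𝒢 P M) (H : ThreeForm P) : Prop :=
  ∀ (a : 𝒢) (p : P), (H (B.act p a)).compContinuousLinearMap (rightTrans B a p) = H p

/-- The vertical vector at `p` generated by `x ∈ 𝔤`: the derivative at `a = 1` of `a ↦ p · a`
in the direction `x`. For fixed `p`, `x ↦ vert B p x` identifies `𝔤` with the vertical space at
`p`, and so with the fibre of the adjoint bundle `𝔊` at `π p` (`x` stands for the class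
`{p, x}`). -/
def vert (B : PrincipalBundle 𝒢 P M) (p : P) (x : Lie3 𝒢) : TangentSpace (𝓡 4) p :=
  mfderiv (𝓡 3) (𝓡 4) (fun a : 𝒢 => B.act p a) 1 x

/-- The adjoint action `Ad_a` on `𝔤`. -/
def Ad (a : 𝒢) (x : Lie3 𝒢) : Lie3 𝒢 :=
  mfderiv (𝓡 3) (𝓡 3) (fun b : 𝒢 => a * b * a⁻¹) 1 x

/-- Smooth sections over `U ⊆ M` of the adjoint bundle `𝔊 = P ×_Ad 𝔤`, given by the
corresponding equivariant functions `η : π⁻¹ U → 𝔤` (the value at `m` being `{p, η p}`, for any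
`p` over `m`). As a vector space, `𝔤 = T₁𝒢` is by definition the model space of `𝒢`. -/
structure IsAdjointSection (B : PrincipalBundle 𝒢 P M) (U : Set M) (η : P → Lie3 𝒢) : Prop where
  smooth : ContMDiffOn (M' := EuclideanSpace ℝ (Fin 3))
    (𝓡 4) 𝓘(ℝ, EuclideanSpace ℝ (Fin 3)) ∞ η (B.proj ⁻¹' U)
  equivariant : ∀ p ∈ B.proj ⁻¹' U, ∀ a : 𝒢, η (B.act p a) = Ad a⁻¹ (η p)

/-- `V` is the horizontal lift to `π⁻¹ U` of a smooth vector field `v` on `U ⊆ M` with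
`g(v, v) = 1`. Here horizontal means `g`-orthogonal to the fibres (this is the connection `A` on
`P` associated with the metric on `P`), and the metric on `M` is the one for which horizontal
lifting is isometric. As `M` is one-dimensional, `v` is unique up to sign on connected sets, and
`∇ᵥv = 0` for the Levi-Civita connection. -/
structure IsUnitHorizontal (B : PrincipalBundle 𝒢 P M) (g : Metric4 P) (U : Set M)
    (V : ∀ p : P, TangentSpace (𝓡 4) p) : Prop where
  smooth : ContMDiffOn (𝓡 4) (𝓡 4).tangent ∞
    (fun p => (⟨p, V p⟩ : TangentBundle (𝓡 4) P)) (B.proj ⁻¹' U)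
  horizontal : ∀ p ∈ B.proj ⁻¹' U, ∀ x : Lie3 𝒢, g.inner p (V p) (vert B p x) = 0
  unit : ∀ p ∈ B.proj ⁻¹' U, g.inner p (V p) (V p) = 1
  invariant : ∀ p ∈ B.proj ⁻¹' U, ∀ a : 𝒢, rightTrans B a p (V p) = V (B.act p a)

/-- The covariant derivative `D_v` induced on sections of bundles associated with `P` (`𝔊` and its
tensor bundles) by the connection on `P`: the equivariant function (with values in a fixed vector space)
that represents the section is differentiated along the horizontal lift `V` of `v`. -/
def covDeriv {E : Type*} [NormedAddCommGroup E] [NormedSpace ℝ E]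
    (V : ∀ p : P, TangentSpace (𝓡 4) p) (f : P → E) (p : P) : E :=
  mfderiv (𝓡 4) 𝓘(ℝ, E) f p (V p)

/-- `D_v η` for a section `η` of `𝔊`. It equals `[v, η]`, the bracket of invariant vector fields
on `P`, and `D_v {s, x} = {s, [(s^* A) v, x]}` for local sections `s` of `P`. -/
def covDerivSec (V : ∀ p : P, TangentSpace (𝓡 4) p) (η : P → Lie3 𝒢) (p : P) : Lie3 𝒢 :=
  covDeriv (E := EuclideanSpace ℝ (Fin 3)) V η p

/-- The Lie bracket of the fibre of `𝔊` over `π p`: the bracket of invariant vertical vector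
fields on `P`, which is `[{p, x}, {p, y}] = -{p, [x, y]}`. -/
def fibBr (x y : Lie3 𝒢) : Lie3 𝒢 := -⁅x, y⁆

/-- The centre of the fibre of `𝔊`. It is the centre of `𝔤`, whatever the point `p` used. -/
def centre (𝒢 : Type*) [TopologicalSpace 𝒢] [ChartedSpace (EuclideanSpace ℝ (Fin 3)) 𝒢]
    [Group 𝒢] : Set (Lie3 𝒢) :=
  {z | ∀ x : Lie3 𝒢, fibBr z x = 0}

/-- The fibre metric `G` on `𝔊`. -/
def fibG (B : PrincipalBundle 𝒢 P M) (g : Metric4 P) (p : P) (x y : Lie3 𝒢) : ℝ :=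
  g.inner p (vert B p x) (vert B p y)

/-- The `G`-orthogonal complement of the centre in the fibre of `𝔊`. -/
def centrePerp (B : PrincipalBundle 𝒢 P M) (g : Metric4 P) (p : P) : Set (Lie3 𝒢) :=
  {x | ∀ z ∈ centre 𝒢, fibG B g p x z = 0}

/-- A basis of `𝔤`, used to write traces in coordinates. -/
def lieBasis (𝒢 : Type*) [TopologicalSpace 𝒢] [ChartedSpace (EuclideanSpace ℝ (Fin 3)) 𝒢]
    [Group 𝒢] : Module.Basis (Fin 3) ℝ (Lie3 𝒢) :=
  (EuclideanSpace.basisFun (Fin 3) ℝ).toBasis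

/-- The trace `tr_G T = ∑ G^{ij} T(eᵢ, eⱼ)` of a bilinear map `T` on the fibre of `𝔊`, where
`(G^{ij})` is the inverse of the Gram matrix of `G`. For bilinear `T` it does not depend on the
basis. -/
def trG (B : PrincipalBundle 𝒢 P M) (g : Metric4 P) (p : P) {E : Type*} [AddCommGroup E]
    [Module ℝ E] (T : Lie3 𝒢 → Lie3 𝒢 → E) : E :=
  ∑ i : Fin 3, ∑ j : Fin 3,
    (Matrix.of fun k l : Fin 3 => fibG B g p (lieBasis 𝒢 k) (lieBasis 𝒢 l))⁻¹ i j •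
      T (lieBasis 𝒢 i) (lieBasis 𝒢 j)

/-- `|α|²` for a covector `α` on the fibre of `𝔊`. -/
def normSq1 (B : PrincipalBundle 𝒢 P M) (g : Metric4 P) (p : P) (α : Lie3 𝒢 → ℝ) : ℝ :=
  trG B g p fun x x' => α x * α x'

/-- `|T|²` for a bilinear form `T` on the fibre of `𝔊`. -/
def normSq2 (B : PrincipalBundle 𝒢 P M) (g : Metric4 P) (p : P)
    (T : Lie3 𝒢 → Lie3 𝒢 → ℝ) : ℝ :=
  trG B g p fun x x' => trG B g p fun y y' => T x y * T x' y'

/-- `|[,]|²`. -/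
def normSqBr (B : PrincipalBundle 𝒢 P M) (g : Metric4 P) (p : P) : ℝ :=
  trG B g p fun x x' => trG B g p fun y y' => fibG B g p (fibBr x y) (fibBr x' y')

/-- `|H^𝔊|²`, where `H^𝔊` is the restriction of `H` to `𝔊`. -/
def normSqHfib (B : PrincipalBundle 𝒢 P M) (g : Metric4 P) (H : ThreeForm P) (p : P) : ℝ :=
  trG B g p fun x x' => trG B g p fun y y' => trG B g p fun z z' =>
    H p ![vert B p x, vert B p y, vert B p z] * H p ![vert B p x', vert B p y', vert B p z']

/-- `(D_v G)(x, y)`. -/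
def dG (B : PrincipalBundle 𝒢 P M) (g : Metric4 P) (V : ∀ p : P, TangentSpace (𝓡 4) p)
    (p : P) (x y : Lie3 𝒢) : ℝ :=
  covDeriv V (fun q => fibG B g q x y) p

/-- `(D_· DG)_· (x, y)`: for a unit field `v` on the one-dimensional base it is
`(D_v DG)_v = D_v (D_v G) - D_{∇ᵥv} G = D_v (D_v G)`. -/
def ddG (B : PrincipalBundle 𝒢 P M) (g : Metric4 P) (V : ∀ p : P, TangentSpace (𝓡 4) p)
    (p : P) (x y : Lie3 𝒢) : ℝ :=
  covDeriv V (fun q => dG B g V q x y) p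

/-- `H(v, x, y)`. -/
def hV (B : PrincipalBundle 𝒢 P M) (H : ThreeForm P) (V : ∀ p : P, TangentSpace (𝓡 4) p)
    (p : P) (x y : Lie3 𝒢) : ℝ :=
  H p ![V p, vert B p x, vert B p y]

/-- `(D_· H)(·, x, y)`: for a unit field `v` it is `(D_v H)(v, x, y) = D_v (H(v, ·, ·))(x, y)`,
since `∇ᵥv = 0`. -/
def dhV (B : PrincipalBundle 𝒢 P M) (H : ThreeForm P) (V : ∀ p : P, TangentSpace (𝓡 4) p)
    (p : P) (x y : Lie3 𝒢) : ℝ :=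
  covDeriv V (fun q => hV B H V q x y) p

/-- `|DG|²`. -/
def normSqDG (B : PrincipalBundle 𝒢 P M) (g : Metric4 P) (V : ∀ p : P, TangentSpace (𝓡 4) p)
    (p : P) : ℝ :=
  normSq2 B g p (dG B g V p)

/-- `DG(·,·) = tr_G DG`, evaluated on `v`. -/
def trDG (B : PrincipalBundle 𝒢 P M) (g : Metric4 P) (V : ∀ p : P, TangentSpace (𝓡 4) p)
    (p : P) : ℝ :=
  trG B g p (dG B g V p)

/-- `DG_·(x, ·) DG_·(y, ·)`. -/
def dGdG (B : PrincipalBundle 𝒢 P M) (g : Metric4 P) (V : ∀ p : P, TangentSpace (𝓡 4) p)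
    (p : P) (x y : Lie3 𝒢) : ℝ :=
  trG B g p fun c c' => dG B g V p x c * dG B g V p y c'

/-- `tr_g H² = H²(v, v)`, where `H²(X, Y)` is the full contraction of `H(X, ·, ·) H(Y, ·, ·)` over
`𝔊 ⊕ TM`. The `TM`-part does not contribute, as `H(v, v, ·) = 0`. -/
def trHsq (B : PrincipalBundle 𝒢 P M) (g : Metric4 P) (H : ThreeForm P)
    (V : ∀ p : P, TangentSpace (𝓡 4) p) (p : P) : ℝ :=
  normSq2 B g p (hV B H V p)

/-- `H²(v, y)` for `y ∈ 𝔊`; again the `TM`-part of the contraction does not contribute. -/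
def hSqMixed (B : PrincipalBundle 𝒢 P M) (g : Metric4 P) (H : ThreeForm P)
    (V : ∀ p : P, TangentSpace (𝓡 4) p) (p : P) (y : Lie3 𝒢) : ℝ :=
  trG B g p fun c c' => trG B g p fun d d' =>
    hV B H V p c d * H p ![vert B p y, vert B p c', vert B p d']

/-- `H(v, ·₁, ·₂) [·₁, ·₂]`, an element of the fibre of `𝔊`. -/
def hBr (B : PrincipalBundle 𝒢 P M) (g : Metric4 P) (H : ThreeForm P)
    (V : ∀ p : P, TangentSpace (𝓡 4) p) (p : P) : Lie3 𝒢 :=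
  trG B g p fun c c' => trG B g p fun d d' => hV B H V p c d • fibBr c' d'

/-- The covector `D_v G([·, y], ·)`. -/
def dGBr (B : PrincipalBundle 𝒢 P M) (g : Metric4 P)
    (V : ∀ p : P, TangentSpace (𝓡 4) p) (p : P) (y : Lie3 𝒢) : ℝ :=
  trG B g p fun c c' => dG B g V p (fibBr c y) c'

/-- The scalar `S_B`, written with a unit field `v` (through its horizontal lift `V`) and a
`G`-unit vector `η₃` in the centre of the fibre of `𝔊`. -/
def SB (B : PrincipalBundle 𝒢 P M) (g : Metric4 P) (H : ThreeForm P)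
    (V : ∀ p : P, TangentSpace (𝓡 4) p) (p : P) (η₃ : Lie3 𝒢) : ℝ :=
  2 * normSq2 B g p (fun x y => ddG B g V p x y - dGdG B g V p x y
      + trG B g p fun c c' => hV B H V p x c * hV B H V p y c')
  + 2 * normSq2 B g p (fun x y => dhV B H V p x y
      + (trG B g p fun c c' => hV B H V p c x * dG B g V p c' y)
      - trG B g p fun c c' => hV B H V p c y * dG B g V p c' x)
  + normSqBr B g p * (trDG B g V p - 2 * dG B g V p η₃ η₃) ^ 2
  + 2 * normSqBr B g p *
      ((trG B g p fun c c' => dG B g V p c η₃ * dG B g V p c' η₃) - dG B g V p η₃ η₃ ^ 2)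
  + 2 * normSq1 B g p (dGBr B g V p)
  + 2 * normSq1 B g p (fun y => dGBr B g V p y + hSqMixed B g H V p y)
  + 2 * fibG B g p (hBr B g H V p) (hBr B g H V p)
  + 1 / 3 * normSqHfib B g H p * trDG B g V p ^ 2

/-- `S_B` vanishes identically: at every point, in terms of any local unit field and any unit
vector `η₃` in the centre (`S_B` does not depend on these choices). -/
def SBVanishes (B : PrincipalBundle 𝒢 P M) (g : Metric4 P) (H : ThreeForm P) : Prop :=
  ∀ (U : Set M) (V : ∀ p : P, TangentSpace (𝓡 4) p), IsOpen U → IsUnitHorizontal B g U V →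
    ∀ p ∈ B.proj ⁻¹' U, ∀ η₃ ∈ centre 𝒢, fibG B g p η₃ η₃ = 1 → SB B g H V p η₃ = 0

end Bundle

end NilBundle

end

open scoped Manifold ContDiff

set_option linter.unusedSectionVars false

noncomputable section

/-! Every summand of `SB` is nonnegative; for the one containing DG(·, η₃) this is Cauchy-Schwarz
(`sq_dG_le`). So each summand vanishes separately (`terms_eq_zero_of_SB`). Write G for the Gram
matrix of the fibre metric, A = D_v G and h = H(v, ·, ·). The first summand gives D_v A − A G⁻¹ A =
−h G⁻¹ hᵀ. After multiplication by G⁻¹ the trace of the left side is the second derivative of log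
det G along v, and that of the right side is −tr_g H² ≤ 0 (`FlowsAt.hasDerivAt_trDG_of_SB`).

Nilpotency of 𝒢 makes every Ad a unipotent, so det Ad a = 1 and log det G is a function on the base.
It has a minimum on each component of the compact M, and a concave function of one variable is
constant near an interior minimum; so the set of minima is open and closed, and log det G is locally
constant (`logDet_eventually_eq`). Therefore tr DG = 0, then tr_g H² = 0, h = 0 and D_v A = A G⁻¹ A.
The last equation says that the endomorphism N = G⁻¹ A is parallel, so |DG|² = tr N² is constant.

Unipotency also makes 𝔤 unimodular and provides a nonzero central vector fixed by Ad. If 𝔤 is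
nonabelian, the centre and the derived algebra are then the same line
(`centre_and_derived_of_unimodular`). Since |[,]|² ≠ 0 and tr DG = 0, the two summands with that
factor force DG(·, η₃) = 0. Thus N is selfadjoint and traceless with η₃ in its kernel, and
Cayley-Hamilton gives N² = ½ tr N² on the orthogonal complement (`sq_eq_on_orthogonal`). If 𝔤 is
abelian, the centre is everything and the statements about the splitting are trivial.

For the other two norms, |[,]|² is a constant multiple of G(z₀, z₀)² / det G, with z₀ central, and
|H^𝔊|² = 6 k² / det G, where k is the value of H on the vertical fields of a fixed basis of 𝔤. From
ι_V H = 0 and dH = 0 follows L_V H = 0; as V commutes with the vertical fields, k is constant along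
V.

Derivatives along V are mostly computed on integral curves of V, which reduces them to one-variable
calculus with 3 × 3 matrices. -/

namespace NilBundle

/-! ### Contractions of forms against an inverse Gram matrix. -/

section MatrixAlgebra

open Matrix
open scoped MatrixOrder Matrix.Norms.L2Operator

/-- The full contraction `|T|²` of a bilinear form with matrix `T`, the inverse metric being `S`. -/
def contr2 (S T : Matrix (Fin 3) (Fin 3) ℝ) : ℝ :=
  ∑ i, ∑ j, S i j * ∑ k, ∑ l, S k l * (T i k * T j l)

theorem contr2_eq_trace {S : Matrix (Fin 3) (Fin 3) ℝ} (hS : Sᵀ = S) (T : Matrix (Fin 3) (Fin 3) ℝ) :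
    contr2 S T = trace (S * T * S * Tᵀ) := by
  have h : ∀ i j, S i j = S j i := fun i j => by conv_lhs => rw [← hS, transpose_apply]
  simp only [contr2, trace, diag, mul_apply, transpose_apply, Fin.sum_univ_three,
    h 1 0, h 2 0, h 2 1]
  ring

/-- A square root of the positive operator. `B` plays the role of an orthonormal coframe:
conjugation by it turns contractions with `S` into Frobenius norms. -/
theorem exists_factor {S : Matrix (Fin 3) (Fin 3) ℝ} (hS : S.PosDef) :
    ∃ B : Matrix (Fin 3) (Fin 3) ℝ, S = Bᵀ * B ∧ IsUnit B.det := by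
  obtain ⟨B, hB⟩ := CStarAlgebra.nonneg_iff_eq_star_mul_self.mp
    (Matrix.nonneg_iff_posSemidef.2 hS.posSemidef)
  refine ⟨B, hB, ?_⟩
  have h := hS.det_pos.ne'
  rw [hB, det_mul] at h
  exact (right_ne_zero_of_mul h).isUnit

theorem contr2_factor (B T : Matrix (Fin 3) (Fin 3) ℝ) :
    contr2 (Bᵀ * B) T = trace ((B * T * Bᵀ) * (B * T * Bᵀ)ᵀ) := by
  rw [contr2_eq_trace (by simp)]
  simp only [transpose_mul, transpose_transpose, Matrix.mul_assoc]
  rw [trace_mul_comm]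
  simp only [Matrix.mul_assoc]

theorem contr2_nonneg {S : Matrix (Fin 3) (Fin 3) ℝ} (hS : S.PosDef)
    (T : Matrix (Fin 3) (Fin 3) ℝ) : 0 ≤ contr2 S T := by
  obtain ⟨B, rfl, -⟩ := exists_factor hS
  rw [contr2_factor]
  exact (posSemidef_self_mul_conjTranspose (B * T * Bᵀ)).trace_nonneg

theorem contr2_eq_zero {S : Matrix (Fin 3) (Fin 3) ℝ} (hS : S.PosDef)
    {T : Matrix (Fin 3) (Fin 3) ℝ} (h : contr2 S T = 0) : T = 0 := by
  obtain ⟨B, rfl, hB⟩ := exists_factor hS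
  rw [contr2_factor] at h
  have h0 : B * T * Bᵀ = 0 := trace_mul_conjTranspose_self_eq_zero_iff.mp h
  have hBt : IsUnit Bᵀ.det := by rwa [det_transpose]
  calc T = B⁻¹ * (B * T * Bᵀ) * Bᵀ⁻¹ := by
        rw [Matrix.mul_assoc, Matrix.mul_assoc, mul_nonsing_inv _ hBt, Matrix.mul_one,
          nonsing_inv_mul_cancel_left _ _ hB]
    _ = 0 := by rw [h0]; simp

/-- Cauchy-Schwarz between a covector and a unit vector, obtained by expanding 0 ≤ |α − (η·α) Gη|²
in the inverse metric. -/
theorem inv_contr2_cauchy {G : Matrix (Fin 3) (Fin 3) ℝ} (hG : G.PosDef) (α η : Fin 3 → ℝ)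
    (hη : η ⬝ᵥ G *ᵥ η = 1) : (η ⬝ᵥ α) ^ 2 ≤ α ⬝ᵥ G⁻¹ *ᵥ α := by
  have hdet : IsUnit G.det := hG.det_pos.ne'.isUnit
  have hS := hG.inv.posSemidef.dotProduct_mulVec_nonneg (α - (η ⬝ᵥ α) • G *ᵥ η)
  have hGt : Gᵀ = G := hG.isHermitian
  have e1 : G⁻¹ *ᵥ (G *ᵥ η) = η := by simp [mulVec_mulVec, nonsing_inv_mul _ hdet]
  have e2 : (G *ᵥ η) ⬝ᵥ G⁻¹ *ᵥ α = η ⬝ᵥ α := by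
    rw [dotProduct_mulVec, ← mulVec_transpose, transpose_nonsing_inv, hGt, e1]
  have e3 : (G *ᵥ η) ⬝ᵥ η = 1 := by rw [dotProduct_comm, hη]
  simp only [star_trivial, mulVec_sub, mulVec_smul, e1, sub_dotProduct, dotProduct_sub,
    smul_dotProduct, dotProduct_smul, smul_eq_mul, e2, e3] at hS
  rw [dotProduct_comm α η] at hS
  nlinarith

theorem inv_dotProduct_eq_zero {G : Matrix (Fin 3) (Fin 3) ℝ} (hG : G.PosDef) {α : Fin 3 → ℝ}
    (h : α ⬝ᵥ G⁻¹ *ᵥ α = 0) : α = 0 := by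
  by_contra hα
  have := hG.inv.dotProduct_mulVec_pos hα
  simp only [star_trivial] at this
  exact this.ne' h

/-- `∑ S S S ε ε = 6 det S`. -/
theorem triple_contraction (S : Matrix (Fin 3) (Fin 3) ℝ) (T : Fin 3 → Fin 3 → Fin 3 → ℝ)
    (h1 : ∀ i j, T i i j = 0) (h2 : ∀ i j k, T j i k = - T i j k)
    (h3 : ∀ i j k, T i k j = - T i j k) :
    ∑ i, ∑ j, S i j * ∑ k, ∑ l, S k l * ∑ m, ∑ n, S m n * (T i k m * T j l n)
      = 6 * S.det * T 0 1 2 ^ 2 := by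
  have h4 : ∀ i j, T i j i = 0 := fun i j => by rw [h3, h1, neg_zero]
  have h5 : ∀ i j, T j i i = 0 := fun i j => by rw [h2, h4, neg_zero]
  have e1 : T 1 0 2 = - T 0 1 2 := h2 _ _ _
  have e2 : T 0 2 1 = - T 0 1 2 := h3 _ _ _
  have e3 : T 1 2 0 = T 0 1 2 := by rw [h3, e1, neg_neg]
  have e4 : T 2 0 1 = T 0 1 2 := by rw [h2, e2, neg_neg]
  have e5 : T 2 1 0 = - T 0 1 2 := by rw [h3, e4]
  simp only [Fin.sum_univ_three, h1, h4, h5, e1, e2, e3, e4, e5, det_fin_three]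
  ring

/-- Contraction of two copies of an antisymmetric form. -/
theorem double_contraction {G : Matrix (Fin 3) (Fin 3) ℝ} (hG : G.PosDef)
    (w : Matrix (Fin 3) (Fin 3) ℝ) (hw : ∀ i j, w j i = - w i j) :
    contr2 G⁻¹ w = 2 * (G.det)⁻¹ * (![w 1 2, w 2 0, w 0 1] ⬝ᵥ G *ᵥ ![w 1 2, w 2 0, w 0 1]) := by
  have hdet : G.det ≠ 0 := hG.det_pos.ne'
  have h0 : ∀ i, w i i = 0 := fun i => by have := hw i i; linarith
  have h : ∀ i j, G i j = G j i := fun i j => by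
    conv_lhs => rw [← (show Gᵀ = G from hG.isHermitian), transpose_apply]
  -- With the adjugate in place of G⁻¹ this is a polynomial identity in the entries; the vector is
  -- the dual of the two-form `w`.
  have hc : contr2 (adjugate G) w = 2 * G.det *
      (![w 1 2, w 2 0, w 0 1] ⬝ᵥ G *ᵥ ![w 1 2, w 2 0, w 0 1]) := by
    simp [contr2, adjugate_fin_three, Fin.sum_univ_three, dotProduct, mulVec, h0, hw 0 1, hw 0 2,
      hw 1 2, det_fin_three, h 1 0, h 2 0, h 2 1]
    ring
  have hs : contr2 G⁻¹ w = (G.det)⁻¹ ^ 2 * contr2 (adjugate G) w := by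
    simp only [contr2, inv_def, Ring.inverse_eq_inv', Matrix.smul_apply, smul_eq_mul, Fin.sum_univ_three]
    ring
  rw [hs, hc]
  field_simp

end MatrixAlgebra

/-! ### Determinants, inverses and traces along curves of matrices. -/

section MatrixCurves

open Matrix

variable {G : ℝ → Matrix (Fin 3) (Fin 3) ℝ} {A : Matrix (Fin 3) (Fin 3) ℝ} {t : ℝ}

/-- Jacobi's formula: the derivative is tr(adj(G) A), and adj(G) = det G · G⁻¹. -/
theorem hasDerivAt_det_curve (hG : ∀ i j, HasDerivAt (fun s => G s i j) (A i j) t)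
    (h0 : (G t).det ≠ 0) :
    HasDerivAt (fun s => (G s).det) ((G t).det * trace ((G t)⁻¹ * A)) t := by
  have e : (G t).det * trace ((G t)⁻¹ * A) = trace (adjugate (G t) * A) := by
    rw [inv_def, Ring.inverse_eq_inv', Matrix.smul_mul, trace_smul, smul_eq_mul,
      mul_inv_cancel_left₀ h0]
  rw [e]
  rw [show (fun s => (G s).det) = _ from funext fun s => det_fin_three (G s)]
  have := ((((((hG 0 0).mul (hG 1 1)).mul (hG 2 2)).sub (((hG 0 0).mul (hG 1 2)).mul (hG 2 1))).sub
    (((hG 0 1).mul (hG 1 0)).mul (hG 2 2))).add (((hG 0 1).mul (hG 1 2)).mul (hG 2 0))).add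
    (((hG 0 2).mul (hG 1 0)).mul (hG 2 1)) |>.sub (((hG 0 2).mul (hG 1 1)).mul (hG 2 0))
  refine HasDerivAt.congr_deriv this ?_
  simp [trace, adjugate_fin_three, Fin.sum_univ_three, vecMul, dotProduct]
  ring

open scoped Matrix.Norms.Operator in
theorem hasDerivAt_inv_entry (hG : ∀ i j, HasDerivAt (fun s => G s i j) (A i j) t)
    (h0 : (G t).det ≠ 0) (i j : Fin 3) :
    HasDerivAt (fun s => (G s)⁻¹ i j) (-((G t)⁻¹ * A * (G t)⁻¹) i j) t := by
  have hG' : HasDerivAt G A t := hasDerivAt_pi.2 fun i => hasDerivAt_pi.2 fun j => hG i j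
  have hu : IsUnit (G t) := (isUnit_iff_isUnit_det _).2 h0.isUnit
  obtain ⟨u, hu⟩ := hu
  have := (hasFDerivAt_ringInverse (𝕜 := ℝ) u)
  rw [hu] at this
  have h2 := this.comp_hasDerivAt t hG'
  have h3 := hasDerivAt_pi.1 (hasDerivAt_pi.1 h2 i) j
  have hui : (↑u⁻¹ : Matrix (Fin 3) (Fin 3) ℝ) = (G t)⁻¹ := by
    rw [← hu, coe_units_inv]
  rw [show (fun s => (G s)⁻¹ i j) = fun s => Ring.inverse (G s) i j from
    funext fun s => by rw [nonsing_inv_eq_ringInverse]]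
  refine HasDerivAt.congr_deriv h3 ?_
  rw [← hui]
  simp

theorem hasDerivAt_mul_entry {F K : ℝ → Matrix (Fin 3) (Fin 3) ℝ}
    {F' K' : Matrix (Fin 3) (Fin 3) ℝ}
    (hF : ∀ i j, HasDerivAt (fun s => F s i j) (F' i j) t)
    (hK : ∀ i j, HasDerivAt (fun s => K s i j) (K' i j) t) (i j : Fin 3) :
    HasDerivAt (fun s => (F s * K s) i j) ((F' * K t + F t * K') i j) t := by
  simp only [mul_apply, Matrix.add_apply, ← Finset.sum_add_distrib]
  exact HasDerivAt.fun_sum fun k _ => (hF i k).fun_mul (hK k j)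

theorem hasDerivAt_trace_entry {F : ℝ → Matrix (Fin 3) (Fin 3) ℝ} {F' : Matrix (Fin 3) (Fin 3) ℝ}
    (hF : ∀ i j, HasDerivAt (fun s => F s i j) (F' i j) t) :
    HasDerivAt (fun s => trace (F s)) (trace F') t := by
  simp only [trace, diag]
  exact HasDerivAt.fun_sum fun k _ => hF k k

variable {F : ℝ → Matrix (Fin 3) (Fin 3) ℝ} {B : Matrix (Fin 3) (Fin 3) ℝ}

/-- The derivative of the endomorphism `G⁻¹ F`. -/
theorem hasDerivAt_inv_mul (hG : ∀ i j, HasDerivAt (fun s => G s i j) (A i j) t)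
    (hF : ∀ i j, HasDerivAt (fun s => F s i j) (B i j) t) (h0 : (G t).det ≠ 0) (i j : Fin 3) :
    HasDerivAt (fun s => ((G s)⁻¹ * F s) i j)
      (((G t)⁻¹ * (B - A * (G t)⁻¹ * F t)) i j) t := by
  have := hasDerivAt_mul_entry (F := fun s => (G s)⁻¹) (F' := -((G t)⁻¹ * A * (G t)⁻¹))
    (hasDerivAt_inv_entry hG h0) hF i j
  convert this using 2
  simp only [Matrix.mul_sub, Matrix.neg_mul, Matrix.mul_assoc]
  exact sub_eq_neg_add _ _

end MatrixCurves

/-! ### The minimum principle in one variable. -/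

/-- A function which is concave near an interior local minimum is constant near it. -/
theorem eventually_const_of_concave {u φ ψ : ℝ → ℝ} {t₀ : ℝ}
    (hu : ∀ᶠ t in nhds t₀, HasDerivAt u (φ t) t) (hφ : ∀ᶠ t in nhds t₀, HasDerivAt φ (ψ t) t)
    (hψ : ∀ᶠ t in nhds t₀, ψ t ≤ 0) (hmin : IsLocalMin u t₀) :
    ∀ᶠ t in nhds t₀, u t = u t₀ := by
  have hφ0 : φ t₀ = 0 := hmin.hasDerivAt_eq_zero hu.self_of_nhds
  have hmin' : ∀ᶠ t in nhds t₀, u t₀ ≤ u t := hmin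
  obtain ⟨ε, hε, h⟩ := Metric.eventually_nhds_iff_ball.1 (hu.and (hφ.and (hψ.and hmin')))
  refine Metric.eventually_nhds_iff_ball.2 ⟨ε, hε, fun t ht => ?_⟩
  have hconv : Convex ℝ (Metric.ball t₀ ε) := convex_ball _ _
  -- The derivative `φ` decreases and vanishes at `t₀`, so `u` increases before `t₀` and decreases
  -- after it. Hence `u t ≤ u t₀`, against the minimum.
  have hanti : AntitoneOn φ (Metric.ball t₀ ε) :=
    antitoneOn_of_deriv_nonpos hconv (fun s hs => (h s hs).2.1.continuousAt.continuousWithinAt)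
      (fun s hs => (h s (interior_subset hs)).2.1.differentiableAt.differentiableWithinAt)
      (fun s hs => by rw [(h s (interior_subset hs)).2.1.deriv]; exact (h s (interior_subset hs)).2.2.1)
  have h0 : t₀ ∈ Metric.ball t₀ ε := Metric.mem_ball_self hε
  refine le_antisymm ?_ (h t ht).2.2.2
  rcases le_total t₀ t with hle | hle
  · have hsub : Set.Icc t₀ t ⊆ Metric.ball t₀ ε := hconv.ordConnected.out h0 ht
    have : AntitoneOn u (Set.Icc t₀ t) :=
      antitoneOn_of_deriv_nonpos (convex_Icc _ _)
        (fun s hs => (h s (hsub hs)).1.continuousAt.continuousWithinAt)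
        (fun s hs => (h s (hsub (interior_subset hs))).1.differentiableAt.differentiableWithinAt)
        (fun s hs => by
          have hs' := interior_subset hs
          rw [(h s (hsub hs')).1.deriv, ← hφ0]
          exact hanti h0 (hsub hs') hs'.1)
    exact this (Set.left_mem_Icc.2 hle) (Set.right_mem_Icc.2 hle) hle
  · have hsub : Set.Icc t t₀ ⊆ Metric.ball t₀ ε := hconv.ordConnected.out ht h0
    have : MonotoneOn u (Set.Icc t t₀) :=
      monotoneOn_of_deriv_nonneg (convex_Icc _ _)
        (fun s hs => (h s (hsub hs)).1.continuousAt.continuousWithinAt)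
        (fun s hs => (h s (hsub (interior_subset hs))).1.differentiableAt.differentiableWithinAt)
        (fun s hs => by
          have hs' := interior_subset hs
          rw [(h s (hsub hs')).1.deriv, ← hφ0]
          exact hanti (hsub hs') h0 hs'.2)
    exact this (Set.left_mem_Icc.2 hle) (Set.right_mem_Icc.2 hle) hle

/-! ### Symmetry of mixed partial derivatives on a product. -/

section SymmetricDerivatives

variable {E₁ E₂ E₃ : Type*} [NormedAddCommGroup E₁] [NormedSpace ℝ E₁] [NormedAddCommGroup E₂]
  [NormedSpace ℝ E₂] [NormedAddCommGroup E₃] [NormedSpace ℝ E₃]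

/-- The mixed second derivatives of a `C²` map agree. -/
theorem exists_mixed_derivative {A : E₁ × E₂ → E₃} {x₀ : E₁} {s₀ : E₂}
    (hA : ContDiffAt ℝ 2 A (x₀, s₀)) :
    ∃ L : E₂ →L[ℝ] E₁ →L[ℝ] E₃,
      HasFDerivAt (fun s => fderiv ℝ (fun x => A (x, s)) x₀) L s₀ ∧
      HasFDerivAt (fun x => fderiv ℝ (fun s => A (x, s)) s₀) L.flip x₀ := by
  have hd : ∀ᶠ z in nhds (x₀, s₀), DifferentiableAt ℝ A z :=
    (hA.eventually (by simp)).mono fun z hz => hz.differentiableAt (by norm_num)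
  have hD : HasFDerivAt (fderiv ℝ A) (fderiv ℝ (fderiv ℝ A) (x₀, s₀)) (x₀, s₀) :=
    ((hA.fderiv_right (m := 1) (by norm_num)).differentiableAt (by norm_num)).hasFDerivAt
  have hsym := hA.isSymmSndFDerivAt (by simp)
  set D2 := fderiv ℝ (fderiv ℝ A) (x₀, s₀)
  -- This is L s x = D²A (0, s) (x, 0), written as a composition of continuous linear maps.
  refine ⟨((ContinuousLinearMap.compL ℝ E₁ (E₁ × E₂) E₃).flip
    (ContinuousLinearMap.inl ℝ E₁ E₂)).comp (D2.comp (ContinuousLinearMap.inr ℝ E₁ E₂)), ?_, ?_⟩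
  · have h1 : HasFDerivAt (fun s => (fderiv ℝ A (x₀, s)).comp (ContinuousLinearMap.inl ℝ E₁ E₂))
        (((ContinuousLinearMap.compL ℝ E₁ (E₁ × E₂) E₃).flip
          (ContinuousLinearMap.inl ℝ E₁ E₂)).comp (D2.comp (ContinuousLinearMap.inr ℝ E₁ E₂))) s₀ :=
      (((ContinuousLinearMap.compL ℝ E₁ (E₁ × E₂) E₃).flip
          (ContinuousLinearMap.inl ℝ E₁ E₂)).hasFDerivAt).comp s₀
        (hD.comp s₀ (hasFDerivAt_prodMk_right x₀ s₀))
    refine h1.congr_of_eventuallyEq ?_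
    have hc : Filter.Tendsto (fun s : E₂ => (x₀, s)) (nhds s₀) (nhds (x₀, s₀)) :=
      (Continuous.prodMk_right x₀).tendsto s₀
    filter_upwards [hc.eventually hd] with s hs
    exact (hs.hasFDerivAt.comp x₀ (hasFDerivAt_prodMk_left x₀ s)).fderiv
  · have h1 : HasFDerivAt (fun x => (fderiv ℝ A (x, s₀)).comp (ContinuousLinearMap.inr ℝ E₁ E₂))
        (((ContinuousLinearMap.compL ℝ E₂ (E₁ × E₂) E₃).flip
          (ContinuousLinearMap.inr ℝ E₁ E₂)).comp (D2.comp (ContinuousLinearMap.inl ℝ E₁ E₂))) x₀ :=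
      (((ContinuousLinearMap.compL ℝ E₂ (E₁ × E₂) E₃).flip
          (ContinuousLinearMap.inr ℝ E₁ E₂)).hasFDerivAt).comp x₀
        (hD.comp x₀ (hasFDerivAt_prodMk_left x₀ s₀))
    have e : ((ContinuousLinearMap.compL ℝ E₂ (E₁ × E₂) E₃).flip
          (ContinuousLinearMap.inr ℝ E₁ E₂)).comp (D2.comp (ContinuousLinearMap.inl ℝ E₁ E₂))
        = (((ContinuousLinearMap.compL ℝ E₁ (E₁ × E₂) E₃).flip
    (ContinuousLinearMap.inl ℝ E₁ E₂)).comp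
      (D2.comp (ContinuousLinearMap.inr ℝ E₁ E₂))).flip := by
      ext x s
      simpa using hsym (x, 0) (0, s)
    rw [← e]
    refine h1.congr_of_eventuallyEq ?_
    have hc : Filter.Tendsto (fun x : E₁ => (x, s₀)) (nhds x₀) (nhds (x₀, s₀)) :=
      (Continuous.prodMk_left s₀).tendsto x₀
    filter_upwards [hc.eventually hd] with x hx
    exact (hx.hasFDerivAt.comp s₀ (hasFDerivAt_prodMk_right x s₀)).fderiv

end SymmetricDerivatives

/-! ### Cartan's formula for a closed three-form, in coordinates. -/

section LieDerivative

variable {E : Type*} [NormedAddCommGroup E] [NormedSpace ℝ E]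

theorem fderiv_three_form_apply {β : E → E [⋀^Fin 3]→L[ℝ] ℝ} {a b c : E → E} {x : E}
    (hβ : DifferentiableAt ℝ β x) (ha : DifferentiableAt ℝ a x) (hb : DifferentiableAt ℝ b x)
    (hc : DifferentiableAt ℝ c x) (v : E) :
    fderiv ℝ (fun y => β y ![a y, b y, c y]) x v =
      fderiv ℝ β x v ![a x, b x, c x] + (β x ![fderiv ℝ a x v, b x, c x] +
        β x ![a x, fderiv ℝ b x v, c x] + β x ![a x, b x, fderiv ℝ c x v]) := by
  have e : ∀ y, (fun i => (![a, b, c] : Fin 3 → E → E) i y) = ![a y, b y, c y] := fun y => by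
    ext i; fin_cases i <;> rfl
  have := fderiv_continuousAlternatingMap_apply_apply (g := ![a, b, c]) hβ
    (by intro i; fin_cases i <;> assumption) v
  simp only [e] at this
  rw [this, Fin.sum_univ_three]
  have u0 : ∀ p q r s : E, Function.update ![p, q, r] 0 s = ![s, q, r] := fun p q r s => by
    ext i; fin_cases i <;> rfl
  have u1 : ∀ p q r s : E, Function.update ![p, q, r] 1 s = ![p, s, r] := fun p q r s => by
    ext i; fin_cases i <;> rfl
  have u2 : ∀ p q r s : E, Function.update ![p, q, r] 2 s = ![p, q, s] := fun p q r s => by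
    ext i; fin_cases i <;> rfl
  rw [u0, u1, u2]
  rfl

theorem three_form_swap01 {F : Type*} [AddCommGroup F] [Module ℝ F] [TopologicalSpace F]
    (β : F [⋀^Fin 3]→L[ℝ] ℝ) (a b c : F) : β ![b, a, c] = - β ![a, b, c] := by
  have := β.toAlternatingMap.map_swap ![a, b, c] (i := 0) (j := 1) (by decide)
  rw [show (![a, b, c] ∘ Equiv.swap (0 : Fin 3) 1) = ![b, a, c] by
    ext i; fin_cases i <;> simp [Equiv.swap_apply_def]] at this
  exact this

theorem three_form_swap12 {F : Type*} [AddCommGroup F] [Module ℝ F] [TopologicalSpace F]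
    (β : F [⋀^Fin 3]→L[ℝ] ℝ) (a b c : F) : β ![a, c, b] = - β ![a, b, c] := by
  have := β.toAlternatingMap.map_swap ![a, b, c] (i := 1) (j := 2) (by decide)
  rw [show (![a, b, c] ∘ Equiv.swap (1 : Fin 3) 2) = ![a, c, b] by
    ext i; fin_cases i <;> simp [Equiv.swap_apply_def]] at this
  exact this

theorem three_form_self {F : Type*} [AddCommGroup F] [Module ℝ F] [TopologicalSpace F]
    (β : F [⋀^Fin 3]→L[ℝ] ℝ) (a b : F) : β ![a, a, b] = 0 := by
  have := three_form_swap01 β a a b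
  linarith

/-- If `β` is a closed three-form with `ι_V β = 0` near `x`, then `L_V β = 0` at `x`; hence
`β(X₁, X₂, X₃)` has vanishing derivative along `V` for vector fields `Xᵢ` commuting with `V`. -/
theorem fderiv_closed_form_eq_zero {β : E → E [⋀^Fin 3]→L[ℝ] ℝ} {V X Y Z : E → E}
    {x : E} (hβ : DifferentiableAt ℝ β x) (hV : DifferentiableAt ℝ V x)
    (hX : DifferentiableAt ℝ X x) (hY : DifferentiableAt ℝ Y x) (hZ : DifferentiableAt ℝ Z x)
    (hd : extDeriv β x = 0)
    (hι : ∀ᶠ y in nhds x, ∀ u w, β y ![V y, u, w] = 0)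
    (cX : fderiv ℝ X x (V x) = fderiv ℝ V x (X x))
    (cY : fderiv ℝ Y x (V x) = fderiv ℝ V x (Y x))
    (cZ : fderiv ℝ Z x (V x) = fderiv ℝ V x (Z x)) :
    fderiv ℝ (fun y => β y ![X y, Y y, Z y]) x (V x) = 0 := by
  have hι0 := hι.self_of_nhds
  -- Differentiating ι_V β = 0 with constant `u`, `w` moves the derivative from `β` to `V`.
  have key : ∀ u w v : E, fderiv ℝ β x v ![V x, u, w] = - β x ![fderiv ℝ V x v, u, w] := by
    intro u w v
    have h1 := fderiv_three_form_apply hβ hV (differentiableAt_const u)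
      (differentiableAt_const w) v
    have h2 : (fun y => β y ![V y, u, w]) =ᶠ[nhds x] fun _ => 0 := hι.mono fun y hy => hy u w
    rw [h2.fderiv_eq] at h1
    simp only [fderiv_fun_const, Pi.zero_apply, _root_.zero_apply, hι0] at h1
    linarith
  -- Of the four terms of dβ(V, X, Y, Z), three still contain `V` as an argument and are rewritten
  -- by `key`; the fourth is (D_V β)(X, Y, Z).
  have hd' : extDeriv β x ![V x, X x, Y x, Z x] = 0 := by rw [hd]; rfl
  rw [extDeriv_apply hβ, Fin.sum_univ_four] at hd'
  have r0 : (0 : Fin 4).removeNth ![V x, X x, Y x, Z x] = ![X x, Y x, Z x] := by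
    ext i; fin_cases i <;> rfl
  have r1 : (1 : Fin 4).removeNth ![V x, X x, Y x, Z x] = ![V x, Y x, Z x] := by
    ext i; fin_cases i <;> rfl
  have r2 : (2 : Fin 4).removeNth ![V x, X x, Y x, Z x] = ![V x, X x, Z x] := by
    ext i; fin_cases i <;> rfl
  have r3 : (3 : Fin 4).removeNth ![V x, X x, Y x, Z x] = ![V x, X x, Y x] := by
    ext i; fin_cases i <;> rfl
  simp only [fderiv_continuousAlternatingMap_apply_const hβ] at hd'
  rw [r0, r1, r2, r3] at hd'
  simp [key] at hd'
  -- Since the fields commute with `V`, the Leibniz terms D_V X become D_X V and cancel those found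
  -- from dβ = 0, up to reordering of arguments.
  rw [fderiv_three_form_apply hβ hX hY hZ, cX, cY, cZ]
  rw [three_form_swap12 _ (X x) (fderiv ℝ V x (Z x)) (Y x), three_form_swap01 _
    (fderiv ℝ V x (Z x)) (X x), three_form_swap01 _ (fderiv ℝ V x (Y x)) (X x)]
  linarith

end LieDerivative

/-! ### Vector fields, brackets and locally constant maps in charts. -/

section Charts

variable {n k : ℕ} {N : Type*} [TopologicalSpace N] [ChartedSpace (EuclideanSpace ℝ (Fin n)) N]
  {N' : Type*} [TopologicalSpace N'] [ChartedSpace (EuclideanSpace ℝ (Fin k)) N']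
  {F : Type*} [NormedAddCommGroup F] [NormedSpace ℝ F]

/-- The derivative at the base point of a chart, in that chart. -/
theorem mfderiv_eq_fderiv_chart {f : N → F} {p : N} (hf : MDifferentiableAt (𝓡 n) 𝓘(ℝ, F) f p)
    (v : EuclideanSpace ℝ (Fin n)) :
    mfderiv (𝓡 n) 𝓘(ℝ, F) f p v =
      fderiv ℝ (fun x => f ((extChartAt (𝓡 n) p).symm x)) (extChartAt (𝓡 n) p p) v := by
  let L : EuclideanSpace ℝ (Fin n) →L[ℝ] F := mfderiv (𝓡 n) 𝓘(ℝ, F) f p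
  have h : HasFDerivWithinAt (fun x => f ((extChartAt (𝓡 n) p).symm x)) L (Set.range (𝓡 n))
    (extChartAt (𝓡 n) p p) := hf.hasMFDerivAt.2
  have h' : HasFDerivAt (fun x => f ((extChartAt (𝓡 n) p).symm x)) L (extChartAt (𝓡 n) p p) := by
    rwa [ModelWithCorners.range_eq_univ, hasFDerivWithinAt_univ] at h
  exact (congrArg (fun L : EuclideanSpace ℝ (Fin n) →L[ℝ] F => L v) h'.fderiv).symm

/-- A vector field in a chart. -/
def chartField (p₀ : N) (V : ∀ p : N, TangentSpace (𝓡 n) p) (x : EuclideanSpace ℝ (Fin n)) :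
    EuclideanSpace ℝ (Fin n) :=
  mfderiv (𝓡 n) 𝓘(ℝ, EuclideanSpace ℝ (Fin n)) (extChartAt (𝓡 n) p₀)
    ((extChartAt (𝓡 n) p₀).symm x) (V ((extChartAt (𝓡 n) p₀).symm x))

theorem chart_target_mem_nhds (p₀ : N) :
    (extChartAt (𝓡 n) p₀).target ∈ nhds (extChartAt (𝓡 n) p₀ p₀) :=
  extChartAt_target_mem_nhds p₀

variable [IsManifold (𝓡 n) ∞ N] [IsManifold (𝓡 k) ∞ N']

theorem isManifold_one (n : ℕ) (N : Type*) [TopologicalSpace N]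
    [ChartedSpace (EuclideanSpace ℝ (Fin n)) N] [IsManifold (𝓡 n) ∞ N] : IsManifold (𝓡 n) 1 N := IsManifold.of_le (n := ∞) (by norm_num)

theorem mfderiv_chart_symm_apply {p₀ : N} {x : EuclideanSpace ℝ (Fin n)}
    (hx : x ∈ (extChartAt (𝓡 n) p₀).target)
    (v : TangentSpace (𝓡 n) ((extChartAt (𝓡 n) p₀).symm x)) :
    mfderiv 𝓘(ℝ, EuclideanSpace ℝ (Fin n)) (𝓡 n) (extChartAt (𝓡 n) p₀).symm x
      (mfderiv (𝓡 n) 𝓘(ℝ, EuclideanSpace ℝ (Fin n)) (extChartAt (𝓡 n) p₀)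
        ((extChartAt (𝓡 n) p₀).symm x) v) = v := by
  have : IsManifold (𝓡 n) 1 N := isManifold_one n N
  have := mfderivWithin_extChartAt_symm_comp_mfderiv_extChartAt hx
  rw [ModelWithCorners.range_eq_univ, mfderivWithin_univ] at this
  exact congrArg (fun L : TangentSpace (𝓡 n) ((extChartAt (𝓡 n) p₀).symm x) →L[ℝ]
    TangentSpace (𝓡 n) ((extChartAt (𝓡 n) p₀).symm x) => L v) this

/-- Pullback along the inverse chart applies the inverse of the derivative of that map, which is the
derivative of the chart. This links `chartField` to the definition of the Lie bracket on a manifold.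
-/
theorem chartField_eq_mpullback {p₀ : N} (V : ∀ p : N, TangentSpace (𝓡 n) p)
    {x : EuclideanSpace ℝ (Fin n)} (hx : x ∈ (extChartAt (𝓡 n) p₀).target) :
    VectorField.mpullbackWithin 𝓘(ℝ, EuclideanSpace ℝ (Fin n)) (𝓡 n) (extChartAt (𝓡 n) p₀).symm V
      (Set.range (𝓡 n)) x = chartField p₀ V x := by
  have : IsManifold (𝓡 n) 1 N := isManifold_one n N
  rw [VectorField.mpullbackWithin_apply, ContinuousLinearMap.inverse_eq
    (mfderivWithin_extChartAt_symm_comp_mfderiv_extChartAt hx)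
    (mfderiv_extChartAt_comp_mfderivWithin_extChartAt_symm hx)]
  rfl

/-- The Lie bracket in the chart at the base point. -/
theorem mlieBracket_eq_chart (V W : ∀ p : N, TangentSpace (𝓡 n) p) (p₀ : N) :
    (VectorField.mlieBracket (𝓡 n) V W p₀ : EuclideanSpace ℝ (Fin n)) =
      fderiv ℝ (chartField p₀ W) (extChartAt (𝓡 n) p₀ p₀) (V p₀) -
        fderiv ℝ (chartField p₀ V) (extChartAt (𝓡 n) p₀ p₀) (W p₀) := by
  have : IsManifold (𝓡 n) 1 N := isManifold_one n N
  have hT := chart_target_mem_nhds (n := n) p₀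
  have base : ∀ Y : (∀ p : N, TangentSpace (𝓡 n) p),
      chartField p₀ Y (extChartAt (𝓡 n) p₀ p₀) = Y p₀ := by
    intro Y
    unfold chartField
    rw [extChartAt_to_inv, mfderiv_extChartAt_self]
    rfl
  let f : (∀ p : N, TangentSpace (𝓡 n) p) → EuclideanSpace ℝ (Fin n) → EuclideanSpace ℝ (Fin n) :=
    fun Y => VectorField.mpullbackWithin 𝓘(ℝ, EuclideanSpace ℝ (Fin n)) (𝓡 n)
        (extChartAt (𝓡 n) p₀).symm Y (Set.range (𝓡 n))
  have e : ∀ Y : (∀ p : N, TangentSpace (𝓡 n) p),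
      f Y =ᶠ[nhds (extChartAt (𝓡 n) p₀ p₀)] chartField p₀ Y := fun Y => by
    filter_upwards [hT] with x hx using chartField_eq_mpullback Y hx
  have h0 : VectorField.lieBracketWithin ℝ (f V) (f W)
      ((extChartAt (𝓡 n) p₀).symm ⁻¹' Set.univ ∩ Set.range (𝓡 n)) (extChartAt (𝓡 n) p₀ p₀) =
      VectorField.lieBracket ℝ (chartField p₀ V) (chartField p₀ W) (extChartAt (𝓡 n) p₀ p₀) := by
    have hs : (extChartAt (𝓡 n) p₀).symm ⁻¹' Set.univ ∩ Set.range (𝓡 n) = Set.univ := by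
      rw [ModelWithCorners.range_eq_univ]; simp
    rw [hs, VectorField.lieBracketWithin_univ]
    exact (e V).lieBracket_vectorField_eq (𝕜 := ℝ) (e W)
  let LB : TangentSpace 𝓘(ℝ, EuclideanSpace ℝ (Fin n)) (extChartAt (𝓡 n) p₀ p₀) :=
    VectorField.lieBracketWithin (E := EuclideanSpace ℝ (Fin n)) ℝ (f V) (f W)
      ((extChartAt (𝓡 n) p₀).symm ⁻¹' Set.univ ∩ Set.range (𝓡 n)) (extChartAt (𝓡 n) p₀ p₀)
  have h1 : VectorField.mlieBracket (𝓡 n) V W p₀ = (LB : EuclideanSpace ℝ (Fin n)) := by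
    have i1 : VectorField.mlieBracket (𝓡 n) V W p₀ =
      (mfderiv (𝓡 n) 𝓘(ℝ, EuclideanSpace ℝ (Fin n)) (extChartAt (𝓡 n) p₀) p₀).inverse LB :=
        VectorField.mlieBracketWithin_apply
    rw [i1]
    refine (congrArg (fun L : TangentSpace (𝓡 n) p₀ →L[ℝ] TangentSpace (𝓡 n) p₀ =>
      (L.inverse LB : TangentSpace (𝓡 n) p₀))
      mfderiv_extChartAt_self).trans ?_
    simp only [ContinuousLinearMap.inverse_id]
    rfl
  refine (h1.trans h0).trans ?_
  rw [VectorField.lieBracket, base, base]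

/-- A map with vanishing derivative is locally constant. -/
theorem eventually_eq_of_mfderiv_eq_zero {f : N → N'} (hf : MDifferentiable (𝓡 n) (𝓡 k) f)
    (h : ∀ p, mfderiv (𝓡 n) (𝓡 k) f p = 0) (p : N) : ∀ᶠ q in nhds p, f q = f p := by
  have : IsManifold (𝓡 n) 1 N := isManifold_one n N
  have : IsManifold (𝓡 k) 1 N' := isManifold_one k N'
  set φ := extChartAt (𝓡 n) p
  set ψ := extChartAt (𝓡 k) (f p)
  have hsrc : ∀ᶠ x in nhds (φ p), x ∈ φ.target ∧ f (φ.symm x) ∈ ψ.source := by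
    refine Filter.Eventually.and (chart_target_mem_nhds (n := n) p) ?_
    have h1 : Filter.Tendsto φ.symm (nhds (φ p)) (nhds p) := by
      have := continuousAt_extChartAt_symm (I := 𝓡 n) p
      rw [ContinuousAt, extChartAt_to_inv] at this
      exact this
    have h2 : ∀ᶠ q in nhds p, f q ∈ ψ.source :=
      (hf p).continuousAt.eventually (extChartAt_source_mem_nhds (f p))
    exact h1.eventually h2
  obtain ⟨ε, hε, hb⟩ := Metric.eventually_nhds_iff_ball.1 hsrc
  have hd : ∀ x ∈ Metric.ball (φ p) ε, HasFDerivAt (fun x => ψ (f (φ.symm x)))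
      (0 : EuclideanSpace ℝ (Fin n) →L[ℝ] EuclideanSpace ℝ (Fin k)) x := by
    intro x hx
    obtain ⟨hx1, hx2⟩ := hb x hx
    have d1 : MDifferentiableAt 𝓘(ℝ, EuclideanSpace ℝ (Fin n)) (𝓡 n) φ.symm x := by
      have := mdifferentiableWithinAt_extChartAt_symm (I := 𝓡 n) hx1
      rwa [ModelWithCorners.range_eq_univ, mdifferentiableWithinAt_univ] at this
    have d3 : MDifferentiableAt (𝓡 k) 𝓘(ℝ, EuclideanSpace ℝ (Fin k)) ψ (f (φ.symm x)) :=
      mdifferentiableAt_extChartAt (by rwa [← extChartAt_source (I := 𝓡 k)])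
    have d2 := (hf (φ.symm x)).hasMFDerivAt
    rw [h] at d2
    have := (d3.hasMFDerivAt.comp (φ.symm x) d2).comp x d1.hasMFDerivAt
    have h4 := this.hasFDerivAt
    refine h4.congr_fderiv ?_
    ext v
    have h0 := (mfderiv (𝓡 k) 𝓘(ℝ, EuclideanSpace ℝ (Fin k)) ψ (f (φ.symm x))).map_zero
    exact h0
  have hconst : ∀ x ∈ Metric.ball (φ p) ε, ψ (f (φ.symm x)) = ψ (f (φ.symm (φ p))) := fun x hx =>
    Metric.isOpen_ball.is_const_of_fderiv_eq_zero (𝕜 := ℝ)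
      (f := fun x => ψ (f (φ.symm x))) (convex_ball _ _).isPreconnected
      (fun y hy => (hd y hy).differentiableAt.differentiableWithinAt)
      (fun y hy => (hd y hy).fderiv) hx (Metric.mem_ball_self hε)
  have hc : ∀ᶠ q in nhds p, φ q ∈ Metric.ball (φ p) ε :=
    (continuousAt_extChartAt (I := 𝓡 n) p).eventually (Metric.ball_mem_nhds _ hε)
  filter_upwards [hc, extChartAt_source_mem_nhds (I := 𝓡 n) p] with q hq hq'
  have e := hconst _ hq
  have h1 := (hb _ hq).2
  rw [φ.left_inv hq', extChartAt_to_inv] at e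
  rw [φ.left_inv hq'] at h1
  exact ψ.injOn h1 (mem_extChartAt_source (f p)) e

end Charts

/-! ### An action in charts, and its two partial derivatives. -/

section ChartAction

variable {n : ℕ} {N : Type*} [TopologicalSpace N] [ChartedSpace (EuclideanSpace ℝ (Fin n)) N]
  {𝒢 : Type*} [TopologicalSpace 𝒢] [ChartedSpace (EuclideanSpace ℝ (Fin 3)) 𝒢]
  {act : N → 𝒢 → N} {q₀ : N}

theorem contMDiff_act_left
    (hact : ContMDiff ((𝓡 n).prod (𝓡 3)) (𝓡 n) ∞ (fun z : N × 𝒢 => act z.1 z.2))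
    (q : N) : ContMDiff (𝓡 3) (𝓡 n) ∞ (act q) :=
  hact.comp (contMDiff_const.prodMk contMDiff_id)

theorem contMDiff_act_right
    (hact : ContMDiff ((𝓡 n).prod (𝓡 3)) (𝓡 n) ∞ (fun z : N × 𝒢 => act z.1 z.2))
    (a : 𝒢) : ContMDiff (𝓡 n) (𝓡 n) ∞ (fun q => act q a) :=
  hact.comp (contMDiff_id.prodMk contMDiff_const)

variable [IsManifold (𝓡 n) ∞ N] [Group 𝒢]

/-- A right action in charts at `q₀` and at the identity. -/
def chartAct (act : N → 𝒢 → N) (q₀ : N)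
    (z : EuclideanSpace ℝ (Fin n) × EuclideanSpace ℝ (Fin 3)) : EuclideanSpace ℝ (Fin n) :=
  extChartAt (𝓡 n) q₀ (act ((extChartAt (𝓡 n) q₀).symm z.1) ((extChartAt (𝓡 3) (1 : 𝒢)).symm z.2))

theorem contDiffAt_chartAct [IsManifold (𝓡 3) ∞ 𝒢]
    (hact : ContMDiff ((𝓡 n).prod (𝓡 3)) (𝓡 n) ∞ (fun z : N × 𝒢 => act z.1 z.2))
    (h1 : ∀ q, act q 1 = q) : ContDiffAt ℝ ∞ (chartAct act q₀)
    (extChartAt (𝓡 n) q₀ q₀, extChartAt (𝓡 3) (1 : 𝒢) 1) := by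
  have s1 : ContMDiffAt 𝓘(ℝ, EuclideanSpace ℝ (Fin n)) (𝓡 n) ∞ (extChartAt (𝓡 n) q₀).symm
      (extChartAt (𝓡 n) q₀ q₀) :=
    (contMDiffOn_extChartAt_symm q₀).contMDiffAt (chart_target_mem_nhds q₀)
  have s2 : ContMDiffAt 𝓘(ℝ, EuclideanSpace ℝ (Fin 3)) (𝓡 3) ∞ (extChartAt (𝓡 3) (1 : 𝒢)).symm
      (extChartAt (𝓡 3) (1 : 𝒢) 1) :=
    (contMDiffOn_extChartAt_symm (1 : 𝒢)).contMDiffAt (chart_target_mem_nhds (1 : 𝒢))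
  have s3 : ContMDiffAt (𝓘(ℝ, EuclideanSpace ℝ (Fin n)).prod 𝓘(ℝ, EuclideanSpace ℝ (Fin 3)))
      ((𝓡 n).prod (𝓡 3)) ∞
      (fun z : EuclideanSpace ℝ (Fin n) × EuclideanSpace ℝ (Fin 3) =>
        ((extChartAt (𝓡 n) q₀).symm z.1, (extChartAt (𝓡 3) (1 : 𝒢)).symm z.2))
      (extChartAt (𝓡 n) q₀ q₀, extChartAt (𝓡 3) (1 : 𝒢) 1) :=
    (s1.comp (extChartAt (𝓡 n) q₀ q₀, extChartAt (𝓡 3) (1 : 𝒢) 1) contMDiffAt_fst).prodMk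
      (s2.comp (extChartAt (𝓡 n) q₀ q₀, extChartAt (𝓡 3) (1 : 𝒢) 1) contMDiffAt_snd)
  have s5 := (hact.contMDiffAt).comp _ s3
  have s4 : ContMDiffAt (𝓡 n) 𝓘(ℝ, EuclideanSpace ℝ (Fin n)) ∞ (extChartAt (𝓡 n) q₀)
      (act ((extChartAt (𝓡 n) q₀).symm (extChartAt (𝓡 n) q₀ q₀))
        ((extChartAt (𝓡 3) (1 : 𝒢)).symm (extChartAt (𝓡 3) (1 : 𝒢) 1))) := by
    rw [extChartAt_to_inv, extChartAt_to_inv, h1]; exact contMDiffAt_extChartAt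
  have s6 := ContMDiffAt.comp (I' := 𝓡 n)
    (extChartAt (𝓡 n) q₀ q₀, extChartAt (𝓡 3) (1 : 𝒢) 1) s4 s5
  rw [← modelWithCornersSelf_prod, chartedSpaceSelf_prod] at s6
  exact s6.contDiffAt

/-- The derivative in the group variable at 1 is the generating field of the action. The vector `w`
is kept separate so that the lemma serves both `vert` and the left-invariant fields, which are equal
to this derivative by definition. -/
theorem fderiv_chartAct_right
    (hact : ContMDiff ((𝓡 n).prod (𝓡 3)) (𝓡 n) ∞ (fun z : N × 𝒢 => act z.1 z.2))
    (h1 : ∀ q, act q 1 = q) {x : EuclideanSpace ℝ (Fin n)}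
    (hx : x ∈ (extChartAt (𝓡 n) q₀).target) (v : EuclideanSpace ℝ (Fin 3))
    {w : TangentSpace (𝓡 n) ((extChartAt (𝓡 n) q₀).symm x)}
    (hw : (w : EuclideanSpace ℝ (Fin n)) = 
      mfderiv (𝓡 3) (𝓡 n) (act ((extChartAt (𝓡 n) q₀).symm x)) 1 v) :
    fderiv ℝ (fun s => chartAct act q₀ (x, s)) (extChartAt (𝓡 3) (1 : 𝒢) 1) v =
      mfderiv (𝓡 n) 𝓘(ℝ, EuclideanSpace ℝ (Fin n)) (extChartAt (𝓡 n) q₀)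
        ((extChartAt (𝓡 n) q₀).symm x) w := by
  have := isManifold_one n N
  set q := (extChartAt (𝓡 n) q₀).symm x
  have hq : q ∈ (chartAt (EuclideanSpace ℝ (Fin n)) q₀).source := by
    rw [← extChartAt_source (I := 𝓡 n)]; exact (extChartAt (𝓡 n) q₀).map_target hx
  have d1 : MDifferentiableAt (𝓡 3) (𝓡 n) (act q) 1 :=
    (contMDiff_act_left hact q).mdifferentiableAt (by norm_num)
  have d2 : MDifferentiableAt (𝓡 n) 𝓘(ℝ, EuclideanSpace ℝ (Fin n)) (extChartAt (𝓡 n) q₀)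
      (act q 1) := by rw [h1]; exact mdifferentiableAt_extChartAt hq
  have e1 := mfderiv_eq_fderiv_chart (f := extChartAt (𝓡 n) q₀ ∘ act q) (d2.comp _ d1) v
  refine e1.symm.trans ?_
  rw [mfderiv_comp _ d2 d1]
  have e3 : ∀ r, r = q → ∀ u : EuclideanSpace ℝ (Fin n),
      (mfderiv (𝓡 n) 𝓘(ℝ, EuclideanSpace ℝ (Fin n)) (extChartAt (𝓡 n) q₀) r u
        : EuclideanSpace ℝ (Fin n)) =
      mfderiv (𝓡 n) 𝓘(ℝ, EuclideanSpace ℝ (Fin n)) (extChartAt (𝓡 n) q₀) q u := by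
    rintro r rfl u; rfl
  refine (e3 _ (h1 q) _).trans ?_
  exact congrArg (fun u : EuclideanSpace ℝ (Fin n) =>
    mfderiv (𝓡 n) 𝓘(ℝ, EuclideanSpace ℝ (Fin n)) (extChartAt (𝓡 n) q₀) q u) hw.symm

/-- The derivative in the space variable is the differential of translation by `a`. No
multiplicativity of `act` enters, so conjugation can be inserted as well; this is how Ad is
obtained. -/
theorem fderiv_chartAct_left
    (hact : ContMDiff ((𝓡 n).prod (𝓡 3)) (𝓡 n) ∞ (fun z : N × 𝒢 => act z.1 z.2)) {a : 𝒢}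
    (ha : act q₀ a ∈ (extChartAt (𝓡 n) q₀).source)
    (has : a ∈ (extChartAt (𝓡 3) (1 : 𝒢)).source) (v : EuclideanSpace ℝ (Fin n)) :
    fderiv ℝ (fun x => chartAct act q₀ (x, extChartAt (𝓡 3) (1 : 𝒢) a)) (extChartAt (𝓡 n) q₀ q₀) v =
      mfderiv (𝓡 n) 𝓘(ℝ, EuclideanSpace ℝ (Fin n)) (extChartAt (𝓡 n) q₀) (act q₀ a)
        (mfderiv (𝓡 n) (𝓡 n) (fun q => act q a) q₀ v) := by
  have := isManifold_one n N
  have d1 : MDifferentiableAt (𝓡 n) (𝓡 n) (fun q => act q a) q₀ :=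
    (contMDiff_act_right hact a).mdifferentiableAt (by norm_num)
  have d2 : MDifferentiableAt (𝓡 n) 𝓘(ℝ, EuclideanSpace ℝ (Fin n)) (extChartAt (𝓡 n) q₀)
      (act q₀ a) := mdifferentiableAt_extChartAt (by rwa [← extChartAt_source (I := 𝓡 n)])
  have e1 := mfderiv_eq_fderiv_chart (f := extChartAt (𝓡 n) q₀ ∘ fun q => act q a)
    (MDifferentiableAt.comp q₀ d2 d1) v
  rw [mfderiv_comp q₀ d2 d1] at e1
  simp only [chartAct, (extChartAt (𝓡 3) (1 : 𝒢)).left_inv has]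
  exact e1.symm

end ChartAction

/-! ### Unimodular Lie algebras of dimension three. -/

section LieAlgebraDimThree

variable {L : Type*} [LieRing L] [LieAlgebra ℝ L]

/-- In a nonabelian unimodular three-dimensional Lie algebra with a nonzero central element `z₀`,
the centre and the derived algebra are spanned by `z₀`. -/
theorem centre_and_derived_of_unimodular [FiniteDimensional ℝ L] (hdim : Module.finrank ℝ L = 3)
    (htr : ∀ y : L, LinearMap.trace ℝ L (LieAlgebra.ad ℝ L y : L →ₗ[ℝ] L) = 0) {z₀ : L}
    (hz₀ : z₀ ≠ 0) (hc : ∀ x : L, ⁅x, z₀⁆ = 0) (hn : ∃ x y : L, ⁅x, y⁆ ≠ 0) :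
    (∀ z : L, (∀ x : L, ⁅z, x⁆ = 0) → ∃ c : ℝ, z = c • z₀) ∧
      ∀ x y : L, ∃ c : ℝ, ⁅x, y⁆ = c • z₀ := by
  have hc' : ∀ x : L, ⁅z₀, x⁆ = 0 := fun x => by rw [← lie_skew, hc, neg_zero]
  have basis_of : ∀ v : Fin 3 → L, LinearIndependent ℝ v → ∃ b : Module.Basis (Fin 3) ℝ L, ⇑b = v :=
    fun v hv => ⟨basisOfLinearIndependentOfCardEqFinrank hv (by simp [hdim]), by simp⟩
  have expand : ∀ b : Module.Basis (Fin 3) ℝ L, ∀ x y : L, ⁅x, y⁆ =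
      (b.repr x 0 * b.repr y 1 - b.repr x 1 * b.repr y 0) • ⁅b 0, b 1⁆ +
      (b.repr x 0 * b.repr y 2 - b.repr x 2 * b.repr y 0) • ⁅b 0, b 2⁆ +
      (b.repr x 1 * b.repr y 2 - b.repr x 2 * b.repr y 1) • ⁅b 1, b 2⁆ := by
    intro b x y
    conv_lhs => rw [← b.sum_repr x, ← b.sum_repr y]
    simp only [Fin.sum_univ_three, add_lie, lie_add, smul_lie, lie_smul, lie_self, smul_zero]
    rw [← lie_skew (b 1) (b 0), ← lie_skew (b 2) (b 0), ← lie_skew (b 2) (b 1)]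
    module
  constructor
  · intro z hz
    by_contra hne
    push Not at hne
    -- Two independent central vectors extend to a basis by one further vector, and then all
    -- brackets vanish.
    have hli : LinearIndependent ℝ ![z, z₀] := by
      rw [LinearIndependent.pair_symm_iff, LinearIndependent.pair_iff' hz₀]
      exact fun a h => hne a h.symm
    obtain ⟨w, hw⟩ := exists_linearIndependent_cons_of_lt_finrank hli (by rw [hdim]; norm_num)
    obtain ⟨b, hb⟩ := basis_of _ hw
    have b1 : b 1 = z := by rw [hb]; rfl
    have b2 : b 2 = z₀ := by rw [hb]; rfl
    obtain ⟨x, y, hxy⟩ := hn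
    apply hxy
    rw [expand b, b1, b2, hc, hc, ← lie_skew, hz]
    simp
  · have hli1 : LinearIndependent ℝ ![z₀] := by
      rw [linearIndependent_unique_iff]; exact hz₀
    obtain ⟨w₁, hw₁⟩ := exists_linearIndependent_cons_of_lt_finrank hli1 (by rw [hdim]; norm_num)
    obtain ⟨w₂, hw₂⟩ := exists_linearIndependent_cons_of_lt_finrank hw₁ (by rw [hdim]; norm_num)
    obtain ⟨b, hb⟩ := basis_of _ hw₂
    have b2 : b 2 = z₀ := by rw [hb]; rfl
    have h02 : ⁅b 0, b 2⁆ = 0 := by rw [b2, hc]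
    have h12 : ⁅b 1, b 2⁆ = 0 := by rw [b2, hc]
    have h10 : ⁅b 1, b 0⁆ = -⁅b 0, b 1⁆ := (lie_skew _ _).symm
    -- As `b 2` is central, tr ad(b 0) is the `b 1`-coefficient of ⁅b 0, b 1⁆ and tr ad(b 1) is
    -- minus its `b 0`-coefficient. Unimodularity leaves only the component along `z₀`.
    have tr0 := htr (b 0)
    have tr1 := htr (b 1)
    rw [LinearMap.trace_eq_matrix_trace ℝ b, Matrix.trace] at tr0 tr1
    simp [-lie_skew, Fin.sum_univ_three, LinearMap.toMatrix_apply, h02, h12, h10] at tr0 tr1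
    intro x y
    refine ⟨(b.repr x 0 * b.repr y 1 - b.repr x 1 * b.repr y 0) * b.repr ⁅b 0, b 1⁆ 2, ?_⟩
    have h01 : ⁅b 0, b 1⁆ = b.repr ⁅b 0, b 1⁆ 2 • z₀ := by
      conv_lhs => rw [← b.sum_repr ⁅b 0, b 1⁆]
      rw [Fin.sum_univ_three, tr0, tr1, b2]; simp
    rw [expand b, h02, h12, mul_smul, ← h01]
    simp

end LieAlgebraDimThree

/-! ### The adjoint representation of a nilpotent Lie group, not assumed connected. -/

section LieGroup

variable {𝒢 : Type*} [TopologicalSpace 𝒢] [ChartedSpace (EuclideanSpace ℝ (Fin 3)) 𝒢] [Group 𝒢]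
  [LieGroup (𝓡 3) ∞ 𝒢]

variable (𝒢) in
theorem lieGroup_three : LieGroup (𝓡 3) (minSmoothness ℝ 3) 𝒢 :=
  LieGroup.of_le (n := ∞) (by rw [minSmoothness_of_isRCLikeNormedField]; exact WithTop.coe_le_coe.2 (show (3 : ℕ∞) ≤ ⊤ from le_top))

/-- The derivative at the identity of a self-map of a Lie group that fixes the identity. -/
def derivOne (f : 𝒢 → 𝒢) : EuclideanSpace ℝ (Fin 3) →L[ℝ] EuclideanSpace ℝ (Fin 3) :=
  mfderiv (𝓡 3) (𝓡 3) f 1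

theorem derivOne_comp {f h : 𝒢 → 𝒢} (hf : MDifferentiableAt (𝓡 3) (𝓡 3) f 1)
    (hh : MDifferentiableAt (𝓡 3) (𝓡 3) h 1) (h1 : h 1 = 1) :
    derivOne (f ∘ h) = (derivOne f).comp (derivOne h) := by
  have e := mfderiv_comp_of_eq (x := (1 : 𝒢)) hf hh h1
  have e2 : ∀ r : 𝒢, r = 1 → (show EuclideanSpace ℝ (Fin 3) →L[ℝ] EuclideanSpace ℝ (Fin 3) from
      mfderiv (𝓡 3) (𝓡 3) f r) = derivOne f := by
    rintro r rfl; rfl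
  refine Eq.trans e ?_
  exact congrArg (fun T : EuclideanSpace ℝ (Fin 3) →L[ℝ] EuclideanSpace ℝ (Fin 3) =>
    T.comp (derivOne h)) (e2 _ h1)

/-- The differential of multiplication at (1, 1) is addition. -/
theorem derivOne_mul {f h : 𝒢 → 𝒢} (hf : MDifferentiableAt (𝓡 3) (𝓡 3) f 1)
    (hh : MDifferentiableAt (𝓡 3) (𝓡 3) h 1) (hf1 : f 1 = 1) (h1 : h 1 = 1) :
    derivOne (fun b => f b * h b) = derivOne f + derivOne h := by
  have hm : ContMDiff ((𝓡 3).prod (𝓡 3)) (𝓡 3) ∞ (fun z : 𝒢 × 𝒢 => z.1 * z.2) := contMDiff_mul _ _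
  have dΦ : MDifferentiableAt ((𝓡 3).prod (𝓡 3)) (𝓡 3) (fun z : 𝒢 × 𝒢 => f z.1 * h z.2) (1, 1) :=
    MDifferentiableAt.comp (I' := (𝓡 3).prod (𝓡 3)) (1, 1) (hm.mdifferentiableAt (by norm_num))
      ((hf.comp (1, 1) mdifferentiableAt_fst).prodMk (hh.comp (1, 1) mdifferentiableAt_snd))
  have dd : MDifferentiableAt (𝓡 3) ((𝓡 3).prod (𝓡 3)) (fun b : 𝒢 => (b, b)) 1 :=
    mdifferentiableAt_id.prodMk mdifferentiableAt_id
  ext1 v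
  have e1 := mfderiv_comp_apply (f := fun b : 𝒢 => (b, b)) (1 : 𝒢) dΦ dd v
  rw [mfderiv_prod_eq_add_apply dΦ] at e1
  have e2 : mfderiv (𝓡 3) ((𝓡 3).prod (𝓡 3)) (fun b : 𝒢 => (b, b)) 1 v = (v, v) := by
    have := mfderiv_prodMk (x := (1 : 𝒢)) (f := fun b : 𝒢 => b) (g := fun b : 𝒢 => b)
      (I := 𝓡 3) (I' := 𝓡 3) (I'' := 𝓡 3) mdifferentiableAt_id mdifferentiableAt_id
    rw [this]
    show (mfderiv (𝓡 3) (𝓡 3) (fun b : 𝒢 => b) 1 v, mfderiv (𝓡 3) (𝓡 3) (fun b : 𝒢 => b) 1 v) = _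
    have := mfderiv_id (I := 𝓡 3) (x := (1 : 𝒢))
    have e3 : mfderiv (𝓡 3) (𝓡 3) (fun b : 𝒢 => b) 1 v = v := congrArg (fun T => T v) this
    rw [e3]
    rfl
  rw [e2] at e1
  refine e1.trans ?_
  show derivOne (fun z => f z * h 1) v + derivOne (fun z => f 1 * h z) v = _
  have q1 : (fun z => f z * h 1) = f := funext fun z => by rw [h1, mul_one]
  have q2 : (fun z => f 1 * h z) = h := funext fun z => by rw [hf1, one_mul]
  rw [q1, q2]
  rfl

theorem derivOne_const : derivOne (fun _ : 𝒢 => (1 : 𝒢)) = 0 := mfderiv_const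

theorem derivOne_id : derivOne (fun b : 𝒢 => b) = ContinuousLinearMap.id ℝ _ := mfderiv_id

theorem mdifferentiable_of_contMDiff_top {f : 𝒢 → 𝒢} (hf : ContMDiff (𝓡 3) (𝓡 3) ∞ f) (a : 𝒢) :
    MDifferentiableAt (𝓡 3) (𝓡 3) f a := hf.mdifferentiableAt (by norm_num)

/-- The adjoint action as a continuous linear map of the model space. -/
def adL (a : 𝒢) : EuclideanSpace ℝ (Fin 3) →L[ℝ] EuclideanSpace ℝ (Fin 3) :=
  derivOne (fun b : 𝒢 => a * b * a⁻¹)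

theorem contMDiff_conj (a : 𝒢) : ContMDiff (𝓡 3) (𝓡 3) ∞ (fun b : 𝒢 => a * b * a⁻¹) :=
  (contMDiff_const.mul contMDiff_id).mul contMDiff_const

theorem adL_mul (a b : 𝒢) : adL (a * b) = (adL a).comp (adL b) := by
  rw [adL, adL, adL, ← derivOne_comp]
  · congr 1; ext c; simp [mul_assoc]
  · exact mdifferentiable_of_contMDiff_top (contMDiff_conj a) 1
  · exact mdifferentiable_of_contMDiff_top (contMDiff_conj b) 1
  · simp

theorem adL_one : adL (1 : 𝒢) = ContinuousLinearMap.id ℝ _ := by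
  rw [adL, ← derivOne_id (𝒢 := 𝒢)]; congr 1; ext b; simp

theorem contMDiff_commutator (a : 𝒢) :
    ContMDiff (𝓡 3) (𝓡 3) ∞ (fun b : 𝒢 => a * b * a⁻¹ * b⁻¹) :=
  (contMDiff_conj a).mul contMDiff_id.inv

/-- Multiplying the commutator of `a` and `b` by `b` gives the conjugate of `b` by `a`; at the
identity products differentiate to sums. -/
theorem derivOne_commutator (a : 𝒢) :
    derivOne (fun b : 𝒢 => a * b * a⁻¹ * b⁻¹) = adL a - ContinuousLinearMap.id ℝ _ := by
  have := derivOne_mul (f := fun b : 𝒢 => a * b * a⁻¹ * b⁻¹) (h := fun b => b)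
    (mdifferentiable_of_contMDiff_top (contMDiff_commutator a) 1)
    (mdifferentiable_of_contMDiff_top contMDiff_id 1) (by simp) rfl
  simp only [inv_mul_cancel_right] at this
  rw [eq_sub_iff_add_eq, ← derivOne_id (𝒢 := 𝒢), ← this]
  rfl

/-- Iterated commutators `b ↦ [a₁, [a₂, …, [aₙ, b]]]`. -/
def iterComm : List 𝒢 → 𝒢 → 𝒢
  | [] => fun b => b
  | a :: l => fun b => a * iterComm l b * a⁻¹ * (iterComm l b)⁻¹

theorem iterComm_one (l : List 𝒢) : iterComm l 1 = 1 := by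
  induction l with
  | nil => rfl
  | cons a l ih => simp [iterComm, ih]

theorem contMDiff_iterComm (l : List 𝒢) : ContMDiff (𝓡 3) (𝓡 3) ∞ (iterComm l) := by
  induction l with
  | nil => exact contMDiff_id
  | cons a l ih => exact (contMDiff_commutator a).comp ih

theorem iterComm_mem (l : List 𝒢) (b : 𝒢) :
    iterComm l b ∈ (⊤ : Subgroup 𝒢).lowerCentralSeries l.length := by
  induction l with
  | nil => exact Subgroup.mem_top _
  | cons a l ih =>
    rw [List.length_cons, Subgroup.lowerCentralSeries_succ, Subgroup.commutator_comm]
    exact Subgroup.commutator_mem_commutator (Subgroup.mem_top a) ih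

/-- The composition of the maps `Ad a - 1`. -/
def iterAd : List 𝒢 → EuclideanSpace ℝ (Fin 3) →L[ℝ] EuclideanSpace ℝ (Fin 3)
  | [] => ContinuousLinearMap.id ℝ _
  | a :: l => (adL a - ContinuousLinearMap.id ℝ _).comp (iterAd l)

theorem derivOne_iterComm (l : List 𝒢) : derivOne (iterComm l) = iterAd l := by
  induction l with
  | nil => exact derivOne_id
  | cons a l ih =>
    rw [iterAd, ← ih, ← derivOne_commutator, ← derivOne_comp]
    · rfl
    · exact mdifferentiable_of_contMDiff_top (contMDiff_commutator a) 1
    · exact mdifferentiable_of_contMDiff_top (contMDiff_iterComm l) 1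
    · exact iterComm_one l

/-- Commutators of length equal to the nilpotency class are trivial, so the maps `iterComm l` are
constant and their derivatives vanish. Only nilpotency of the abstract group enters, so components
other than that of 1 are covered. -/
theorem exists_iterAd_eq_zero [Group.IsNilpotent 𝒢] :
    ∃ n, ∀ l : List 𝒢, l.length = n → iterAd l = 0 := by
  refine ⟨Group.nilpotencyClass 𝒢, fun l hl => ?_⟩
  rw [← derivOne_iterComm, ← derivOne_const (𝒢 := 𝒢)]
  congr 1
  ext b
  have := iterComm_mem l b
  rw [hl, Subgroup.lowerCentralSeries_nilpotencyClass] at this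
  exact Subgroup.mem_bot.1 this

theorem isNilpotent_adL_sub_one [Group.IsNilpotent 𝒢] (a : 𝒢) :
    IsNilpotent ((adL a - ContinuousLinearMap.id ℝ _ :
      EuclideanSpace ℝ (Fin 3) →L[ℝ] EuclideanSpace ℝ (Fin 3)) :
      EuclideanSpace ℝ (Fin 3) →ₗ[ℝ] EuclideanSpace ℝ (Fin 3)) := by
  obtain ⟨n, hn⟩ := exists_iterAd_eq_zero (𝒢 := 𝒢)
  refine ⟨n, ?_⟩
  have h := hn (List.replicate n a) (by simp)
  have e : ∀ m : ℕ, ((adL a - ContinuousLinearMap.id ℝ _ :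
      EuclideanSpace ℝ (Fin 3) →L[ℝ] EuclideanSpace ℝ (Fin 3)) :
      EuclideanSpace ℝ (Fin 3) →ₗ[ℝ] EuclideanSpace ℝ (Fin 3)) ^ m =
      (iterAd (List.replicate m a) : EuclideanSpace ℝ (Fin 3) →ₗ[ℝ] EuclideanSpace ℝ (Fin 3)) := by
    intro m
    induction m with
    | zero => rfl
    | succ m ih => rw [pow_succ', ih]; rfl
  rw [e, h]; rfl

theorem trace_adL [Group.IsNilpotent 𝒢] (a : 𝒢) :
    LinearMap.trace ℝ (EuclideanSpace ℝ (Fin 3))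
      (adL a : EuclideanSpace ℝ (Fin 3) →ₗ[ℝ] EuclideanSpace ℝ (Fin 3)) = 3 := by
  have h := (LinearMap.isNilpotent_trace_of_isNilpotent (isNilpotent_adL_sub_one a)).eq_zero
  rw [ContinuousLinearMap.toLinearMap_sub, map_sub, sub_eq_zero] at h
  rw [h]
  simp

theorem det_adL [Group.IsNilpotent 𝒢] (a : 𝒢) :
    LinearMap.det (adL a : EuclideanSpace ℝ (Fin 3) →ₗ[ℝ] EuclideanSpace ℝ (Fin 3)) = 1 := by
  have h := IsNilpotent.charpoly_eq_X_pow_finrank (isNilpotent_adL_sub_one a)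
  -- The characteristic polynomial of the nilpotent map Ad a − 1 is X³. Its value at −1 is det(−1 −
  -- (Ad a − 1)) = det(−Ad a) = −det Ad a.
  have h2 := LinearMap.eval_charpoly ((adL a - ContinuousLinearMap.id ℝ _ :
      EuclideanSpace ℝ (Fin 3) →L[ℝ] EuclideanSpace ℝ (Fin 3)) :
      EuclideanSpace ℝ (Fin 3) →ₗ[ℝ] EuclideanSpace ℝ (Fin 3)) (-1)
  have e : algebraMap ℝ (Module.End ℝ (EuclideanSpace ℝ (Fin 3))) (-1) -
      ((adL a - ContinuousLinearMap.id ℝ _ :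
      EuclideanSpace ℝ (Fin 3) →L[ℝ] EuclideanSpace ℝ (Fin 3)) :
      EuclideanSpace ℝ (Fin 3) →ₗ[ℝ] EuclideanSpace ℝ (Fin 3)) =
      (-1 : ℝ) • (adL a : EuclideanSpace ℝ (Fin 3) →ₗ[ℝ] EuclideanSpace ℝ (Fin 3)) := by
    refine LinearMap.ext fun v => ?_
    show (-1 : ℝ) • v - (adL a v - v) = (-1 : ℝ) • adL a v
    module
  rw [h, e, LinearMap.det_smul] at h2
  simp at h2
  exact h2

/-- As in Engel's theorem: at the least length for which all composites of maps Ad a − 1 vanish, a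
nonzero value of a composite one factor shorter is killed by every Ad a − 1. Length zero is excluded
because the empty composite is the identity. -/
theorem exists_fixed_vector [Group.IsNilpotent 𝒢] :
    ∃ x : EuclideanSpace ℝ (Fin 3), x ≠ 0 ∧ ∀ a : 𝒢, adL a x = x := by
  obtain ⟨n, hn⟩ := exists_iterAd_eq_zero (𝒢 := 𝒢)
  induction n with
  | zero =>
    have := hn [] rfl
    obtain ⟨v, hv⟩ := exists_ne (0 : EuclideanSpace ℝ (Fin 3))
    exact absurd (congrArg (fun T => T v) this) hv
  | succ n ih =>
    by_cases h : ∀ l : List 𝒢, l.length = n → iterAd l = 0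
    · exact ih h
    · push Not at h
      obtain ⟨l, hl, hne⟩ := h
      obtain ⟨v, hv⟩ : ∃ v, iterAd l v ≠ 0 := by
        by_contra hall
        push Not at hall
        exact hne (ContinuousLinearMap.ext hall)
      refine ⟨iterAd l v, hv, fun a => ?_⟩
      have := congrArg (fun T => T v) (hn (a :: l) (by simp [hl]))
      simpa [iterAd, sub_eq_zero] using this

/-- The base point of the tangent space does not matter in the model space. -/
theorem mfderiv_chart_congr {p₀ q r : 𝒢} (h : r = q) (u : EuclideanSpace ℝ (Fin 3)) :
    (mfderiv (𝓡 3) 𝓘(ℝ, EuclideanSpace ℝ (Fin 3)) (extChartAt (𝓡 3) p₀) r u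
      : EuclideanSpace ℝ (Fin 3)) =
    mfderiv (𝓡 3) 𝓘(ℝ, EuclideanSpace ℝ (Fin 3)) (extChartAt (𝓡 3) p₀) q u := by
  subst h; rfl

theorem chart_symm_eventually :
    ∀ᶠ s in nhds (extChartAt (𝓡 3) (1 : 𝒢) 1), s ∈ (extChartAt (𝓡 3) (1 : 𝒢)).target :=
  chart_target_mem_nhds (1 : 𝒢)

theorem fderiv_conj_chart {s : EuclideanSpace ℝ (Fin 3)}
    (hs : s ∈ (extChartAt (𝓡 3) (1 : 𝒢)).target) :
    fderiv ℝ (fun x => chartAct (fun b a : 𝒢 => a * b * a⁻¹) 1 (x, s)) (extChartAt (𝓡 3) (1 : 𝒢) 1) =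
      adL ((extChartAt (𝓡 3) (1 : 𝒢)).symm s) := by
  have := isManifold_one 3 𝒢
  have hc : ContMDiff ((𝓡 3).prod (𝓡 3)) (𝓡 3) ∞ (fun z : 𝒢 × 𝒢 => z.2 * z.1 * z.2⁻¹) :=
    (contMDiff_snd.mul contMDiff_fst).mul contMDiff_snd.inv
  set a := (extChartAt (𝓡 3) (1 : 𝒢)).symm s with ha
  have hsa : s = extChartAt (𝓡 3) (1 : 𝒢) a := ((extChartAt (𝓡 3) (1 : 𝒢)).right_inv hs).symm
  have has : a ∈ (extChartAt (𝓡 3) (1 : 𝒢)).source := (extChartAt (𝓡 3) (1 : 𝒢)).map_target hs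
  ext1 v
  rw [hsa, fderiv_chartAct_left (act := fun b a : 𝒢 => a * b * a⁻¹) hc
    (by simp) has v]
  refine (mfderiv_chart_congr (p₀ := (1 : 𝒢)) (r := a * 1 * a⁻¹) (q := 1) (by simp) (adL a v)).trans ?_
  rw [mfderiv_extChartAt_self]
  rfl

theorem fderiv_mul_chart_right {s : EuclideanSpace ℝ (Fin 3)}
    (hs : s ∈ (extChartAt (𝓡 3) (1 : 𝒢)).target) (v : EuclideanSpace ℝ (Fin 3)) :
    fderiv ℝ (fun t => chartAct (fun b a : 𝒢 => b * a) 1 (s, t)) (extChartAt (𝓡 3) (1 : 𝒢) 1) v =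
      chartField 1 (mulInvariantVectorField (I := 𝓡 3) (G := 𝒢) v) s :=
  fderiv_chartAct_right (act := fun b a : 𝒢 => b * a) (contMDiff_mul _ _) mul_one hs v rfl

/-- Left translation by `a` is conjugation by `a` followed by right translation. This is a second
expression for the left-invariant field, to be compared with `fderiv_mul_chart_right`. -/
theorem fderiv_mul_chart_left {s : EuclideanSpace ℝ (Fin 3)}
    (hs : s ∈ (extChartAt (𝓡 3) (1 : 𝒢)).target) (v : EuclideanSpace ℝ (Fin 3)) :
    fderiv ℝ (fun t => chartAct (fun b a : 𝒢 => b * a) 1 (t, s)) (extChartAt (𝓡 3) (1 : 𝒢) 1)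
      (adL ((extChartAt (𝓡 3) (1 : 𝒢)).symm s) v) =
      chartField 1 (mulInvariantVectorField (I := 𝓡 3) (G := 𝒢) v) s := by
  set a := (extChartAt (𝓡 3) (1 : 𝒢)).symm s with ha
  have hsa : s = extChartAt (𝓡 3) (1 : 𝒢) a := ((extChartAt (𝓡 3) (1 : 𝒢)).right_inv hs).symm
  have has : a ∈ (extChartAt (𝓡 3) (1 : 𝒢)).source := (extChartAt (𝓡 3) (1 : 𝒢)).map_target hs
  conv_lhs => rw [hsa]
  rw [fderiv_chartAct_left (act := fun b a : 𝒢 => b * a) (contMDiff_mul _ _)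
    (by simpa using has) has]
  refine (mfderiv_chart_congr (one_mul a) _).trans ?_
  have e : (mfderiv (𝓡 3) (𝓡 3) (fun b : 𝒢 => b * a) 1 (adL a v) : EuclideanSpace ℝ (Fin 3)) =
      mfderiv (𝓡 3) (𝓡 3) (fun b : 𝒢 => a * b) 1 v := by
    have h1 : (fun b : 𝒢 => a * b) = (fun b => b * a) ∘ fun b => a * b * a⁻¹ := by
      ext b; simp
    have h2 := derivOne_comp (f := fun b : 𝒢 => b * a) (h := fun b => a * b * a⁻¹)
      (mdifferentiable_of_contMDiff_top (contMDiff_id.mul contMDiff_const) 1)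
      (mdifferentiable_of_contMDiff_top (contMDiff_conj a) 1) (by simp)
    rw [h1]
    exact (congrArg (fun T : EuclideanSpace ℝ (Fin 3) →L[ℝ] EuclideanSpace ℝ (Fin 3) => T v) h2).symm
  exact congrArg (fun u : EuclideanSpace ℝ (Fin 3) => (mfderiv (𝓡 3) 𝓘(ℝ, EuclideanSpace ℝ (Fin 3))
    (extChartAt (𝓡 3) (1 : 𝒢)) a u : EuclideanSpace ℝ (Fin 3))) e

/-- The differential of the adjoint representation is the bracket. -/
theorem exists_hasFDerivAt_adL : ∃ D : EuclideanSpace ℝ (Fin 3) →L[ℝ]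
      EuclideanSpace ℝ (Fin 3) →L[ℝ] EuclideanSpace ℝ (Fin 3),
    HasFDerivAt (fun s => adL ((extChartAt (𝓡 3) (1 : 𝒢)).symm s)) D (extChartAt (𝓡 3) (1 : 𝒢) 1) ∧
    ∀ x y : Lie3 𝒢, ⁅y, x⁆ = D y x := by
  have hc : ContMDiff ((𝓡 3).prod (𝓡 3)) (𝓡 3) ∞ (fun z : 𝒢 × 𝒢 => z.2 * z.1 * z.2⁻¹) :=
    (contMDiff_snd.mul contMDiff_fst).mul contMDiff_snd.inv
  have h2 : (2 : ℕ∞ω) ≤ ∞ := WithTop.coe_le_coe.2 (show (2 : ℕ∞) ≤ ⊤ from le_top)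
  obtain ⟨D, hD, -⟩ := exists_mixed_derivative ((contDiffAt_chartAct (q₀ := (1 : 𝒢))
    (act := fun b a : 𝒢 => a * b * a⁻¹) hc (by simp)).of_le h2)
  obtain ⟨L, hL, hL'⟩ := exists_mixed_derivative ((contDiffAt_chartAct (q₀ := (1 : 𝒢))
    (act := fun b a : 𝒢 => b * a) (contMDiff_mul _ _) mul_one).of_le h2)
  set o := extChartAt (𝓡 3) (1 : 𝒢) 1
  have hD' : HasFDerivAt (fun s => adL ((extChartAt (𝓡 3) (1 : 𝒢)).symm s)) D o :=
    hD.congr_of_eventuallyEq (chart_symm_eventually.mono fun s hs => (fderiv_conj_chart hs).symm)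
  have hX : ∀ v : EuclideanSpace ℝ (Fin 3), HasFDerivAt
      (chartField 1 (mulInvariantVectorField (I := 𝓡 3) (G := 𝒢) v)) (L v) o := by
    intro v
    have h := hL'.clm_apply (hasFDerivAt_const v o)
    refine (h.congr_of_eventuallyEq (chart_symm_eventually.mono fun s hs =>
      (fderiv_mul_chart_right hs v).symm)).congr_fderiv ?_
    ext1 u
    simp
  have ho : adL ((extChartAt (𝓡 3) (1 : 𝒢)).symm o) = ContinuousLinearMap.id ℝ _ := by
    rw [extChartAt_to_inv, adL_one]
  have hid : fderiv ℝ (fun t => chartAct (fun b a : 𝒢 => b * a) 1 (t, o)) o =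
      ContinuousLinearMap.id ℝ _ := by
    have e : (fun t => chartAct (fun b a : 𝒢 => b * a) 1 (t, o)) =ᶠ[nhds o] id := by
      filter_upwards [chart_symm_eventually (𝒢 := 𝒢)] with s hs
      simp only [chartAct, o, extChartAt_to_inv, mul_one]
      exact (extChartAt (𝓡 3) (1 : 𝒢)).right_inv hs
    rw [e.fderiv_eq, fderiv_id]
  -- Both expressions for the left-invariant field of `v` are differentiated at the identity. `L` is
  -- the mixed second derivative of the multiplication, and its failure to be symmetric is the
  -- derivative of Ad.
  have key : ∀ v u : EuclideanSpace ℝ (Fin 3), L v u = L u v + D u v := by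
    intro v u
    have h := hL.clm_apply (hD'.clm_apply (hasFDerivAt_const v o))
    have h' := (h.congr_of_eventuallyEq (chart_symm_eventually.mono fun s hs =>
      (fderiv_mul_chart_left hs v).symm)).unique (hX v)
    have h3 := congrArg (fun T : EuclideanSpace ℝ (Fin 3) →L[ℝ] EuclideanSpace ℝ (Fin 3) => T u) h'
    simp only [ho, hid] at h3
    simp at h3
    rw [← h3]; abel
  refine ⟨D, hD', fun x y => ?_⟩
  rw [GroupLieAlgebra.bracket_def]
  refine (mlieBracket_eq_chart _ _ _).trans ?_
  have b1 : ∀ v : Lie3 𝒢, mulInvariantVectorField (I := 𝓡 3) v (1 : 𝒢) = v := by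
    intro v
    have := fderiv_mul_chart_left (𝒢 := 𝒢) (s := o) (mem_extChartAt_target _) v
    rw [ho, hid] at this
    unfold chartField at this
    rw [extChartAt_to_inv, mfderiv_extChartAt_self] at this
    exact this.symm
  rw [(hX x).fderiv, (hX y).fderiv, b1, b1]
  have := key x y
  exact sub_eq_iff_eq_add'.2 this

theorem finrank_lie3 : Module.finrank ℝ (Lie3 𝒢) = 3 :=
  finrank_euclideanSpace_fin (𝕜 := ℝ) (n := 3)

/-- A vector fixed by the adjoint action is central. -/
theorem bracket_eq_zero_of_fixed {z : Lie3 𝒢} (hz : ∀ a : 𝒢, adL a z = z)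
    (y : Lie3 𝒢) : ⁅y, z⁆ = 0 := by
  obtain ⟨D, hD, hb⟩ := exists_hasFDerivAt_adL (𝒢 := 𝒢)
  have h := hD.clm_apply (hasFDerivAt_const (z : EuclideanSpace ℝ (Fin 3)) (extChartAt (𝓡 3) (1 : 𝒢) 1))
  simp only [hz] at h
  have aux : ∀ u : EuclideanSpace ℝ (Fin 3), D u z = 0 := fun u => by
    have h' := congrArg (fun T : EuclideanSpace ℝ (Fin 3) →L[ℝ] EuclideanSpace ℝ (Fin 3) => T u)
      (h.unique (hasFDerivAt_const (z : EuclideanSpace ℝ (Fin 3)) _))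
    have h2 : adL ((extChartAt (𝓡 3) (1 : 𝒢)).symm (extChartAt (𝓡 3) (1 : 𝒢) 1)) 0 + D u z = 0 := h'
    rwa [map_zero, zero_add] at h2
  rw [hb z y]
  exact aux y

/-- Ad is unipotent, so its trace is constantly 3, and the derivative of this trace at the identity
is the trace of ad. -/
theorem trace_ad_eq_zero [Group.IsNilpotent 𝒢] (y : Lie3 𝒢) :
    letI := lieGroup_three 𝒢
    LinearMap.trace ℝ (Lie3 𝒢) (LieAlgebra.ad ℝ (Lie3 𝒢) y : Lie3 𝒢 →ₗ[ℝ] Lie3 𝒢) = 0 := by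
  obtain ⟨D, hD, hb⟩ := exists_hasFDerivAt_adL (𝒢 := 𝒢)
  let _ := lieGroup_three 𝒢
  let τ : (EuclideanSpace ℝ (Fin 3) →L[ℝ] EuclideanSpace ℝ (Fin 3)) →L[ℝ] ℝ :=
    LinearMap.toContinuousLinearMap ((LinearMap.trace ℝ (EuclideanSpace ℝ (Fin 3))).comp
      (ContinuousLinearMap.coeLM ℝ))
  have h := τ.hasFDerivAt.comp (extChartAt (𝓡 3) (1 : 𝒢) 1) hD
  have e : (τ ∘ fun s => adL ((extChartAt (𝓡 3) (1 : 𝒢)).symm s)) = fun _ => 3 := by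
    ext s; exact trace_adL _
  rw [e] at h
  have h' := congrArg (fun T : EuclideanSpace ℝ (Fin 3) →L[ℝ] ℝ => T y)
    (h.unique (hasFDerivAt_const 3 _))
  have e2 : (LieAlgebra.ad ℝ (Lie3 𝒢) y : Lie3 𝒢 →ₗ[ℝ] Lie3 𝒢) =
      (D y : EuclideanSpace ℝ (Fin 3) →ₗ[ℝ] EuclideanSpace ℝ (Fin 3)) :=
    LinearMap.ext fun x => hb x y
  rw [e2]
  exact h'

/-- If the Lie algebra is abelian, so is the identity component. -/
theorem commute_of_bracket_eq_zero (h : ∀ x y : Lie3 𝒢, ⁅x, y⁆ = 0) {a b : 𝒢}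
    (ha : a ∈ connectedComponent (1 : 𝒢)) (hb : b ∈ connectedComponent (1 : 𝒢)) : a * b = b * a := by
  have hm1 := isManifold_one 3 𝒢
  obtain ⟨D, hD, hbr⟩ := exists_hasFDerivAt_adL (𝒢 := 𝒢)
  have hD0 : ∀ y x, D y x = 0 := fun y x => (hbr x y).symm.trans (h y x)
  have hpre : IsPreconnected (connectedComponent (1 : 𝒢)) := isPreconnected_connectedComponent
  have hAd : ∀ x : EuclideanSpace ℝ (Fin 3), adL a x = x := by
    intro x
    -- At the identity the derivative of c ↦ Ad_c x is the bracket with `x`, here zero.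
    -- Multiplicativity of Ad then carries the vanishing to every point.
    have h1 : HasMFDerivAt (𝓡 3) 𝓘(ℝ, EuclideanSpace ℝ (Fin 3)) (fun c : 𝒢 => adL c x) 1 0 := by
      have d1 := (hD.clm_apply (hasFDerivAt_const x _)).hasMFDerivAt
      have d2 := (mdifferentiableAt_extChartAt (I := 𝓡 3) (mem_chart_source
        (EuclideanSpace ℝ (Fin 3)) (1 : 𝒢))).hasMFDerivAt
      have d3 := HasMFDerivAt.comp (1 : 𝒢) d1 d2
      have d4 := d3.congr_of_eventuallyEq (f₁ := fun c : 𝒢 => adL c x) (by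
        filter_upwards [extChartAt_source_mem_nhds (I := 𝓡 3) (1 : 𝒢)] with c hc
        simp only [Function.comp_apply]
        rw [(extChartAt (𝓡 3) (1 : 𝒢)).left_inv hc])
      have e : ∀ v : EuclideanSpace ℝ (Fin 3), (ContinuousLinearMap.comp
          (((adL ((extChartAt (𝓡 3) (1 : 𝒢)).symm (extChartAt (𝓡 3) (1 : 𝒢) 1))).comp
          (0 : EuclideanSpace ℝ (Fin 3) →L[ℝ] EuclideanSpace ℝ (Fin 3))) + D.flip x)
          (show EuclideanSpace ℝ (Fin 3) →L[ℝ] EuclideanSpace ℝ (Fin 3) from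
          mfderiv (𝓡 3) 𝓘(ℝ, EuclideanSpace ℝ (Fin 3)) (extChartAt (𝓡 3) (1 : 𝒢)) 1)) v = 0 := by
        intro v
        show adL _ 0 + D _ x = 0
        rw [hD0, map_zero, add_zero]
      exact d4.congr_mfderiv (ContinuousLinearMap.ext e)
    have h2 : ∀ c : 𝒢, HasMFDerivAt (𝓡 3) 𝓘(ℝ, EuclideanSpace ℝ (Fin 3))
        (fun c : 𝒢 => adL c x) c 0 := by
      intro c
      have e1 : (fun b : 𝒢 => adL b x) = (adL c) ∘ (fun b => adL b x) ∘ fun b => c⁻¹ * b := by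
        ext1 b
        simp only [Function.comp_apply]
        rw [← ContinuousLinearMap.comp_apply, ← adL_mul, mul_inv_cancel_left]
      have d1 : HasMFDerivAt (𝓡 3) 𝓘(ℝ, EuclideanSpace ℝ (Fin 3)) (fun c : 𝒢 => adL c x)
          (c⁻¹ * c) 0 := by rw [inv_mul_cancel]; exact h1
      have d2 := (mdifferentiable_of_contMDiff_top (contMDiff_const.mul contMDiff_id :
        ContMDiff (𝓡 3) (𝓡 3) ∞ fun b => c⁻¹ * b) c).hasMFDerivAt
      have d3 := (adL c).hasFDerivAt.hasMFDerivAt.comp c (d1.comp c d2)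
      rw [e1]
      refine d3.congr_mfderiv (ContinuousLinearMap.ext fun v => ?_)
      exact (adL c).map_zero
    have h3 : IsLocallyConstant (fun c : 𝒢 => adL c x) := by
      rw [IsLocallyConstant.iff_eventually_eq]
      intro c
      exact eventually_eq_of_mfderiv_eq_zero (k := 3) (fun q => (h2 q).mdifferentiableAt)
        (fun q => (h2 q).mfderiv) c
    have h4 := h3.apply_eq_of_isPreconnected hpre ha mem_connectedComponent
    rw [h4, adL_one]; rfl
  have h5 : ∀ c : 𝒢, mfderiv (𝓡 3) (𝓡 3) (fun b : 𝒢 => a * b * a⁻¹ * b⁻¹) c = 0 := by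
    intro c
    have e0 : adL a = ContinuousLinearMap.id ℝ _ := ContinuousLinearMap.ext hAd
    -- The same translation argument for the commutator with `a`: its derivative at 1 is Ad a − 1 =
    -- 0, and this identity transports it to `c`.
    have e1 : (fun b : 𝒢 => a * b * a⁻¹ * b⁻¹) = (fun d => a * c * a⁻¹ * d * c⁻¹) ∘
        (fun b => a * b * a⁻¹ * b⁻¹) ∘ fun b => c⁻¹ * b := by
      ext1 b
      simp only [Function.comp_apply]
      group
    have d0 : HasMFDerivAt (𝓡 3) (𝓡 3) (fun b : 𝒢 => a * b * a⁻¹ * b⁻¹) 1 0 := by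
      refine (mdifferentiable_of_contMDiff_top (contMDiff_commutator a) 1).hasMFDerivAt.congr_mfderiv
        ((derivOne_commutator a).trans ?_)
      rw [e0, sub_self]; rfl
    have d1 : HasMFDerivAt (𝓡 3) (𝓡 3) (fun b : 𝒢 => a * b * a⁻¹ * b⁻¹) (c⁻¹ * c) 0 := by
      rw [inv_mul_cancel]; exact d0
    have d2 := (mdifferentiable_of_contMDiff_top (contMDiff_const.mul contMDiff_id :
        ContMDiff (𝓡 3) (𝓡 3) ∞ fun b => c⁻¹ * b) c).hasMFDerivAt
    have d4 := (mdifferentiable_of_contMDiff_top ((contMDiff_const.mul contMDiff_id).mul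
      contMDiff_const : ContMDiff (𝓡 3) (𝓡 3) ∞ fun d => a * c * a⁻¹ * d * c⁻¹)
      (a * (c⁻¹ * c) * a⁻¹ * (c⁻¹ * c)⁻¹)).hasMFDerivAt
    have d3 := d4.comp c (d1.comp c d2)
    rw [e1]
    refine Eq.trans (HasMFDerivAt.mfderiv d3) ?_
    refine ContinuousLinearMap.ext fun v => ?_
    exact ContinuousLinearMap.map_zero _
  have h6 : IsLocallyConstant (fun b : 𝒢 => a * b * a⁻¹ * b⁻¹) := by
    rw [IsLocallyConstant.iff_eventually_eq]
    intro c
    exact eventually_eq_of_mfderiv_eq_zero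
      (mdifferentiable_of_contMDiff_top (contMDiff_commutator a)) h5 c
  have h7 := h6.apply_eq_of_isPreconnected hpre hb mem_connectedComponent
  simp only [mul_one, mul_inv_cancel, inv_one] at h7
  rw [mul_inv_eq_one, mul_inv_eq_iff_eq_mul] at h7
  exact h7

end LieGroup

/-! ### Smoothness of vector fields and of derivatives along them. -/

section Fields

variable {n : ℕ} {N : Type*} [TopologicalSpace N] [ChartedSpace (EuclideanSpace ℝ (Fin n)) N]
  [IsManifold (𝓡 n) ∞ N]

/-- Near `p` the trivialisation of the tangent bundle at `p` is the derivative of the chart at `p`.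
-/
theorem contMDiffAt_section_iff_chartField {V : ∀ p : N, TangentSpace (𝓡 n) p} {p : N} :
    ContMDiffAt (𝓡 n) (𝓡 n).tangent ∞ (fun q => (⟨q, V q⟩ : TangentBundle (𝓡 n) N)) p ↔
      ContDiffAt ℝ ∞ (chartField p V) (extChartAt (𝓡 n) p p) := by
  have := isManifold_one n N
  have e : (fun q => ((trivializationAt (EuclideanSpace ℝ (Fin n)) (TangentSpace (𝓡 n)) p)
      (⟨q, V q⟩ : TangentBundle (𝓡 n) N)).2) =ᶠ[nhds p]
      fun q => (mfderiv (𝓡 n) 𝓘(ℝ, EuclideanSpace ℝ (Fin n)) (extChartAt (𝓡 n) p) q (V q)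
        : EuclideanSpace ℝ (Fin n)) := by
    filter_upwards [(chartAt (EuclideanSpace ℝ (Fin n)) p).open_source.mem_nhds
      (mem_chart_source _ p)] with q hq
    have h1 := TangentBundle.continuousLinearMapAt_trivializationAt (I := 𝓡 n) hq
    have h2 := congrArg (fun T : EuclideanSpace ℝ (Fin n) →L[ℝ] EuclideanSpace ℝ (Fin n) =>
      T (V q)) h1
    refine Eq.trans ?_ h2
    exact (Bundle.Trivialization.continuousLinearMapAt_apply_of_mem (R := ℝ) (trivializationAt (EuclideanSpace ℝ (Fin n)) (TangentSpace (𝓡 n)) p)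
      (show q ∈ (trivializationAt (EuclideanSpace ℝ (Fin n)) (TangentSpace (𝓡 n)) p).baseSet from hq)
      (V q)).symm
  let G : N → EuclideanSpace ℝ (Fin n) := fun q =>
    mfderiv (𝓡 n) 𝓘(ℝ, EuclideanSpace ℝ (Fin n)) (extChartAt (𝓡 n) p) q (V q)
  have e' : (fun q => ((trivializationAt (EuclideanSpace ℝ (Fin n)) (TangentSpace (𝓡 n)) p)
      (⟨q, V q⟩ : TangentBundle (𝓡 n) N)).2) =ᶠ[nhds p] G := e
  have h3 : ContMDiffAt (𝓡 n) 𝓘(ℝ, EuclideanSpace ℝ (Fin n)) ∞ G p ↔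
      ContDiffAt ℝ ∞ (chartField p V) (extChartAt (𝓡 n) p p) := by
    rw [contMDiffAt_iff_source, ModelWithCorners.range_eq_univ, contMDiffWithinAt_univ,
      contMDiffAt_iff_contDiffAt]
    rfl
  rw [← h3, ← e'.contMDiffAt_iff]
  exact Bundle.contMDiffAt_section p

/-- The chart stays at `p` while `q` varies, so that the formula holds on a neighbourhood and can be
differentiated again, as D_v D_v G requires. -/
theorem mfderiv_apply_eq_chart {V : ∀ p : N, TangentSpace (𝓡 n) p} {p q : N} {F : Type*}
    [NormedAddCommGroup F] [NormedSpace ℝ F] {f : N → F}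
    (hq : q ∈ (extChartAt (𝓡 n) p).source) (hf : MDifferentiableAt (𝓡 n) 𝓘(ℝ, F) f q) :
    (mfderiv (𝓡 n) 𝓘(ℝ, F) f q (V q) : F) =
      fderiv ℝ (fun x => f ((extChartAt (𝓡 n) p).symm x)) (extChartAt (𝓡 n) p q)
        (chartField p V (extChartAt (𝓡 n) p q)) := by
  have := isManifold_one n N
  have hx := (extChartAt (𝓡 n) p).map_source hq
  have hinv := (extChartAt (𝓡 n) p).left_inv hq
  have d1 : MDifferentiableAt 𝓘(ℝ, EuclideanSpace ℝ (Fin n)) (𝓡 n) (extChartAt (𝓡 n) p).symm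
      (extChartAt (𝓡 n) p q) := by
    have := mdifferentiableWithinAt_extChartAt_symm (I := 𝓡 n) hx
    rwa [ModelWithCorners.range_eq_univ, mdifferentiableWithinAt_univ] at this
  have d2 : MDifferentiableAt (𝓡 n) 𝓘(ℝ, F) f
      ((extChartAt (𝓡 n) p).symm (extChartAt (𝓡 n) p q)) := by rwa [hinv]
  let L₁ : EuclideanSpace ℝ (Fin n) →L[ℝ] F :=
    mfderiv (𝓡 n) 𝓘(ℝ, F) f ((extChartAt (𝓡 n) p).symm (extChartAt (𝓡 n) p q))
  let L₂ : EuclideanSpace ℝ (Fin n) →L[ℝ] EuclideanSpace ℝ (Fin n) :=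
    mfderiv 𝓘(ℝ, EuclideanSpace ℝ (Fin n)) (𝓡 n) (extChartAt (𝓡 n) p).symm (extChartAt (𝓡 n) p q)
  have h1 : HasFDerivAt (fun x => f ((extChartAt (𝓡 n) p).symm x)) (L₁.comp L₂)
      (extChartAt (𝓡 n) p q) :=
    (d2.hasMFDerivAt.comp (extChartAt (𝓡 n) p q) d1.hasMFDerivAt).hasFDerivAt
  have h2 := congrArg (fun T : EuclideanSpace ℝ (Fin n) →L[ℝ] F =>
    T (chartField p V (extChartAt (𝓡 n) p q))) h1.fderiv
  refine Eq.trans ?_ h2.symm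
  have h4 := mfderiv_chart_symm_apply hx (V ((extChartAt (𝓡 n) p).symm (extChartAt (𝓡 n) p q)))
  have h5 : ∀ r, r = q → (mfderiv (𝓡 n) 𝓘(ℝ, F) f r (V r) : F) =
      mfderiv (𝓡 n) 𝓘(ℝ, F) f q (V q) := by rintro r rfl; rfl
  refine (h5 _ hinv).symm.trans ?_
  exact congrArg (fun u : TangentSpace (𝓡 n) ((extChartAt (𝓡 n) p).symm (extChartAt (𝓡 n) p q)) =>
    (mfderiv (𝓡 n) 𝓘(ℝ, F) f ((extChartAt (𝓡 n) p).symm (extChartAt (𝓡 n) p q)) u : F)) h4.symm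

theorem contMDiffAt_mfderiv_apply {V : ∀ p : N, TangentSpace (𝓡 n) p} {p : N} {F : Type*}
    [NormedAddCommGroup F] [NormedSpace ℝ F] {f : N → F} {s : Set N} (hs : IsOpen s) (hp : p ∈ s)
    (hV : ContMDiffAt (𝓡 n) (𝓡 n).tangent ∞ (fun q => (⟨q, V q⟩ : TangentBundle (𝓡 n) N)) p)
    (hf : ContMDiffOn (𝓡 n) 𝓘(ℝ, F) ∞ f s) :
    ContMDiffAt (𝓡 n) 𝓘(ℝ, F) ∞ (fun q => (mfderiv (𝓡 n) 𝓘(ℝ, F) f q (V q) : F)) p := by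
  have := isManifold_one n N
  have e : (fun q => (mfderiv (𝓡 n) 𝓘(ℝ, F) f q (V q) : F)) =ᶠ[nhds p]
      (fun x => fderiv ℝ (fun x => f ((extChartAt (𝓡 n) p).symm x)) x (chartField p V x)) ∘
        extChartAt (𝓡 n) p := by
    filter_upwards [extChartAt_source_mem_nhds (I := 𝓡 n) p, hs.mem_nhds hp] with q hq hqs
    exact mfderiv_apply_eq_chart hq
      ((hf.contMDiffAt (hs.mem_nhds hqs)).mdifferentiableAt (by norm_num))
  refine ContMDiffAt.congr_of_eventuallyEq ?_ e
  refine ContMDiffAt.comp (I' := 𝓘(ℝ, EuclideanSpace ℝ (Fin n))) p ?_ contMDiffAt_extChartAt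
  rw [contMDiffAt_iff_contDiffAt]
  have h1 : ContDiffAt ℝ ∞ (fun x => f ((extChartAt (𝓡 n) p).symm x)) (extChartAt (𝓡 n) p p) := by
    have := contMDiffAt_iff_source.1 (hf.contMDiffAt (hs.mem_nhds hp))
    rw [ModelWithCorners.range_eq_univ, contMDiffWithinAt_univ, contMDiffAt_iff_contDiffAt] at this
    exact this
  exact (h1.fderiv_right (m := ∞) (by simp)).clm_apply (contMDiffAt_section_iff_chartField.1 hV)

end Fields

/-! ### Integral curves, and differentiation along them. -/

section Curves

variable {n : ℕ} {N : Type*} [TopologicalSpace N] [ChartedSpace (EuclideanSpace ℝ (Fin n)) N]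
  [IsManifold (𝓡 n) ∞ N]

theorem exists_integral_curve {V : ∀ p : N, TangentSpace (𝓡 n) p} {p : N}
    (hV : ContMDiffAt (𝓡 n) (𝓡 n).tangent ∞ (fun q => (⟨q, V q⟩ : TangentBundle (𝓡 n) N)) p) :
    ∃ γ : ℝ → N, γ 0 = p ∧ IsMIntegralCurveAt γ V 0 := by
  have := isManifold_one n N
  exact exists_isMIntegralCurveAt_of_contMDiffAt_boundaryless 0 (hV.of_le (by norm_num))

theorem hasDerivAt_comp_integral_curve {V : ∀ p : N, TangentSpace (𝓡 n) p} {γ : ℝ → N} {t : ℝ}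
    {F : Type*} [NormedAddCommGroup F] [NormedSpace ℝ F] {f : N → F}
    (hγ : HasMFDerivAt 𝓘(ℝ, ℝ) (𝓡 n) γ t ((1 : ℝ →L[ℝ] ℝ).smulRight (V (γ t))))
    (hf : MDifferentiableAt (𝓡 n) 𝓘(ℝ, F) f (γ t)) :
    HasDerivAt (fun s => f (γ s)) (mfderiv (𝓡 n) 𝓘(ℝ, F) f (γ t) (V (γ t)) : F) t := by
  let L : EuclideanSpace ℝ (Fin n) →L[ℝ] F := mfderiv (𝓡 n) 𝓘(ℝ, F) f (γ t)
  let v : EuclideanSpace ℝ (Fin n) := V (γ t)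
  have h1 : HasFDerivAt (fun s => f (γ s)) (L.comp ((1 : ℝ →L[ℝ] ℝ).smulRight v)) t :=
    (hf.hasMFDerivAt.comp t hγ).hasFDerivAt
  have h2 : HasDerivAt (fun s => f (γ s)) (L ((1 : ℝ) • v)) t := h1.hasDerivAt
  rw [one_smul] at h2
  exact h2

end Curves

/-! ### Vertical vectors and the differential of the projection. -/

section Bundle

variable {𝒢 P M : Type*}
  [TopologicalSpace 𝒢] [ChartedSpace (EuclideanSpace ℝ (Fin 3)) 𝒢] [Group 𝒢]
  [LieGroup (𝓡 3) ∞ 𝒢]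
  [TopologicalSpace P] [ChartedSpace (EuclideanSpace ℝ (Fin 4)) P] [IsManifold (𝓡 4) ∞ P]
  [TopologicalSpace M] [ChartedSpace (EuclideanSpace ℝ (Fin 1)) M] [IsManifold (𝓡 1) ∞ M]
  (B : PrincipalBundle 𝒢 P M) (g : Metric4 P)

/-- The infinitesimal action as a linear map of model spaces. -/
def vertL (p : P) : EuclideanSpace ℝ (Fin 3) →L[ℝ] EuclideanSpace ℝ (Fin 4) :=
  mfderiv (𝓡 3) (𝓡 4) (fun a : 𝒢 => B.act p a) 1

theorem chartField_vert {p : P} (v : Lie3 𝒢) {x : EuclideanSpace ℝ (Fin 4)}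
    (hx : x ∈ (extChartAt (𝓡 4) p).target) :
    chartField p (fun q => vert B q v) x =
      fderiv ℝ (fun s => chartAct B.act p (x, s)) (extChartAt (𝓡 3) (1 : 𝒢) 1) v :=
  (fderiv_chartAct_right B.contMDiff_act B.act_one hx v rfl).symm

theorem contMDiffAt_vert (v : Lie3 𝒢) (p : P) : ContMDiffAt (𝓡 4) (𝓡 4).tangent ∞
    (fun q => (⟨q, vert B q v⟩ : TangentBundle (𝓡 4) P)) p := by
  rw [contMDiffAt_section_iff_chartField]
  have e : chartField p (fun q => vert B q v) =ᶠ[nhds (extChartAt (𝓡 4) p p)]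
      fun x => fderiv ℝ (fun s => chartAct B.act p (x, s)) (extChartAt (𝓡 3) (1 : 𝒢) 1) v := by
    filter_upwards [chart_target_mem_nhds (n := 4) p] with x hx using chartField_vert B v hx
  refine ContDiffAt.congr_of_eventuallyEq ?_ e
  have h := contDiffAt_chartAct (q₀ := p) B.contMDiff_act B.act_one
  have h1 : ContDiffAt ℝ ∞ (fun x => fderiv ℝ (fun s => chartAct B.act p (x, s))
      (extChartAt (𝓡 3) (1 : 𝒢) 1)) (extChartAt (𝓡 4) p p) :=
    ContDiffAt.fderiv (n := ∞) (f := fun x s => chartAct B.act p (x, s)) h contDiffAt_const (by simp)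
  exact h1.clm_apply contDiffAt_const

theorem contMDiffAt_metric {V W : ∀ p : P, TangentSpace (𝓡 4) p} {p : P}
    (hV : ContMDiffAt (𝓡 4) (𝓡 4).tangent ∞ (fun q => (⟨q, V q⟩ : TangentBundle (𝓡 4) P)) p)
    (hW : ContMDiffAt (𝓡 4) (𝓡 4).tangent ∞ (fun q => (⟨q, W q⟩ : TangentBundle (𝓡 4) P)) p) :
    ContMDiffAt (𝓡 4) 𝓘(ℝ, ℝ) ∞ (fun q => g.inner q (V q) (W q)) p := by
  have h := ContMDiffAt.clm_bundle_apply₂ (F₁ := EuclideanSpace ℝ (Fin 4))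
    (F₂ := EuclideanSpace ℝ (Fin 4)) (F₃ := ℝ) (E₃ := Bundle.Trivial P ℝ)
    (g.contMDiff.contMDiffAt (x := p)) hV hW
  exact (Bundle.contMDiffAt_totalSpace.1 h).2

theorem contMDiff_fibG (x y : Lie3 𝒢) :
    ContMDiff (𝓡 4) 𝓘(ℝ, ℝ) ∞ (fun q => fibG B g q x y) := fun p =>
  contMDiffAt_metric g (contMDiffAt_vert B x p) (contMDiffAt_vert B y p)

theorem mdifferentiable_act_left (p : P) (a : 𝒢) : 
    MDifferentiableAt (𝓡 3) (𝓡 4) (fun a : 𝒢 => B.act p a) a :=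
  (contMDiff_act_left B.contMDiff_act p).mdifferentiableAt (by norm_num)

theorem mdifferentiable_act_right (a : 𝒢) (p : P) : 
    MDifferentiableAt (𝓡 4) (𝓡 4) (fun p => B.act p a) p :=
  (contMDiff_act_right B.contMDiff_act a).mdifferentiableAt (by norm_num)

/-- In a trivialisation the group component of p · a is that of p times a. Translating it back
inverts a ↦ p · a on the left, so the differential has a left inverse. -/
theorem vert_injective (p : P) : Function.Injective (vertL B p) := by
  rw [injective_iff_map_eq_zero]
  intro x hx
  obtain ⟨U, e, hU, hm, hs, ht, he, -, -, hact⟩ := B.locallyTrivial (B.proj p)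
  have hp : p ∈ e.source := by rw [hs]; exact hm
  have hdF : MDifferentiableAt (𝓡 4) (𝓡 3) (fun q => (e p).2⁻¹ * (e q).2) (B.act p 1) := by
    have h1 : MDifferentiableAt (𝓡 4) ((𝓡 1).prod (𝓡 3)) e (B.act p 1) := by
      rw [B.act_one]
      exact (he.contMDiffAt (e.open_source.mem_nhds hp)).mdifferentiableAt (by norm_num)
    have h2 : MDifferentiableAt (𝓡 3) (𝓡 3) (fun b : 𝒢 => (e p).2⁻¹ * b) (e (B.act p 1)).2 :=
      (contMDiff_const.mul contMDiff_id : ContMDiff (𝓡 3) (𝓡 3) ∞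
        (fun b : 𝒢 => (e p).2⁻¹ * b)).mdifferentiableAt (by norm_num)
    exact h2.comp (B.act p 1) (mdifferentiableAt_snd.comp (B.act p 1) h1)
  have h3 := hdF.hasMFDerivAt.comp 1 (mdifferentiable_act_left B p 1).hasMFDerivAt
  have e2 : (fun q => (e p).2⁻¹ * (e q).2) ∘ (fun a : 𝒢 => B.act p a) = fun b => b := by
    ext a
    simp [hact p hp]
  rw [e2] at h3
  have h4 := hasMFDerivAt_unique h3 (hasMFDerivAt_id (I := 𝓡 3) (1 : 𝒢))
  let L : EuclideanSpace ℝ (Fin 4) →L[ℝ] EuclideanSpace ℝ (Fin 3) := 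
    mfderiv (𝓡 4) (𝓡 3) (fun q => (e p).2⁻¹ * (e q).2) (B.act p 1)
  have h5 : L (vertL B p x) = x := congrArg
    (fun T : EuclideanSpace ℝ (Fin 3) →L[ℝ] EuclideanSpace ℝ (Fin 3) => T x) h4
  rw [← h5, hx, map_zero]

/-- The differential of the projection. -/
def dproj (p : P) : EuclideanSpace ℝ (Fin 4) →L[ℝ] EuclideanSpace ℝ (Fin 1) :=
  mfderiv (𝓡 4) (𝓡 1) B.proj p

theorem mdifferentiable_proj (p : P) : MDifferentiableAt (𝓡 4) (𝓡 1) B.proj p :=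
  B.contMDiff_proj.mdifferentiableAt (by norm_num)

theorem dproj_vert (p : P) (x : EuclideanSpace ℝ (Fin 3)) : dproj B p (vertL B p x) = 0 := by
  have h := (mdifferentiable_proj B (B.act p 1)).hasMFDerivAt.comp 1
    (mdifferentiable_act_left B p 1).hasMFDerivAt
  have e : B.proj ∘ (fun a : 𝒢 => B.act p a) = fun _ => B.proj p := by
    ext a; exact B.proj_act p a
  rw [e] at h
  have h2 := hasMFDerivAt_unique h (hasMFDerivAt_const (B.proj p) (1 : 𝒢))
  have h3 : dproj B (B.act p 1) (vertL B p x) = 0 := congrArg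
    (fun T : EuclideanSpace ℝ (Fin 3) →L[ℝ] EuclideanSpace ℝ (Fin 1) => T x) h2
  rwa [B.act_one] at h3

theorem exists_local_section (p : P) : ∃ s : M → P, ContMDiffAt (𝓡 1) (𝓡 4) ∞ s (B.proj p) ∧
    s (B.proj p) = p ∧ ∀ᶠ m in nhds (B.proj p), B.proj (s m) = m := by
  obtain ⟨U, e, hU, hm, hs, ht, he, hes, hpr, hact⟩ := B.locallyTrivial (B.proj p)
  have hp : p ∈ e.source := by rw [hs]; exact hm
  refine ⟨fun m => e.symm (m, (e p).2), ?_, ?_, ?_⟩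
  · refine ContMDiffAt.comp (I' := (𝓡 1).prod (𝓡 3)) (B.proj p) (hes.contMDiffAt ?_)
      (contMDiffAt_id.prodMk contMDiffAt_const)
    exact e.open_target.mem_nhds (by rw [ht]; exact ⟨hm, trivial⟩)
  · have : (B.proj p, (e p).2) = e p := Prod.ext (hpr p hp).symm rfl
    show e.symm (B.proj p, (e p).2) = p
    rw [this, e.left_inv hp]
  · filter_upwards [hU.mem_nhds hm] with m hmU
    have hmt : (m, (e p).2) ∈ e.target := by rw [ht]; exact ⟨hmU, trivial⟩
    rw [← hpr _ (e.map_target hmt), e.right_inv hmt]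

theorem dproj_surjective (p : P) : Function.Surjective (dproj B p) := by
  obtain ⟨s, hs, hsp, hsm⟩ := exists_local_section B p
  intro w
  have d1 := (mdifferentiable_proj B (s (B.proj p))).hasMFDerivAt.comp (B.proj p)
    (hs.mdifferentiableAt (by norm_num)).hasMFDerivAt
  have h2 := hasMFDerivAt_unique d1
    ((hasMFDerivAt_id (I := 𝓡 1) (B.proj p)).congr_of_eventuallyEq hsm)
  let L : EuclideanSpace ℝ (Fin 1) →L[ℝ] EuclideanSpace ℝ (Fin 4) := mfderiv (𝓡 1) (𝓡 4) s (B.proj p)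
  have h3 : dproj B (s (B.proj p)) (L w) = w := congrArg
    (fun T : EuclideanSpace ℝ (Fin 1) →L[ℝ] EuclideanSpace ℝ (Fin 1) => T w) h2
  rw [hsp] at h3
  exact ⟨L w, h3⟩

/-- The differential of right translation as a map of model spaces. -/
def rightL (a : 𝒢) (p : P) : EuclideanSpace ℝ (Fin 4) →L[ℝ] EuclideanSpace ℝ (Fin 4) :=
  rightTrans B a p

/-- Differentiate (p · a) · b = (p · a b a⁻¹) · a in `b` at the identity. -/
theorem vert_act (p : P) (a : 𝒢) (x : EuclideanSpace ℝ (Fin 3)) :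
    vertL B (B.act p a) x = rightL B a p (vertL B p (adL a x)) := by
  have c1 : ContMDiff (𝓡 3) (𝓡 4) ∞ (fun b : 𝒢 => B.act (B.act p a) b) :=
    contMDiff_act_left B.contMDiff_act _
  have e : (fun b : 𝒢 => B.act (B.act p a) b) =
      (fun q => B.act q a) ∘ (fun b : 𝒢 => B.act p b) ∘ fun b : 𝒢 => a * b * a⁻¹ := by
    ext b; simp [← B.act_mul]
  have h1 := (mdifferentiable_act_left B p (a * 1 * a⁻¹)).hasMFDerivAt.comp (1 : 𝒢)
    (mdifferentiable_of_contMDiff_top (contMDiff_conj a) 1).hasMFDerivAt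
  have h2 := (mdifferentiable_act_right B a (B.act p (a * 1 * a⁻¹))).hasMFDerivAt.comp (1 : 𝒢) h1
  have h3 := h2.mfderiv
  have h4 : vertL B (B.act p a) x =
      (mfderiv (𝓡 4) (𝓡 4) (fun q => B.act q a) (B.act p (a * 1 * a⁻¹)) :
        EuclideanSpace ℝ (Fin 4) →L[ℝ] EuclideanSpace ℝ (Fin 4))
      ((mfderiv (𝓡 3) (𝓡 4) (fun b : 𝒢 => B.act p b) (a * 1 * a⁻¹) :
        EuclideanSpace ℝ (Fin 3) →L[ℝ] EuclideanSpace ℝ (Fin 4)) (adL a x)) := by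
    unfold vertL
    rw [e]
    exact congrArg (fun T : EuclideanSpace ℝ (Fin 3) →L[ℝ] EuclideanSpace ℝ (Fin 4) => T x) h3
  rw [h4]
  have e1 : ∀ b : 𝒢, b = 1 → ((mfderiv (𝓡 4) (𝓡 4) (fun q => B.act q a) (B.act p b) :
        EuclideanSpace ℝ (Fin 4) →L[ℝ] EuclideanSpace ℝ (Fin 4))
      ((mfderiv (𝓡 3) (𝓡 4) (fun b : 𝒢 => B.act p b) b :
        EuclideanSpace ℝ (Fin 3) →L[ℝ] EuclideanSpace ℝ (Fin 4)) (adL a x))) =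
        rightL B a p (vertL B p (adL a x)) := by
    rintro b rfl
    have : ∀ q, q = p → (mfderiv (𝓡 4) (𝓡 4) (fun q => B.act q a) q :
        EuclideanSpace ℝ (Fin 4) →L[ℝ] EuclideanSpace ℝ (Fin 4)) (vertL B p (adL a x)) =
        rightL B a p (vertL B p (adL a x)) := by rintro q rfl; rfl
    exact this _ (B.act_one p)
  exact e1 _ (by simp)

end Bundle

open Matrix

/-! ### The fibre metric and traces as matrices. -/

section Bundle

variable {𝒢 P M : Type*}
  [TopologicalSpace 𝒢] [ChartedSpace (EuclideanSpace ℝ (Fin 3)) 𝒢] [Group 𝒢]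
  [LieGroup (𝓡 3) ∞ 𝒢]
  [TopologicalSpace P] [ChartedSpace (EuclideanSpace ℝ (Fin 4)) P] [IsManifold (𝓡 4) ∞ P]
  [TopologicalSpace M] [ChartedSpace (EuclideanSpace ℝ (Fin 1)) M] [IsManifold (𝓡 1) ∞ M]
  (B : PrincipalBundle 𝒢 P M) (g : Metric4 P)

/-- A vertical vector at `p` is generated by an element of the Lie algebra. -/
theorem exists_vert_of_dproj_eq_zero {p : P} {u : EuclideanSpace ℝ (Fin 4)} (hu : dproj B p u = 0) :
    ∃ x, u = vertL B p x := by
  let D : EuclideanSpace ℝ (Fin 4) →ₗ[ℝ] EuclideanSpace ℝ (Fin 1) := dproj B p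
  let W : EuclideanSpace ℝ (Fin 3) →ₗ[ℝ] EuclideanSpace ℝ (Fin 4) := vertL B p
  have h1 : LinearMap.range W ≤ LinearMap.ker D := by
    rintro _ ⟨x, rfl⟩
    exact dproj_vert B p x
  have h2 : Module.finrank ℝ (LinearMap.range W) = 3 := by
    rw [LinearMap.finrank_range_of_inj (vert_injective B p)]; simp
  have h3 : Module.finrank ℝ (LinearMap.ker D) = 3 := by
    have := LinearMap.finrank_range_add_finrank_ker D
    rw [LinearMap.range_eq_top.2 (dproj_surjective B p)] at this
    simp at this
    omega
  have h4 := Submodule.eq_of_le_of_finrank_eq h1 (h2.trans h3.symm)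
  have h5 : u ∈ LinearMap.range W := by rw [h4]; exact hu
  obtain ⟨x, hx⟩ := h5
  exact ⟨x, hx.symm⟩

/-- The metric on the model space. -/
def gL (p : P) : EuclideanSpace ℝ (Fin 4) →L[ℝ] EuclideanSpace ℝ (Fin 4) →L[ℝ] ℝ := g.inner p

theorem gL_pos (p : P) {u : EuclideanSpace ℝ (Fin 4)} (hu : u ≠ 0) : 0 < gL g p u u := g.pos p u hu

theorem fibG_eq_gL (p : P) (x y : EuclideanSpace ℝ (Fin 3)) :
    fibG B g p x y = gL g p (vertL B p x) (vertL B p y) := rfl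

theorem fibG_symm (p : P) (x y : Lie3 𝒢) : fibG B g p x y = fibG B g p y x := g.symm p _ _

theorem fibG_pos (p : P) {x : EuclideanSpace ℝ (Fin 3)} (hx : x ≠ 0) : 0 < fibG B g p x x :=
  gL_pos g p fun h => hx (vert_injective B p (h.trans (map_zero _).symm))

/-- A tangent vector as an element of the model space. -/
def modelVec {p : P} (v : TangentSpace (𝓡 4) p) : EuclideanSpace ℝ (Fin 4) := v

variable {B g} in
/-- A unit horizontal vector and the vertical vectors span the tangent space. -/
theorem exists_decomposition {U : Set M} {V : ∀ p : P, TangentSpace (𝓡 4) p}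
    (hV : IsUnitHorizontal B g U V) {p : P} (hp : p ∈ B.proj ⁻¹' U) (u : EuclideanSpace ℝ (Fin 4)) :
    ∃ (c : ℝ) (x : EuclideanSpace ℝ (Fin 3)), u = c • modelVec (V p) + vertL B p x := by
  let v : EuclideanSpace ℝ (Fin 4) := modelVec (V p)
  have hv : dproj B p v ≠ 0 := by
    intro h
    obtain ⟨x, hx⟩ := exists_vert_of_dproj_eq_zero B h
    have h1 : gL g p v (vertL B p x) = 0 := hV.horizontal p hp x
    have h2 : gL g p v v = 1 := hV.unit p hp
    rw [← hx, h2] at h1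
    exact one_ne_zero h1
  obtain ⟨c, hc⟩ := exists_smul_eq_of_finrank_eq_one (K := ℝ) (V := EuclideanSpace ℝ (Fin 1))
    (by simp) hv (dproj B p u)
  obtain ⟨x, hx⟩ := exists_vert_of_dproj_eq_zero B (p := p) (u := u - c • v) (by
    rw [map_sub, map_smul, hc, sub_self])
  exact ⟨c, x, by rw [← hx]; exact (add_sub_cancel _ _).symm⟩

/-- The standard basis of the model space of the group. -/
abbrev stdE (i : Fin 3) : EuclideanSpace ℝ (Fin 3) := EuclideanSpace.basisFun (Fin 3) ℝ i

theorem lieBasis_eq (i : Fin 3) : lieBasis 𝒢 i = stdE i := by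
  show (EuclideanSpace.basisFun (Fin 3) ℝ).toBasis i = _
  simp

theorem sum_stdE (x : EuclideanSpace ℝ (Fin 3)) : x = ∑ i, x i • stdE i := by
  have := (EuclideanSpace.basisFun (Fin 3) ℝ).sum_repr x
  simpa using this.symm

/-- The matrix of a bilinear form in the standard basis. -/
def matB (T : Lie3 𝒢 → Lie3 𝒢 → ℝ) : Matrix (Fin 3) (Fin 3) ℝ :=
  Matrix.of fun i j => T (lieBasis 𝒢 i) (lieBasis 𝒢 j)

theorem sum_eq_dotProduct (A : Matrix (Fin 3) (Fin 3) ℝ) (x y : Fin 3 → ℝ) :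
    x ⬝ᵥ A *ᵥ y = ∑ i, ∑ j, (x i * y j) * A i j := by
  simp only [dotProduct, mulVec, Finset.mul_sum]
  refine Finset.sum_congr rfl fun i _ => Finset.sum_congr rfl fun j _ => ?_
  ring

theorem bilin_eq_dotProduct (T : EuclideanSpace ℝ (Fin 3) →ₗ[ℝ] EuclideanSpace ℝ (Fin 3) →ₗ[ℝ] ℝ)
    (x y : EuclideanSpace ℝ (Fin 3)) :
    T x y = x.ofLp ⬝ᵥ (Matrix.of fun i j => T (stdE i) (stdE j)) *ᵥ y.ofLp := by
  conv_lhs => rw [sum_stdE x, sum_stdE y]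
  rw [sum_eq_dotProduct]
  simp only [map_sum, LinearMap.sum_apply, map_smul, LinearMap.smul_apply, smul_eq_mul, Matrix.of_apply]
  simp only [Finset.mul_sum]
  rw [Finset.sum_comm]
  refine Finset.sum_congr rfl fun i _ => Finset.sum_congr rfl fun j _ => ?_
  ring

/-- The Gram matrix of the fibre metric. -/
def gram (p : P) : Matrix (Fin 3) (Fin 3) ℝ := matB (fibG B g p)

theorem fibG_eq_dotProduct (p : P) (x y : EuclideanSpace ℝ (Fin 3)) :
    fibG B g p x y = x.ofLp ⬝ᵥ gram B g p *ᵥ y.ofLp := by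
  let L : EuclideanSpace ℝ (Fin 3) →ₗ[ℝ] EuclideanSpace ℝ (Fin 4) := vertL B p
  let T₀ : EuclideanSpace ℝ (Fin 4) →ₗ[ℝ] EuclideanSpace ℝ (Fin 4) →ₗ[ℝ] ℝ :=
    LinearMap.mk₂ ℝ (fun u w => gL g p u w) (by simp) (by simp) (by simp) (by simp)
  have h := bilin_eq_dotProduct (T₀.compl₁₂ L L) x y
  refine (show fibG B g p x y = T₀.compl₁₂ L L x y from rfl).trans (h.trans ?_)
  have e : gram B g p = Matrix.of fun i j => T₀.compl₁₂ L L (stdE i) (stdE j) := by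
    ext i j
    simp only [gram, matB, Matrix.of_apply, lieBasis_eq]
    rfl
  rw [e]

theorem gram_posDef (p : P) : (gram B g p).PosDef := by
  refine Matrix.PosDef.of_dotProduct_mulVec_pos ?_ ?_
  · ext i j
    exact fibG_symm B g p _ _
  · intro x hx
    have h := fibG_pos B g p (x := WithLp.toLp 2 x) (by simpa using hx)
    rw [fibG_eq_dotProduct] at h
    simpa using h

theorem gram_transpose (p : P) : (gram B g p)ᵀ = gram B g p := by
  ext i j
  exact fibG_symm B g p _ _

theorem gram_det_pos (p : P) : 0 < (gram B g p).det := (gram_posDef B g p).det_pos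

theorem gram_inv_posDef (p : P) : (gram B g p)⁻¹.PosDef := (gram_posDef B g p).inv

theorem trG_eq {E : Type*} [AddCommGroup E] [Module ℝ E] (p : P) (T : Lie3 𝒢 → Lie3 𝒢 → E) :
    trG B g p T = ∑ i, ∑ j, (gram B g p)⁻¹ i j • T (lieBasis 𝒢 i) (lieBasis 𝒢 j) := rfl

theorem normSq2_eq (p : P) (T : Lie3 𝒢 → Lie3 𝒢 → ℝ) :
    normSq2 B g p T = contr2 (gram B g p)⁻¹ (matB T) := rfl

theorem normSq1_eq (p : P) (α : Lie3 𝒢 → ℝ) : normSq1 B g p α =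
    (fun i => α (lieBasis 𝒢 i)) ⬝ᵥ (gram B g p)⁻¹ *ᵥ (fun i => α (lieBasis 𝒢 i)) := by
  rw [sum_eq_dotProduct, normSq1, trG_eq]
  refine Finset.sum_congr rfl fun i _ => Finset.sum_congr rfl fun j _ => ?_
  rw [smul_eq_mul]; ring

theorem normSq1_nonneg (p : P) (α : Lie3 𝒢 → ℝ) : 0 ≤ normSq1 B g p α := by
  rw [normSq1_eq]
  simpa using (gram_inv_posDef B g p).posSemidef.dotProduct_mulVec_nonneg (fun i => α (lieBasis 𝒢 i))

theorem normSq2_nonneg (p : P) (T : Lie3 𝒢 → Lie3 𝒢 → ℝ) : 0 ≤ normSq2 B g p T :=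
  contr2_nonneg (gram_inv_posDef B g p) _

theorem trG_mul_eq (p : P) (T T' : Lie3 𝒢 → Lie3 𝒢 → ℝ) (i j : Fin 3) :
    trG B g p (fun c c' => T (lieBasis 𝒢 i) c * T' (lieBasis 𝒢 j) c') =
      (matB T * (gram B g p)⁻¹ * (matB T')ᵀ) i j := by
  rw [trG_eq]
  simp only [Matrix.mul_apply, Finset.sum_mul, Matrix.transpose_apply, matB, Matrix.of_apply, smul_eq_mul]
  rw [Finset.sum_comm]
  refine Finset.sum_congr rfl fun i _ => Finset.sum_congr rfl fun j _ => ?_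
  ring

theorem trG_eq_trace (p : P) (T : Lie3 𝒢 → Lie3 𝒢 → ℝ) :
    trG B g p T = ((gram B g p)⁻¹ * matB T).trace := by
  have hS : ((gram B g p)⁻¹)ᵀ = (gram B g p)⁻¹ := by
    rw [Matrix.transpose_nonsing_inv, gram_transpose]
  rw [trG_eq]
  simp only [Matrix.trace, Matrix.diag, Matrix.mul_apply]
  rw [Finset.sum_comm]
  refine Finset.sum_congr rfl fun i _ => Finset.sum_congr rfl fun j _ => ?_
  conv_rhs => rw [← hS]
  rfl

end Bundle

/-! ### Derivatives of the fibre metric along flow lines. -/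

section Bundle

variable {𝒢 P M : Type*}
  [TopologicalSpace 𝒢] [ChartedSpace (EuclideanSpace ℝ (Fin 3)) 𝒢] [Group 𝒢]
  [LieGroup (𝓡 3) ∞ 𝒢]
  [TopologicalSpace P] [ChartedSpace (EuclideanSpace ℝ (Fin 4)) P] [IsManifold (𝓡 4) ∞ P]
  [TopologicalSpace M] [ChartedSpace (EuclideanSpace ℝ (Fin 1)) M] [IsManifold (𝓡 1) ∞ M]
  {B : PrincipalBundle 𝒢 P M} {g : Metric4 P} {H : ThreeForm P}
  {U : Set M} {V : ∀ p : P, TangentSpace (𝓡 4) p}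

theorem isOpen_preimage (B : PrincipalBundle 𝒢 P M) (hU : IsOpen U) : IsOpen (B.proj ⁻¹' U) :=
  hU.preimage B.contMDiff_proj.continuous

theorem IsUnitHorizontal.contMDiffAt (hU : IsOpen U) (hV : IsUnitHorizontal B g U V) {p : P}
    (hp : p ∈ B.proj ⁻¹' U) : ContMDiffAt (𝓡 4) (𝓡 4).tangent ∞
    (fun p => (⟨p, V p⟩ : TangentBundle (𝓡 4) P)) p :=
  hV.smooth.contMDiffAt ((isOpen_preimage B hU).mem_nhds hp)

/-- At time `t`, the curve `γ` is over `U` and has velocity `V`. -/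
def FlowsAt (B : PrincipalBundle 𝒢 P M) (U : Set M) (V : ∀ p : P, TangentSpace (𝓡 4) p)
    (γ : ℝ → P) (t : ℝ) : Prop :=
  γ t ∈ B.proj ⁻¹' U ∧ HasMFDerivAt 𝓘(ℝ, ℝ) (𝓡 4) γ t ((1 : ℝ →L[ℝ] ℝ).smulRight (V (γ t)))

theorem exists_flow_line (hU : IsOpen U) (hV : IsUnitHorizontal B g U V) {p : P}
    (hp : p ∈ B.proj ⁻¹' U) :
    ∃ γ : ℝ → P, γ 0 = p ∧ ContinuousAt γ 0 ∧ ∀ᶠ t in nhds 0, FlowsAt B U V γ t := by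
  obtain ⟨γ, h0, hγ⟩ := exists_integral_curve (hV.contMDiffAt hU hp)
  refine ⟨γ, h0, hγ.continuousAt, ?_⟩
  have h1 : ∀ᶠ t in nhds (0 : ℝ), γ t ∈ B.proj ⁻¹' U :=
    hγ.continuousAt.eventually ((isOpen_preimage B hU).mem_nhds (by rw [h0]; exact hp))
  exact h1.and hγ

theorem FlowsAt.hasDerivAt {γ : ℝ → P} {t : ℝ} (h : FlowsAt B U V γ t) {F : Type*}
    [NormedAddCommGroup F] [NormedSpace ℝ F] {f : P → F}
    (hf : MDifferentiableAt (𝓡 4) 𝓘(ℝ, F) f (γ t)) :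
    HasDerivAt (fun s => f (γ s)) (covDeriv V f (γ t)) t :=
  hasDerivAt_comp_integral_curve h.2 hf

theorem mdifferentiableAt_fibG (x y : Lie3 𝒢) (p : P) :
    MDifferentiableAt (𝓡 4) 𝓘(ℝ, ℝ) (fun q => fibG B g q x y) p :=
  (contMDiff_fibG B g x y).mdifferentiableAt (by norm_num)

theorem contMDiffOn_dG (hU : IsOpen U) (hV : IsUnitHorizontal B g U V) (x y : Lie3 𝒢) :
    ContMDiffOn (𝓡 4) 𝓘(ℝ, ℝ) ∞ (fun q => dG B g V q x y) (B.proj ⁻¹' U) := fun _ hp =>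
  (contMDiffAt_mfderiv_apply (isOpen_preimage B hU) hp (hV.contMDiffAt hU hp)
    (contMDiff_fibG B g x y).contMDiffOn).contMDiffWithinAt

theorem mdifferentiableAt_dG (hU : IsOpen U) (hV : IsUnitHorizontal B g U V) (x y : Lie3 𝒢) {p : P}
    (hp : p ∈ B.proj ⁻¹' U) : MDifferentiableAt (𝓡 4) 𝓘(ℝ, ℝ) (fun q => dG B g V q x y) p :=
  ((contMDiffOn_dG hU hV x y).contMDiffAt ((isOpen_preimage B hU).mem_nhds hp)).mdifferentiableAt
    (by norm_num)

theorem dG_symm (p : P) (x y : Lie3 𝒢) : dG B g V p x y = dG B g V p y x := by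
  unfold dG
  congr 1
  funext q
  exact fibG_symm B g q x y

theorem FlowsAt.hasDerivAt_gram {γ : ℝ → P} {t : ℝ} (h : FlowsAt B U V γ t) (i j : Fin 3) :
    HasDerivAt (fun s => gram B g (γ s) i j) (matB (dG B g V (γ t)) i j) t :=
  h.hasDerivAt (mdifferentiableAt_fibG _ _ _)

theorem FlowsAt.hasDerivAt_dG {γ : ℝ → P} {t : ℝ} (h : FlowsAt B U V γ t) (hU : IsOpen U)
    (hV : IsUnitHorizontal B g U V) (i j : Fin 3) :
    HasDerivAt (fun s => matB (dG B g V (γ s)) i j) (matB (ddG B g V (γ t)) i j) t :=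
  h.hasDerivAt (mdifferentiableAt_dG hU hV _ _ h.1)

/-- `dG` is defined by a separate derivative for each pair of vectors. Its bilinearity comes from
that of G along a flow line and uniqueness of derivatives. -/
theorem dG_eq_dotProduct (hU : IsOpen U) (hV : IsUnitHorizontal B g U V) {p : P}
    (hp : p ∈ B.proj ⁻¹' U) (x y : EuclideanSpace ℝ (Fin 3)) :
    dG B g V p x y = x.ofLp ⬝ᵥ matB (dG B g V p) *ᵥ y.ofLp := by
  obtain ⟨γ, rfl, -, h⟩ := exists_flow_line hU hV hp
  have h0 := h.self_of_nhds
  have h1 : HasDerivAt (fun s => fibG B g (γ s) x y) (dG B g V (γ 0) x y) 0 :=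
    h0.hasDerivAt (mdifferentiableAt_fibG _ _ _)
  simp only [fibG_eq_dotProduct, sum_eq_dotProduct] at h1
  rw [sum_eq_dotProduct]
  exact h1.unique (HasDerivAt.fun_sum fun i _ => HasDerivAt.fun_sum fun j _ =>
    (h0.hasDerivAt_gram i j).const_mul _)

theorem ddG_eq_dotProduct (hU : IsOpen U) (hV : IsUnitHorizontal B g U V) {p : P}
    (hp : p ∈ B.proj ⁻¹' U) (x y : EuclideanSpace ℝ (Fin 3)) :
    ddG B g V p x y = x.ofLp ⬝ᵥ matB (ddG B g V p) *ᵥ y.ofLp := by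
  obtain ⟨γ, rfl, -, h⟩ := exists_flow_line hU hV hp
  have h0 := h.self_of_nhds
  have h1 : HasDerivAt (fun s => dG B g V (γ s) x y) (ddG B g V (γ 0) x y) 0 :=
    h0.hasDerivAt (mdifferentiableAt_dG hU hV _ _ hp)
  have e : (fun s => dG B g V (γ s) x y) =ᶠ[nhds 0] fun s =>
      ∑ i, ∑ j, (x i * y j) * matB (dG B g V (γ s)) i j := by
    filter_upwards [h] with s hs
    rw [← sum_eq_dotProduct]
    exact dG_eq_dotProduct hU hV hs.1 x y
  rw [sum_eq_dotProduct]
  exact (h1.congr_of_eventuallyEq e.symm).unique (HasDerivAt.fun_sum fun i _ =>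
    HasDerivAt.fun_sum fun j _ => (h0.hasDerivAt_dG hU hV i j).const_mul _)

theorem trDG_eq (p : P) : trDG B g V p = ((gram B g p)⁻¹ * matB (dG B g V p)).trace :=
  trG_eq_trace B g p _

theorem matB_dG_transpose (p : P) : (matB (dG B g V p))ᵀ = matB (dG B g V p) := by
  ext i j; exact dG_symm p _ _

/-- The derivative of `log det G` along a flow line. -/
theorem FlowsAt.hasDerivAt_log_det {γ : ℝ → P} {t : ℝ} (h : FlowsAt B U V γ t) :
    HasDerivAt (fun s => Real.log (gram B g (γ s)).det) (trDG B g V (γ t)) t := by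
  have hd := gram_det_pos B g (γ t)
  have h1 := (hasDerivAt_det_curve (G := fun s => gram B g (γ s)) h.hasDerivAt_gram hd.ne').log hd.ne'
  rw [mul_div_cancel_left₀ _ hd.ne', ← trDG_eq] at h1
  exact h1

theorem FlowsAt.hasDerivAt_inv_dG {γ : ℝ → P} {t : ℝ} (h : FlowsAt B U V γ t) (hU : IsOpen U)
    (hV : IsUnitHorizontal B g U V) (i j : Fin 3) :
    HasDerivAt (fun s => ((gram B g (γ s))⁻¹ * matB (dG B g V (γ s))) i j)
      (((gram B g (γ t))⁻¹ * (matB (ddG B g V (γ t)) -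
        matB (dG B g V (γ t)) * (gram B g (γ t))⁻¹ * matB (dG B g V (γ t)))) i j) t :=
  hasDerivAt_inv_mul (G := fun s => gram B g (γ s)) h.hasDerivAt_gram (h.hasDerivAt_dG hU hV)
    (gram_det_pos B g _).ne' i j

theorem FlowsAt.hasDerivAt_trDG {γ : ℝ → P} {t : ℝ} (h : FlowsAt B U V γ t) (hU : IsOpen U)
    (hV : IsUnitHorizontal B g U V) : HasDerivAt (fun s => trDG B g V (γ s))
      ((gram B g (γ t))⁻¹ * (matB (ddG B g V (γ t)) -
        matB (dG B g V (γ t)) * (gram B g (γ t))⁻¹ * matB (dG B g V (γ t)))).trace t := by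
  simp only [trDG_eq]
  exact hasDerivAt_trace_entry (h.hasDerivAt_inv_dG hU hV)

theorem dGdG_basis (p : P) (i j : Fin 3) : dGdG B g V p (lieBasis 𝒢 i) (lieBasis 𝒢 j) =
    (matB (dG B g V p) * (gram B g p)⁻¹ * matB (dG B g V p)) i j := by
  refine (trG_mul_eq B g p (dG B g V p) (dG B g V p) i j).trans ?_
  rw [matB_dG_transpose]

/-- The components of the bracket in the orthonormal coframe `C` are scalar two-forms. This reduces
positivity and vanishing of |[,]|² to those of `contr2`. -/
theorem normSqBr_eq_sum {C : Matrix (Fin 3) (Fin 3) ℝ} (p : P) (hC : gram B g p = Cᵀ * C) :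
    normSqBr B g p = ∑ c, contr2 (gram B g p)⁻¹
      (Matrix.of fun i j => (C *ᵥ (fibBr (lieBasis 𝒢 i) (lieBasis 𝒢 j) : EuclideanSpace ℝ (Fin 3)).ofLp) c) := by
  have h : ∀ x y : Lie3 𝒢, fibG B g p x y = ∑ c, (C *ᵥ (x : EuclideanSpace ℝ (Fin 3)).ofLp) c *
      (C *ᵥ (y : EuclideanSpace ℝ (Fin 3)).ofLp) c := by
    intro x y
    refine (fibG_eq_dotProduct B g p x y).trans ?_
    rw [hC, ← mulVec_mulVec, dotProduct_mulVec, vecMul_transpose]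
    rfl
  unfold normSqBr
  simp only [trG_eq, contr2, smul_eq_mul, h, Matrix.of_apply, Finset.mul_sum]
  conv_rhs => rw [Finset.sum_comm]
  refine Finset.sum_congr rfl fun i _ => ?_
  conv_rhs => rw [Finset.sum_comm]
  refine Finset.sum_congr rfl fun j _ => ?_
  conv_rhs => rw [Finset.sum_comm]
  refine Finset.sum_congr rfl fun k _ => ?_
  conv_rhs => rw [Finset.sum_comm]

theorem normSqBr_nonneg (p : P) : 0 ≤ normSqBr B g p := by
  obtain ⟨C, hC, -⟩ := exists_factor (gram_posDef B g p)
  rw [normSqBr_eq_sum p hC]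
  exact Finset.sum_nonneg fun c _ => contr2_nonneg (gram_inv_posDef B g p) _

theorem fibBr_eq_zero_of_normSqBr {p : P} (h : normSqBr B g p = 0) (i j : Fin 3) :
    fibBr (lieBasis 𝒢 i) (lieBasis 𝒢 j) = 0 := by
  obtain ⟨C, hC, hdet⟩ := exists_factor (gram_posDef B g p)
  rw [normSqBr_eq_sum p hC, Finset.sum_eq_zero_iff_of_nonneg
    fun c _ => contr2_nonneg (gram_inv_posDef B g p) _] at h
  have h1 : C *ᵥ (fibBr (lieBasis 𝒢 i) (lieBasis 𝒢 j) : EuclideanSpace ℝ (Fin 3)).ofLp = 0 := by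
    ext c
    have := contr2_eq_zero (gram_inv_posDef B g p) (h c (Finset.mem_univ c))
    exact congrFun (congrFun this i) j
  have h2 := Matrix.eq_zero_of_mulVec_eq_zero hdet.ne_zero h1
  exact (WithLp.ofLp_eq_zero 2).1 h2

/-- The value of the three-form on the fibre. -/
def fibH (B : PrincipalBundle 𝒢 P M) (H : ThreeForm P) (p : P) : ℝ :=
  H p ![vert B p (lieBasis 𝒢 0), vert B p (lieBasis 𝒢 1), vert B p (lieBasis 𝒢 2)]

theorem normSqHfib_eq (p : P) :
    normSqHfib B g H p = 6 * (gram B g p)⁻¹.det * fibH B H p ^ 2 := by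
  refine triple_contraction (gram B g p)⁻¹ (fun i j k =>
    H p ![vert B p (lieBasis 𝒢 i), vert B p (lieBasis 𝒢 j), vert B p (lieBasis 𝒢 k)]) ?_ ?_ ?_
  · intro i j
    exact (H p).map_eq_zero_of_eq _ (i := 0) (j := 1) rfl (by decide)
  · intro i j k
    exact three_form_swap01 (H p) _ _ _
  · intro i j k
    exact three_form_swap12 (H p) _ _ _

theorem normSqHfib_nonneg (p : P) : 0 ≤ normSqHfib B g H p := by
  rw [normSqHfib_eq]
  have := (gram_inv_posDef B g p).det_pos
  positivity

end Bundle

/-! ### Pointwise consequences of vanishing S_B; equivariance of the fibre metric. -/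

section Bundle

variable {𝒢 P M : Type*}
  [TopologicalSpace 𝒢] [ChartedSpace (EuclideanSpace ℝ (Fin 3)) 𝒢] [Group 𝒢]
  [LieGroup (𝓡 3) ∞ 𝒢]
  [TopologicalSpace P] [ChartedSpace (EuclideanSpace ℝ (Fin 4)) P] [IsManifold (𝓡 4) ∞ P]
  [TopologicalSpace M] [ChartedSpace (EuclideanSpace ℝ (Fin 1)) M] [IsManifold (𝓡 1) ∞ M]
  {B : PrincipalBundle 𝒢 P M} {g : Metric4 P} {H : ThreeForm P}
  {U : Set M} {V : ∀ p : P, TangentSpace (𝓡 4) p}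

/-- `∑ DG(·, η)² ≥ DG(η, η)²` for a unit vector `η`. -/
theorem sq_dG_le (hU : IsOpen U) (hV : IsUnitHorizontal B g U V) {p : P} (hp : p ∈ B.proj ⁻¹' U)
    {η : Lie3 𝒢} (hη : fibG B g p η η = 1) :
    dG B g V p η η ^ 2 ≤ trG B g p fun c c' => dG B g V p c η * dG B g V p c' η := by
  have h1 := (fibG_eq_dotProduct B g p η η).symm.trans hη
  have h2 := inv_contr2_cauchy (gram_posDef B g p) (fun i => dG B g V p (lieBasis 𝒢 i) η) _ h1
  rw [← normSq1_eq B g p fun x => dG B g V p x η] at h2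
  refine le_of_eq_of_le ?_ h2
  congr 1
  refine (dG_eq_dotProduct hU hV hp η η).trans ?_
  simp only [dotProduct]
  refine Finset.sum_congr rfl fun i _ => ?_
  congr 1
  refine Eq.trans ?_ (dG_eq_dotProduct hU hV hp (lieBasis 𝒢 i) η).symm
  rw [lieBasis_eq]
  simp [stdE]

/-- All eight summands of `SB` are nonnegative. Only the vanishing of these three is needed. -/
theorem terms_eq_zero_of_SB (hU : IsOpen U) (hV : IsUnitHorizontal B g U V) {p : P}
    (hp : p ∈ B.proj ⁻¹' U) {η : Lie3 𝒢} (hη : fibG B g p η η = 1) (h : SB B g H V p η = 0) :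
    normSq2 B g p (fun x y => ddG B g V p x y - dGdG B g V p x y
      + trG B g p fun c c' => NilBundle.hV B H V p x c * NilBundle.hV B H V p y c') = 0 ∧
    normSqBr B g p * (trDG B g V p - 2 * dG B g V p η η) ^ 2 = 0 ∧
    normSqBr B g p * ((trG B g p fun c c' => dG B g V p c η * dG B g V p c' η) -
      dG B g V p η η ^ 2) = 0 := by
  have hbr := normSqBr_nonneg (B := B) (g := g) p
  have h4 := mul_nonneg hbr (sub_nonneg.2 (sq_dG_le hU hV hp hη))
  have h3 := mul_nonneg hbr (sq_nonneg (trDG B g V p - 2 * dG B g V p η η))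
  have h1 := normSq2_nonneg B g p (fun x y => ddG B g V p x y - dGdG B g V p x y
      + trG B g p fun c c' => NilBundle.hV B H V p x c * NilBundle.hV B H V p y c')
  have h2 := normSq2_nonneg B g p (fun x y => dhV B H V p x y
      + (trG B g p fun c c' => NilBundle.hV B H V p c x * dG B g V p c' y)
      - trG B g p fun c c' => NilBundle.hV B H V p c y * dG B g V p c' x)
  have h5 := normSq1_nonneg B g p (dGBr B g V p)
  have h6 := normSq1_nonneg B g p (fun y => dGBr B g V p y + hSqMixed B g H V p y)
  have h7 : 0 ≤ fibG B g p (hBr B g H V p) (hBr B g H V p) := by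
    by_cases h0 : hBr B g H V p = 0
    · rw [h0]
      exact (fibG_eq_dotProduct B g p 0 0).trans (by simp) |>.ge
    · exact (fibG_pos B g p h0).le
  have h8 := mul_nonneg (normSqHfib_nonneg (B := B) (g := g) (H := H) p) (sq_nonneg (trDG B g V p))
  unfold SB at h
  refine ⟨?_, ?_, ?_⟩ <;> linarith

theorem ddG_matrix_eq {p : P}
    (h : normSq2 B g p (fun x y => ddG B g V p x y - dGdG B g V p x y
      + trG B g p fun c c' => NilBundle.hV B H V p x c * NilBundle.hV B H V p y c') = 0) :
    matB (ddG B g V p) - matB (dG B g V p) * (gram B g p)⁻¹ * matB (dG B g V p) =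
      - (matB (NilBundle.hV B H V p) * (gram B g p)⁻¹ * (matB (NilBundle.hV B H V p))ᵀ) := by
  have h1 := contr2_eq_zero (gram_inv_posDef B g p) h
  ext i j
  have h2 := congrFun (congrFun h1 i) j
  rw [Matrix.zero_apply] at h2
  beta_reduce at h2
  rw [dGdG_basis, trG_mul_eq B g p (NilBundle.hV B H V p) (NilBundle.hV B H V p)] at h2
  rw [Matrix.sub_apply, Matrix.neg_apply]
  simp only [matB, Matrix.of_apply] at h2 ⊢
  linarith

theorem trHsq_nonneg (p : P) : 0 ≤ trHsq B g H V p := normSq2_nonneg B g p _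

theorem trHsq_eq (p : P) : trHsq B g H V p = ((gram B g p)⁻¹ * (matB (NilBundle.hV B H V p) * (gram B g p)⁻¹ *
    (matB (NilBundle.hV B H V p))ᵀ)).trace := by
  rw [trHsq, normSq2_eq, contr2_eq_trace (by rw [Matrix.transpose_nonsing_inv, gram_transpose])]
  simp only [Matrix.mul_assoc]

/-- The trace of the first summand's tensor. Since tr DG is the derivative of log det G, it shows
that log det G is concave along flow lines. -/
theorem FlowsAt.hasDerivAt_trDG_of_SB {γ : ℝ → P} {t : ℝ} (hγ : FlowsAt B U V γ t) (hU : IsOpen U)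
    (hV : IsUnitHorizontal B g U V)
    (h : normSq2 B g (γ t) (fun x y => ddG B g V (γ t) x y - dGdG B g V (γ t) x y
      + trG B g (γ t) fun c c' => NilBundle.hV B H V (γ t) x c * NilBundle.hV B H V (γ t) y c') = 0) :
    HasDerivAt (fun s => trDG B g V (γ s)) (-trHsq B g H V (γ t)) t := by
  convert hγ.hasDerivAt_trDG hU hV using 1
  rw [ddG_matrix_eq h, trHsq_eq, Matrix.mul_neg, Matrix.trace_neg]

/-- A normalisation of a nonzero vector. -/
theorem exists_unit_smul (B : PrincipalBundle 𝒢 P M) (g : Metric4 P) (p : P)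
    {z : EuclideanSpace ℝ (Fin 3)} (hz : z ≠ 0) :
    ∃ c : ℝ, c ≠ 0 ∧ fibG B g p (c • z) (c • z) = 1 := by
  have h := fibG_pos B g p hz
  refine ⟨(Real.sqrt (fibG B g p z z))⁻¹, inv_ne_zero (Real.sqrt_pos.2 h).ne', ?_⟩
  have h1 := Real.mul_self_sqrt h.le
  set r := Real.sqrt (fibG B g p z z)
  have hr : r ≠ 0 := (Real.sqrt_pos.2 h).ne'
  have h2 : fibG B g p (r⁻¹ • z) (r⁻¹ • z) = r⁻¹ * r⁻¹ * fibG B g p z z := by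
    refine (fibG_eq_gL B g p _ _).trans ?_
    rw [fibG_eq_gL B g p z z]
    simp [mul_assoc]
  rw [h2, ← h1]
  field_simp

section Equivariance

theorem fibG_act (hg : InvariantMetric B g) (a : 𝒢) (p : P) (x y : EuclideanSpace ℝ (Fin 3)) :
    fibG B g (B.act p a) x y = fibG B g p (adL a x) (adL a y) := by
  have h := hg a p (vertL B p (adL a x)) (vertL B p (adL a y))
  rw [fibG_eq_gL, vert_act, vert_act]
  exact h

theorem dG_act (hg : InvariantMetric B g) (hV : IsUnitHorizontal B g U V) (a : 𝒢) {p : P}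
    (hp : p ∈ B.proj ⁻¹' U) (x y : EuclideanSpace ℝ (Fin 3)) :
    dG B g V (B.act p a) x y = dG B g V p (adL a x) (adL a y) := by
  have e : (fun q => fibG B g q (adL a x) (adL a y)) =
      (fun q => fibG B g q x y) ∘ (fun q => B.act q a) := by
    funext q; exact (fibG_act hg a q x y).symm
  have h1 := (mdifferentiableAt_fibG (B := B) (g := g) x y (B.act p a)).hasMFDerivAt.comp p
    (mdifferentiable_act_right B a p).hasMFDerivAt
  unfold dG covDeriv
  rw [e]
  have h2 := congrArg (fun T : EuclideanSpace ℝ (Fin 4) →L[ℝ] ℝ => T (modelVec (V p))) h1.mfderiv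
  refine Eq.trans ?_ h2.symm
  let L : EuclideanSpace ℝ (Fin 4) →L[ℝ] ℝ := 
    mfderiv (𝓡 4) 𝓘(ℝ, ℝ) (fun q => fibG B g q x y) (B.act p a)
  exact congrArg L (hV.invariant p hp a).symm

/-- The matrix of the adjoint action. -/
def adMat (a : 𝒢) : Matrix (Fin 3) (Fin 3) ℝ :=
  Matrix.of fun i j => (adL a (stdE j)).ofLp i

theorem adMat_mulVec (a : 𝒢) (x : EuclideanSpace ℝ (Fin 3)) :
    (adL a x).ofLp = adMat a *ᵥ x.ofLp := by
  conv_lhs => rw [sum_stdE x]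
  ext i
  simp [adMat, mulVec, dotProduct, mul_comm]

theorem det_adMat [Group.IsNilpotent 𝒢] (a : 𝒢) : (adMat a).det = 1 := by
  have h := det_adL a
  rw [← LinearMap.det_toMatrix (EuclideanSpace.basisFun (Fin 3) ℝ).toBasis] at h
  rw [← h]
  congr 1
  ext i j
  simp [adMat, LinearMap.toMatrix_apply]

theorem matB_comp_adL {T T' : Lie3 𝒢 → Lie3 𝒢 → ℝ} {a : 𝒢} {A : Matrix (Fin 3) (Fin 3) ℝ}
    (hT : ∀ x y : EuclideanSpace ℝ (Fin 3), T x y = T' (adL a x) (adL a y))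
    (hA : ∀ x y : EuclideanSpace ℝ (Fin 3), T' x y = x.ofLp ⬝ᵥ A *ᵥ y.ofLp) :
    matB T = (adMat a)ᵀ * A * adMat a := by
  ext i j
  have e : matB T i j = T (stdE i) (stdE j) := by
    simp only [matB, Matrix.of_apply, lieBasis_eq]
  refine e.trans ((hT (stdE i) (stdE j)).trans ((hA _ _).trans ?_))
  rw [adMat_mulVec, adMat_mulVec]
  simp only [EuclideanSpace.basisFun_apply, PiLp.ofLp_single, mulVec_single_one]
  rw [Matrix.mul_assoc]
  rfl

theorem gram_act (hg : InvariantMetric B g) (a : 𝒢) (p : P) :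
    gram B g (B.act p a) = (adMat a)ᵀ * gram B g p * adMat a :=
  matB_comp_adL (fibG_act hg a p) (fibG_eq_dotProduct B g p)

theorem det_gram_act [Group.IsNilpotent 𝒢] (hg : InvariantMetric B g) (a : 𝒢) (p : P) :
    (gram B g (B.act p a)).det = (gram B g p).det := by
  rw [gram_act hg, det_mul, det_mul, det_transpose, det_adMat]; ring

theorem dG_matrix_act (hg : InvariantMetric B g) (hU : IsOpen U) (hV : IsUnitHorizontal B g U V)
    (a : 𝒢) {p : P} (hp : p ∈ B.proj ⁻¹' U) :
    matB (dG B g V (B.act p a)) = (adMat a)ᵀ * matB (dG B g V p) * adMat a :=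
  matB_comp_adL (dG_act hg hV a hp) (dG_eq_dotProduct hU hV hp)

end Equivariance

end Bundle

/-! ### Horizontal projection and local extension of vectors. -/

section Bundle

variable {𝒢 P M : Type*}
  [TopologicalSpace 𝒢] [ChartedSpace (EuclideanSpace ℝ (Fin 3)) 𝒢] [Group 𝒢]
  [LieGroup (𝓡 3) ∞ 𝒢]
  [TopologicalSpace P] [ChartedSpace (EuclideanSpace ℝ (Fin 4)) P] [IsManifold (𝓡 4) ∞ P]
  [TopologicalSpace M] [ChartedSpace (EuclideanSpace ℝ (Fin 1)) M] [IsManifold (𝓡 1) ∞ M]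
  (B : PrincipalBundle 𝒢 P M) (g : Metric4 P)

/-- A multiple of the horizontal part of a vector. -/
def horPart (p : P) (w : EuclideanSpace ℝ (Fin 4)) : EuclideanSpace ℝ (Fin 4) :=
  (gram B g p).det • w - ∑ i, ∑ j, ((gram B g p).adjugate i j *
    gL g p w (vertL B p (stdE i))) • vertL B p (stdE j)

/-- The adjugate times the Gram matrix is its determinant. Scaling the projection by the determinant
keeps the formula polynomial in the entries of the metric, hence visibly smooth. -/
theorem gL_horPart_stdE (p : P) (w : EuclideanSpace ℝ (Fin 4)) (k : Fin 3) :
    gL g p (horPart B g p w) (vertL B p (stdE k)) = 0 := by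
  have h : ∀ i, ∑ j, (gram B g p).adjugate i j * gL g p (vertL B p (stdE j)) (vertL B p (stdE k)) =
      (gram B g p).det * (1 : Matrix (Fin 3) (Fin 3) ℝ) i k := by
    intro i
    have := congrFun (congrFun (adjugate_mul (gram B g p)) i) k
    rw [Matrix.mul_apply, Matrix.smul_apply, smul_eq_mul] at this
    rw [← this]
    refine Finset.sum_congr rfl fun j _ => ?_
    congr 1
  have h2 : ∀ i, ∑ j, ((gram B g p).adjugate i j * gL g p w (vertL B p (stdE i))) *
      gL g p (vertL B p (stdE j)) (vertL B p (stdE k)) =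
      gL g p w (vertL B p (stdE i)) * ((gram B g p).det * (1 : Matrix (Fin 3) (Fin 3) ℝ) i k) := by
    intro i
    rw [← h, Finset.mul_sum]
    refine Finset.sum_congr rfl fun j _ => ?_
    ring
  simp only [horPart, map_sub, map_sum, map_smul, _root_.sub_apply, _root_.sum_apply,
    _root_.smul_apply, smul_eq_mul, h2]
  simp [Matrix.one_apply, mul_comm]

theorem gL_horPart (p : P) (w : EuclideanSpace ℝ (Fin 4)) (x : EuclideanSpace ℝ (Fin 3)) :
    gL g p (horPart B g p w) (vertL B p x) = 0 := by
  rw [sum_stdE x]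
  simp only [map_sum, map_smul, gL_horPart_stdE]
  simp

theorem horPart_of_horizontal {p : P} {w : EuclideanSpace ℝ (Fin 4)}
    (hw : ∀ x, gL g p w (vertL B p x) = 0) : horPart B g p w = (gram B g p).det • w := by
  simp [horPart, hw]

theorem contMDiffAt_gram (i j : Fin 3) (p : P) :
    ContMDiffAt (𝓡 4) 𝓘(ℝ, ℝ) ∞ (fun q => gram B g q i j) p := contMDiff_fibG B g _ _ p

theorem contMDiffAt_det_gram (p : P) :
    ContMDiffAt (𝓡 4) 𝓘(ℝ, ℝ) ∞ (fun q => (gram B g q).det) p := by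
  have hG := fun i j => contMDiffAt_gram B g i j p
  simp only [det_fin_three]
  exact ((((((((hG _ _).mul (hG _ _)).mul (hG _ _)).sub (((hG _ _).mul (hG _ _)).mul (hG _ _))).sub
    (((hG _ _).mul (hG _ _)).mul (hG _ _))).add (((hG _ _).mul (hG _ _)).mul (hG _ _))).add
    (((hG _ _).mul (hG _ _)).mul (hG _ _))).sub (((hG _ _).mul (hG _ _)).mul (hG _ _)))

theorem contMDiffAt_adjugate_gram (i j : Fin 3) (p : P) :
    ContMDiffAt (𝓡 4) 𝓘(ℝ, ℝ) ∞ (fun q => (gram B g q).adjugate i j) p := by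
  have hG := fun i j => contMDiffAt_gram B g i j p
  simp only [adjugate_fin_three]
  have hm := fun a b c d e f g' h' => ((hG a b).mul (hG c d)).sub ((hG e f).mul (hG g' h'))
  have hm' := fun a b c d e f g' h' => (((hG a b).mul (hG c d)).neg).add ((hG e f).mul (hG g' h'))
  fin_cases i <;> fin_cases j <;> first | exact hm _ _ _ _ _ _ _ _ | exact hm' _ _ _ _ _ _ _ _

theorem contMDiffAt_horPart {W : ∀ p : P, TangentSpace (𝓡 4) p} {p : P}
    (hW : ContMDiffAt (𝓡 4) (𝓡 4).tangent ∞ (fun q => (⟨q, W q⟩ : TangentBundle (𝓡 4) P)) p) :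
    ContMDiffAt (𝓡 4) (𝓡 4).tangent ∞
      (fun q => (⟨q, horPart B g q (modelVec (W q))⟩ : TangentBundle (𝓡 4) P)) p := by
  have hv := fun i => contMDiffAt_vert B (lieBasis 𝒢 i) p
  have hs : ContMDiffAt (𝓡 4) (𝓡 4).tangent ∞ (fun q => (⟨q, (gram B g q).det • W q -
      ∑ i, ∑ j, ((gram B g q).adjugate i j * g.inner q (W q) (vert B q (lieBasis 𝒢 i))) •
        vert B q (lieBasis 𝒢 j)⟩ : TangentBundle (𝓡 4) P)) p := by
    refine ((contMDiffAt_det_gram B g p).smul_section hW).sub_section ?_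
    refine ContMDiffAt.sum_section fun i _ => ContMDiffAt.sum_section fun j _ => ?_
    exact ((contMDiffAt_adjugate_gram B g i j p).mul (contMDiffAt_metric g hW (hv i))).smul_section (hv j)
  have e : (fun q => (⟨q, horPart B g q (modelVec (W q))⟩ : TangentBundle (𝓡 4) P)) =
      (fun q => (⟨q, (gram B g q).det • W q -
      ∑ i, ∑ j, ((gram B g q).adjugate i j * g.inner q (W q) (vert B q (lieBasis 𝒢 i))) •
        vert B q (lieBasis 𝒢 j)⟩ : TangentBundle (𝓡 4) P)) := by
    funext q
    unfold horPart
    simp only [← lieBasis_eq (𝒢 := 𝒢)]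
    rfl
  rw [e]
  exact hs

/-- A smooth local vector field through a given vector. -/
theorem exists_local_field {n : ℕ} {N : Type*} [TopologicalSpace N]
    [ChartedSpace (EuclideanSpace ℝ (Fin n)) N] [IsManifold (𝓡 n) ∞ N] (p : N)
    (w : EuclideanSpace ℝ (Fin n)) : ∃ W : ∀ q : N, TangentSpace (𝓡 n) q,
    ContMDiffAt (𝓡 n) (𝓡 n).tangent ∞ (fun q => (⟨q, W q⟩ : TangentBundle (𝓡 n) N)) p ∧
    W p = w := by
  have := isManifold_one n N
  let W : ∀ q : N, TangentSpace (𝓡 n) q := fun q =>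
    (mfderiv (𝓡 n) 𝓘(ℝ, EuclideanSpace ℝ (Fin n)) (extChartAt (𝓡 n) p) q).inverse w
  refine ⟨W, ?_, ?_⟩
  · rw [contMDiffAt_section_iff_chartField]
    have e : chartField p W =ᶠ[nhds (extChartAt (𝓡 n) p p)] fun _ => w := by
      filter_upwards [chart_target_mem_nhds (n := n) p] with x hx
      have h1 := mfderivWithin_extChartAt_symm_comp_mfderiv_extChartAt (I := 𝓡 n) hx
      have h2 := mfderiv_extChartAt_comp_mfderivWithin_extChartAt_symm (I := 𝓡 n) hx
      have h3 := ContinuousLinearMap.inverse_eq h2 h1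
      have h4 := congrArg (fun T : EuclideanSpace ℝ (Fin n) →L[ℝ] EuclideanSpace ℝ (Fin n) => T w) h2
      refine Eq.trans ?_ h4
      exact congrArg (fun T : EuclideanSpace ℝ (Fin n) →L[ℝ] EuclideanSpace ℝ (Fin n) =>
        (mfderiv (𝓡 n) 𝓘(ℝ, EuclideanSpace ℝ (Fin n)) (extChartAt (𝓡 n) p)
          ((extChartAt (𝓡 n) p).symm x) (T w) : EuclideanSpace ℝ (Fin n))) h3
    exact contDiffAt_const.congr_of_eventuallyEq e
  · have h := congrArg (fun T : EuclideanSpace ℝ (Fin n) →L[ℝ] EuclideanSpace ℝ (Fin n) => 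
      T.inverse w) (mfderiv_extChartAt_self (I := 𝓡 n) (x := p))
    refine h.trans ?_
    show (ContinuousLinearMap.id ℝ (EuclideanSpace ℝ (Fin n))).inverse w = w
    simp

end Bundle

/-! ### Existence of local unit horizontal fields. -/

section Bundle

variable {𝒢 P M : Type*}
  [TopologicalSpace 𝒢] [ChartedSpace (EuclideanSpace ℝ (Fin 3)) 𝒢] [Group 𝒢]
  [LieGroup (𝓡 3) ∞ 𝒢]
  [TopologicalSpace P] [ChartedSpace (EuclideanSpace ℝ (Fin 4)) P] [IsManifold (𝓡 4) ∞ P]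
  [TopologicalSpace M] [ChartedSpace (EuclideanSpace ℝ (Fin 1)) M] [IsManifold (𝓡 1) ∞ M]
  (B : PrincipalBundle 𝒢 P M) (g : Metric4 P)

/-- A local coordinate of the base, as a function on the total space. -/
def baseCoord (m₀ : M) (q : P) : ℝ := (extChartAt (𝓡 1) m₀ (B.proj q)).ofLp 0

/-- The differential of `baseCoord`. -/
def dCoord (m₀ : M) (q : P) : EuclideanSpace ℝ (Fin 4) →L[ℝ] ℝ :=
  mfderiv (𝓡 4) 𝓘(ℝ, ℝ) (baseCoord B m₀) q

variable {m₀ : M} {q : P}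

theorem contMDiffOn_baseCoord (m₀ : M) : ContMDiffOn (𝓡 4) 𝓘(ℝ, ℝ) ∞ (baseCoord B m₀)
    (B.proj ⁻¹' (extChartAt (𝓡 1) m₀).source) := by
  have h1 : ContMDiff 𝓘(ℝ, EuclideanSpace ℝ (Fin 1)) 𝓘(ℝ, ℝ) ∞
      (fun y : EuclideanSpace ℝ (Fin 1) => y.ofLp 0) := by
    rw [contMDiff_iff_contDiff]
    exact contDiff_euclidean.1 contDiff_id 0
  refine h1.comp_contMDiffOn ?_
  rw [extChartAt_source]
  exact contMDiffOn_extChartAt.comp B.contMDiff_proj.contMDiffOn subset_rfl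

theorem mdifferentiableAt_baseCoord (hq : B.proj q ∈ (extChartAt (𝓡 1) m₀).source) :
    MDifferentiableAt (𝓡 4) 𝓘(ℝ, ℝ) (baseCoord B m₀) q :=
  ((contMDiffOn_baseCoord B m₀).contMDiffAt
    (((isOpen_extChartAt_source m₀).preimage B.contMDiff_proj.continuous).mem_nhds hq)).mdifferentiableAt
      (by norm_num)

theorem dCoord_eq (hq : B.proj q ∈ (extChartAt (𝓡 1) m₀).source) (u : EuclideanSpace ℝ (Fin 4)) :
    dCoord B m₀ q u = (show EuclideanSpace ℝ (Fin 1) from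
      mfderiv (𝓡 1) 𝓘(ℝ, EuclideanSpace ℝ (Fin 1)) (extChartAt (𝓡 1) m₀) (B.proj q)
        (dproj B q u)).ofLp 0 := by
  have := isManifold_one 1 M
  have hq' : B.proj q ∈ (chartAt (EuclideanSpace ℝ (Fin 1)) m₀).source := by
    rwa [← extChartAt_source (I := 𝓡 1)]
  have h1 := (mdifferentiableAt_extChartAt (I := 𝓡 1) hq').hasMFDerivAt.comp q
    (mdifferentiable_proj B q).hasMFDerivAt
  have h2 := (EuclideanSpace.proj (𝕜 := ℝ) (0 : Fin 1)).hasMFDerivAt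
    (x := extChartAt (𝓡 1) m₀ (B.proj q)) |>.comp q h1
  have h3 := h2.mfderiv
  exact congrArg (fun T : EuclideanSpace ℝ (Fin 4) →L[ℝ] ℝ => T u) h3

theorem exists_dCoord_pos (hq : B.proj q ∈ (extChartAt (𝓡 1) m₀).source) :
    ∃ u, 0 < dCoord B m₀ q u := by
  have := isManifold_one 1 M
  have h2 : (mfderiv (𝓡 1) 𝓘(ℝ, EuclideanSpace ℝ (Fin 1)) (extChartAt (𝓡 1) m₀) (B.proj q)).comp
      _ = _ := mfderiv_extChartAt_comp_mfderivWithin_extChartAt_symm' (I := 𝓡 1) hq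
  obtain ⟨u, hu⟩ := dproj_surjective B q
    (mfderivWithin 𝓘(ℝ, EuclideanSpace ℝ (Fin 1)) (𝓡 1) (extChartAt (𝓡 1) m₀).symm (Set.range (𝓡 1))
      (extChartAt (𝓡 1) m₀ (B.proj q)) (EuclideanSpace.single 0 1 : EuclideanSpace ℝ (Fin 1)))
  have h3 := congrArg (fun T : EuclideanSpace ℝ (Fin 1) →L[ℝ] EuclideanSpace ℝ (Fin 1) =>
    T (EuclideanSpace.single 0 1)) h2
  refine ⟨u, ?_⟩
  rw [dCoord_eq B hq, hu]
  have h4 : (show EuclideanSpace ℝ (Fin 1) from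
      mfderiv (𝓡 1) 𝓘(ℝ, EuclideanSpace ℝ (Fin 1)) (extChartAt (𝓡 1) m₀) (B.proj q)
        (mfderivWithin 𝓘(ℝ, EuclideanSpace ℝ (Fin 1)) (𝓡 1) (extChartAt (𝓡 1) m₀).symm (Set.range (𝓡 1))
      (extChartAt (𝓡 1) m₀ (B.proj q)) (EuclideanSpace.single 0 1 : EuclideanSpace ℝ (Fin 1)))) =
      (EuclideanSpace.single 0 1 : EuclideanSpace ℝ (Fin 1)) := h3
  rw [h4]
  simp

theorem dCoord_of_dproj_eq_zero (hq : B.proj q ∈ (extChartAt (𝓡 1) m₀).source)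
    {u : EuclideanSpace ℝ (Fin 4)} (hu : dproj B q u = 0) : dCoord B m₀ q u = 0 := by
  rw [dCoord_eq B hq, hu]
  let L : EuclideanSpace ℝ (Fin 1) →L[ℝ] EuclideanSpace ℝ (Fin 1) :=
    mfderiv (𝓡 1) 𝓘(ℝ, EuclideanSpace ℝ (Fin 1)) (extChartAt (𝓡 1) m₀) (B.proj q)
  show (L 0).ofLp 0 = 0
  simp

/-- The unit horizontal vector along which the base coordinate increases. -/
def IsPosUnit (m₀ : M) (q : P) (u : EuclideanSpace ℝ (Fin 4)) : Prop :=
  (∀ x, gL g q u (vertL B q x) = 0) ∧ gL g q u u = 1 ∧ 0 < dCoord B m₀ q u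

theorem dCoord_horPart (hq : B.proj q ∈ (extChartAt (𝓡 1) m₀).source)
    (w : EuclideanSpace ℝ (Fin 4)) :
    dCoord B m₀ q (horPart B g q w) = (gram B g q).det * dCoord B m₀ q w := by
  have h := fun x => dCoord_of_dproj_eq_zero B hq (dproj_vert B q x)
  simp [horPart, h]

theorem isPosUnit_normalize {w : EuclideanSpace ℝ (Fin 4)}
    (hw : ∀ x, gL g q w (vertL B q x) = 0) (hpos : 0 < dCoord B m₀ q w) :
    IsPosUnit B g m₀ q ((Real.sqrt (gL g q w w))⁻¹ • w) := by
  have hw0 : w ≠ 0 := by rintro rfl; simp at hpos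
  have hg := gL_pos g q hw0
  have hs := Real.sqrt_pos.2 hg
  refine ⟨fun x => by simp [hw], ?_, ?_⟩
  · have h1 := Real.mul_self_sqrt hg.le
    set r := Real.sqrt (gL g q w w)
    simp only [map_smul, _root_.smul_apply, smul_eq_mul]
    rw [← h1]
    field_simp
  · rw [map_smul, smul_eq_mul]
    positivity

theorem exists_isPosUnit (hq : B.proj q ∈ (extChartAt (𝓡 1) m₀).source) :
    ∃ u, IsPosUnit B g m₀ q u := by
  obtain ⟨w, hw⟩ := exists_dCoord_pos B hq
  refine ⟨_, isPosUnit_normalize B g (gL_horPart B g q w) ?_⟩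
  rw [dCoord_horPart B g hq]
  exact mul_pos (gram_det_pos B g q) hw

/-- The base is a line, so u' − c u is vertical for some c; being also horizontal, it is zero. Unit
length and the sign of the base coordinate give c = 1. Both smoothness and invariance of the field
built from these vectors follow from this uniqueness. -/
theorem IsPosUnit.unique (hq : B.proj q ∈ (extChartAt (𝓡 1) m₀).source)
    {u u' : EuclideanSpace ℝ (Fin 4)} (hu : IsPosUnit B g m₀ q u) (hu' : IsPosUnit B g m₀ q u') :
    u' = u := by
  have hd : dproj B q u ≠ 0 := fun h => hu.2.2.ne' (dCoord_of_dproj_eq_zero B hq h)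
  obtain ⟨c, hc⟩ := exists_smul_eq_of_finrank_eq_one (K := ℝ) (V := EuclideanSpace ℝ (Fin 1))
    (by simp) hd (dproj B q u')
  obtain ⟨x, hx⟩ := exists_vert_of_dproj_eq_zero B (p := q) (u := u' - c • u) (by
    rw [map_sub, map_smul, hc, sub_self])
  have h0 : vertL B q x = 0 := by
    by_contra hne
    have := gL_pos g q hne
    conv at this => rhs; arg 1; rw [← hx]
    simp [hu.1, hu'.1] at this
  rw [h0, sub_eq_zero] at hx
  have h1 := hu'.2.1
  have h2 := hu'.2.2
  rw [hx] at h1 h2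
  simp only [map_smul, _root_.smul_apply, smul_eq_mul, hu.2.1, mul_one] at h1 h2
  have h3 : 0 < c := (pos_iff_pos_of_mul_pos h2).2 hu.2.2
  have h4 : c = 1 := by nlinarith
  rw [hx, h4, one_smul]

theorem dCoord_act (hq : B.proj q ∈ (extChartAt (𝓡 1) m₀).source) (a : 𝒢)
    (u : EuclideanSpace ℝ (Fin 4)) :
    dCoord B m₀ (B.act q a) (rightL B a q u) = dCoord B m₀ q u := by
  have hqa : B.proj (B.act q a) ∈ (extChartAt (𝓡 1) m₀).source := by rwa [B.proj_act]
  have h := (mdifferentiableAt_baseCoord B hqa).hasMFDerivAt.comp q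
    (mdifferentiable_act_right B a q).hasMFDerivAt
  have e : baseCoord B m₀ ∘ (fun p => B.act p a) = baseCoord B m₀ := by
    funext r; simp only [Function.comp, baseCoord, B.proj_act]
  rw [e] at h
  exact (congrArg (fun T : EuclideanSpace ℝ (Fin 4) →L[ℝ] ℝ => T u) h.mfderiv).symm

theorem IsPosUnit.act (hg : InvariantMetric B g) (hq : B.proj q ∈ (extChartAt (𝓡 1) m₀).source)
    (a : 𝒢) {u : EuclideanSpace ℝ (Fin 4)} (hu : IsPosUnit B g m₀ q u) :
    IsPosUnit B g m₀ (B.act q a) (rightL B a q u) := by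
  refine ⟨fun x => ?_, (hg a q u u).trans hu.2.1, ?_⟩
  · rw [vert_act]
    exact (hg a q u (vertL B q (adL a x))).trans (hu.1 _)
  · rw [dCoord_act B hq]
    exact hu.2.2

variable {B g} in
/-- Around every point of the base there is a unit horizontal field, along which the base
coordinate increases. -/
theorem exists_unitHorizontal (hg : InvariantMetric B g) (m₀ : M) :
    ∃ V : ∀ p : P, TangentSpace (𝓡 4) p,
      IsUnitHorizontal B g (extChartAt (𝓡 1) m₀).source V ∧
      ∀ q ∈ B.proj ⁻¹' (extChartAt (𝓡 1) m₀).source, 0 < dCoord B m₀ q (modelVec (V q)) := by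
  classical
  set U := (extChartAt (𝓡 1) m₀).source with hUdef
  have hUo : IsOpen (B.proj ⁻¹' U) :=
    (isOpen_extChartAt_source m₀).preimage B.contMDiff_proj.continuous
  -- A pointwise choice; outside the chart domain the value 0 plays no role.
  let V : ∀ p : P, TangentSpace (𝓡 4) p := fun p =>
    if h : B.proj p ∈ U then Classical.choose (exists_isPosUnit B g h) else 0
  have hVp : ∀ q ∈ B.proj ⁻¹' U, IsPosUnit B g m₀ q (modelVec (V q)) := by
    intro q hq
    have h : V q = Classical.choose (exists_isPosUnit B g hq) := dif_pos hq
    rw [h]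
    exact Classical.choose_spec (exists_isPosUnit B g hq)
  refine ⟨V, ⟨fun q hq => ?_, fun q hq x => (hVp q hq).1 x, fun q hq => (hVp q hq).2.1,
    fun q hq a => ?_⟩, fun q hq => (hVp q hq).2.2⟩
  · refine ContMDiffAt.contMDiffWithinAt ?_
    -- A smooth field through V q, projected and normalised, is smooth and still points in the
    -- positive direction near q, so by uniqueness it agrees there with `V`.
    obtain ⟨W, hW, hWq⟩ := exists_local_field q (modelVec (V q))
    have h1 := contMDiffAt_horPart B g hW
    have h2 := contMDiffAt_metric g h1 h1
    have hWh : horPart B g q (modelVec (W q)) = (gram B g q).det • modelVec (V q) := by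
      have e : modelVec (W q) = modelVec (V q) := hWq
      rw [e, horPart_of_horizontal B g (hVp q hq).1]
    have hdpos : 0 < dCoord B m₀ q (horPart B g q (modelVec (W q))) := by
      rw [hWh, map_smul]
      exact mul_pos (gram_det_pos B g q) (hVp q hq).2.2
    have h3 : ContinuousAt (fun r => dCoord B m₀ r (horPart B g r (modelVec (W r)))) q :=
      (contMDiffAt_mfderiv_apply hUo hq h1 (contMDiffOn_baseCoord B m₀)).continuousAt
    have h4 : 0 < gL g q (horPart B g q (modelVec (W q))) (horPart B g q (modelVec (W q))) :=
      gL_pos g q fun h => hdpos.ne' (by rw [h, map_zero])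
    have h5 : ContMDiffAt (𝓡 4) 𝓘(ℝ, ℝ) ∞ (fun r => (Real.sqrt
        (g.inner r (horPart B g r (modelVec (W r))) (horPart B g r (modelVec (W r)))))⁻¹) q := by
      have hs : ContDiffAt ℝ ∞ (fun t : ℝ => (Real.sqrt t)⁻¹)
          (g.inner q (horPart B g q (modelVec (W q))) (horPart B g q (modelVec (W q)))) :=
        (Real.contDiffAt_sqrt h4.ne').inv (Real.sqrt_pos.2 h4).ne'
      exact ContMDiffAt.comp (I' := 𝓘(ℝ, ℝ)) (g := fun t : ℝ => (Real.sqrt t)⁻¹) q hs.contMDiffAt h2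
    have h6 := h5.smul_section h1
    refine h6.congr_of_eventuallyEq ?_
    filter_upwards [hUo.mem_nhds hq, h3.eventually (lt_mem_nhds hdpos)] with r hr hpos
    have h7 := IsPosUnit.unique B g hr (isPosUnit_normalize B g (gL_horPart B g r (modelVec (W r))) hpos)
      (hVp r hr)
    have h8 : V r = (Real.sqrt (g.inner r (horPart B g r (modelVec (W r)))
      (horPart B g r (modelVec (W r)))))⁻¹ • (horPart B g r (modelVec (W r)) : TangentSpace (𝓡 4) r) := h7
    rw [h8]
    rfl
  · have hqa : B.proj (B.act q a) ∈ U := by rw [B.proj_act]; exact hq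
    exact IsPosUnit.unique B g hqa (hVp _ hqa) (IsPosUnit.act B g hg hq a (hVp q hq))

end Bundle

/-! ### The minimum principle on the base: log det G is locally constant. -/

section Bundle

variable {𝒢 P M : Type*}
  [TopologicalSpace 𝒢] [ChartedSpace (EuclideanSpace ℝ (Fin 3)) 𝒢] [Group 𝒢]
  [LieGroup (𝓡 3) ∞ 𝒢]
  [TopologicalSpace P] [ChartedSpace (EuclideanSpace ℝ (Fin 4)) P] [IsManifold (𝓡 4) ∞ P]
  [TopologicalSpace M] [ChartedSpace (EuclideanSpace ℝ (Fin 1)) M] [IsManifold (𝓡 1) ∞ M]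
  {B : PrincipalBundle 𝒢 P M} {g : Metric4 P} {H : ThreeForm P}
  {U : Set M} {V : ∀ p : P, TangentSpace (𝓡 4) p}

theorem mem_centre_of_fixed {z : Lie3 𝒢} (hz : ∀ a : 𝒢, adL a z = z) : z ∈ centre 𝒢 := by
  have := lieGroup_three 𝒢
  intro x
  show -⁅z, x⁆ = 0
  rw [lie_skew]
  exact bracket_eq_zero_of_fixed hz x

variable (𝒢) in
/-- A unit vector in the centre, fixed by the adjoint action. -/
theorem exists_unit_fixed [Group.IsNilpotent 𝒢] (B : PrincipalBundle 𝒢 P M) (g : Metric4 P) (p : P) :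
    ∃ z : Lie3 𝒢, (∀ a : 𝒢, adL a z = z) ∧ fibG B g p z z = 1 := by
  obtain ⟨z, hz0, hz⟩ := exists_fixed_vector (𝒢 := 𝒢)
  obtain ⟨c, -, hc⟩ := exists_unit_smul B g p hz0
  exact ⟨c • z, fun a => (map_smul (adL a) c z).trans (by rw [hz a]), hc⟩

/-- `SBVanishes` gives information only through a unit central vector; nilpotency supplies one,
fixed by Ad. -/
theorem SBVanishes.normSq2_eq_zero [Group.IsNilpotent 𝒢] (hSB : SBVanishes B g H) (hU : IsOpen U)
    (hV : IsUnitHorizontal B g U V) {p : P} (hp : p ∈ B.proj ⁻¹' U) :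
    normSq2 B g p (fun x y => ddG B g V p x y - dGdG B g V p x y
      + trG B g p fun c c' => NilBundle.hV B H V p x c * NilBundle.hV B H V p y c') = 0 := by
  obtain ⟨z, hz, hz1⟩ := exists_unit_fixed 𝒢 B g p
  exact (terms_eq_zero_of_SB hU hV hp hz1 (hSB U V hU hV p hp z (mem_centre_of_fixed hz) hz1)).1

/-- The logarithm of the volume of the fibres. -/
def logDet (B : PrincipalBundle 𝒢 P M) (g : Metric4 P) (p : P) : ℝ := Real.log (gram B g p).det

theorem continuous_logDet : Continuous (logDet B g) := by
  have hG : ∀ i j, Continuous fun p => gram B g p i j := fun i j =>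
    (contMDiff_fibG B g _ _).continuous
  have h : Continuous fun p => (gram B g p).det :=
    Continuous.matrix_det (continuous_matrix hG)
  exact h.log fun p => (gram_det_pos B g p).ne'

theorem exists_act_eq (B : PrincipalBundle 𝒢 P M) {p q : P} (h : B.proj p = B.proj q) :
    ∃ a, B.act p a = q := by
  obtain ⟨U, e, hU, hm, hs, ht, he, hes, hpr, hact⟩ := B.locallyTrivial (B.proj p)
  have hp : p ∈ e.source := by rw [hs]; exact hm
  have hq : q ∈ e.source := by rw [hs]; show B.proj q ∈ U; rw [← h]; exact hm
  have hpa : ∀ a, B.act p a ∈ e.source := fun a => by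
    rw [hs]; show B.proj (B.act p a) ∈ U; rw [B.proj_act]; exact hm
  refine ⟨(e p).2⁻¹ * (e q).2, e.injOn (hpa _) hq ?_⟩
  rw [hact p hp]
  refine Prod.ext ?_ (mul_inv_cancel_left _ _)
  rw [hpr p hp, hpr q hq, h]

theorem proj_surjective (B : PrincipalBundle 𝒢 P M) : Function.Surjective B.proj := by
  intro m
  obtain ⟨U, e, hU, hm, hs, ht, he, hes, hpr, hact⟩ := B.locallyTrivial m
  have h : (m, (1 : 𝒢)) ∈ e.target := by rw [ht]; exact ⟨hm, trivial⟩
  exact ⟨e.symm (m, 1), by rw [← hpr _ (e.map_target h), e.right_inv h]⟩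

theorem logDet_eq_of_proj_eq [Group.IsNilpotent 𝒢] (hg : InvariantMetric B g) {p q : P}
    (h : B.proj p = B.proj q) : logDet B g p = logDet B g q := by
  obtain ⟨a, rfl⟩ := exists_act_eq B h
  rw [logDet, logDet, det_gram_act hg]

/-- The projections of flow lines cover a neighbourhood of their base point. -/
theorem eventually_exists_flow {m₀ : M} {γ : ℝ → P}
    (hγ : ∀ᶠ t in nhds 0, FlowsAt B (extChartAt (𝓡 1) m₀).source V γ t)
    (hm : B.proj (γ 0) = m₀) (hpos : 0 < dCoord B m₀ (γ 0) (modelVec (V (γ 0))))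
    {s : Set ℝ} (hs : s ∈ nhds (0 : ℝ)) : ∀ᶠ m in nhds m₀, ∃ t ∈ s, B.proj (γ t) = m := by
  have hder : ∀ᶠ t in nhds 0, HasDerivAt (fun t => baseCoord B m₀ (γ t))
      (dCoord B m₀ (γ t) (modelVec (V (γ t)))) t := by
    filter_upwards [hγ] with t ht
    exact ht.hasDerivAt (mdifferentiableAt_baseCoord B ht.1)
  set c := fun t => baseCoord B m₀ (γ t) with hc
  have h0 := hder.self_of_nhds
  -- The derivative at 0 alone yields values of the base coordinate on both sides of c 0; the
  -- intermediate value theorem then covers a neighbourhood of the base point.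
  have hlt : ∀ᶠ t in nhds 0, (0 < t → c 0 < c t) ∧ (t < 0 → c t < c 0) := by
    have h1 := (hasDerivAt_iff_tendsto_slope.1 h0).eventually (lt_mem_nhds hpos)
    rw [eventually_nhdsWithin_iff] at h1
    filter_upwards [h1] with t ht
    constructor
    · intro hp
      have h2 : 0 < slope c 0 t := ht hp.ne'
      rw [slope_def_field, sub_zero] at h2
      have := (div_pos_iff_of_pos_right hp).1 h2
      linarith
    · intro hn
      have h2 : 0 < slope c 0 t := ht hn.ne
      rw [slope_def_field, sub_zero] at h2
      by_contra hle
      push Not at hle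
      have := div_nonpos_of_nonneg_of_nonpos (sub_nonneg.2 hle) hn.le
      linarith
  obtain ⟨ε, hε, hb⟩ := Metric.eventually_nhds_iff_ball.1
    ((hlt.and hder).and ((Filter.eventually_mem_set.2 hs).and hγ))
  have hmem : ∀ t ∈ Set.Icc (-(ε / 2)) (ε / 2), t ∈ Metric.ball (0 : ℝ) ε := by
    intro t ht
    rw [Metric.mem_ball, Real.dist_eq, sub_zero, abs_lt]
    constructor <;> linarith [ht.1, ht.2]
  have hcont : ContinuousOn c (Set.Icc (-(ε / 2)) (ε / 2)) := fun t ht =>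
    (hb t (hmem t ht)).1.2.continuousAt.continuousWithinAt
  have hl : c (-(ε / 2)) < c 0 := (hb _ (hmem _ ⟨le_rfl, by linarith⟩)).1.1.2 (by linarith)
  have hr : c 0 < c (ε / 2) := (hb _ (hmem _ ⟨by linarith, le_rfl⟩)).1.1.1 (by linarith)
  have hiv := intermediate_value_Icc (by linarith : -(ε / 2) ≤ ε / 2) hcont
  have hcoord : ContinuousAt (fun m => (extChartAt (𝓡 1) m₀ m).ofLp 0) m₀ := by
    have h1 := continuousAt_extChartAt (I := 𝓡 1) m₀
    have h2 : Continuous (fun y : EuclideanSpace ℝ (Fin 1) => y.ofLp 0) := by fun_prop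
    exact h2.continuousAt.comp h1
  have hval : (extChartAt (𝓡 1) m₀ m₀).ofLp 0 = c 0 := by
    simp only [hc, baseCoord, hm]
  have hnear := hcoord.eventually (Ioo_mem_nhds (a := c (-(ε / 2))) (b := c (ε / 2))
    (hl.trans_eq hval.symm) (hval.trans_lt hr))
  filter_upwards [hnear, extChartAt_source_mem_nhds (I := 𝓡 1) m₀] with m hm1 hm2
  obtain ⟨t, ht, htc⟩ := hiv (Set.Ioo_subset_Icc_self hm1)
  have hbt := hb t (hmem t ht)
  refine ⟨t, hbt.2.1, (extChartAt (𝓡 1) m₀).injOn hbt.2.2.1 hm2 ?_⟩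
  ext i
  rw [Subsingleton.elim i 0]
  exact htc

variable [T2Space M] [CompactSpace M] [Group.IsNilpotent 𝒢]

/-- The volume of the fibres is locally constant. -/
theorem logDet_eventually_eq (hg : InvariantMetric B g) (hSB : SBVanishes B g H) (p : P) :
    ∀ᶠ q in nhds p, logDet B g q = logDet B g p := by
  have : LocallyConnectedSpace M :=
    ChartedSpace.locallyConnectedSpace (EuclideanSpace ℝ (Fin 1)) M
  -- No continuity of `σ` is asked for. By invariance `u` does not depend on the choice, and smooth
  -- local sections show it continuous.
  choose σ hσ using proj_surjective B
  let u : M → ℝ := fun m => logDet B g (σ m)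
  have hu : ∀ q, u (B.proj q) = logDet B g q := fun q => logDet_eq_of_proj_eq hg (hσ _)
  have hcont : Continuous u := by
    rw [continuous_iff_continuousAt]
    intro m
    obtain ⟨s, hs, hsp, hsm⟩ := exists_local_section B (σ m)
    rw [hσ] at hs hsp hsm
    have h1 : ContinuousAt (fun m' => logDet B g (s m')) m :=
      continuous_logDet.continuousAt.comp hs.continuousAt
    refine h1.congr ?_
    filter_upwards [hsm] with m' hm'
    rw [← hu, hm']
  set C := connectedComponent (B.proj p)
  have hCo : IsOpen C := isOpen_connectedComponent
  have hCc : IsClosed C := isClosed_connectedComponent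
  obtain ⟨m₁, hm₁, hmin⟩ := hCc.isCompact.exists_isMinOn ⟨_, mem_connectedComponent⟩ hcont.continuousOn
  -- Closed by continuity. Open because the flow line through a minimum is locally constant in log
  -- det G, and its projection covers a neighbourhood of the base point.
  have hclopen : IsClopen (C ∩ {m | u m = u m₁}) := by
    refine ⟨hCc.inter (isClosed_eq hcont continuous_const), isOpen_iff_mem_nhds.2 ?_⟩
    rintro m₀ ⟨hmC, hmu⟩
    obtain ⟨V, hV, hpos⟩ := exists_unitHorizontal (B := B) hg m₀
    have hUo := isOpen_extChartAt_source (I := 𝓡 1) m₀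
    have hp₀ : σ m₀ ∈ B.proj ⁻¹' (extChartAt (𝓡 1) m₀).source := by
      show B.proj (σ m₀) ∈ (extChartAt (𝓡 1) m₀).source
      rw [hσ]; exact mem_extChartAt_source m₀
    obtain ⟨γ, h0, hγc, hγ⟩ := exists_flow_line hUo hV hp₀
    have hloc : IsLocalMin (fun t => logDet B g (γ t)) 0 := by
      have hpr : ContinuousAt (fun t => B.proj (γ t)) 0 :=
        B.contMDiff_proj.continuous.continuousAt.comp hγc
      have h1 : ∀ᶠ t in nhds (0 : ℝ), B.proj (γ t) ∈ C :=
        hpr.eventually (hCo.mem_nhds (by show B.proj (γ 0) ∈ C; rw [h0, hσ]; exact hmC))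
      filter_upwards [h1] with t ht
      rw [← hu, ← hu (γ t), h0, hσ, hmu]
      exact hmin ht
    have hconst := eventually_const_of_concave (u := fun t => logDet B g (γ t))
      (φ := fun t => trDG B g V (γ t)) (ψ := fun t => - trHsq B g H V (γ t))
      (hγ.mono fun t ht => ht.hasDerivAt_log_det)
      (hγ.mono fun t ht => ht.hasDerivAt_trDG_of_SB hUo hV (hSB.normSq2_eq_zero hUo hV ht.1))
      (Filter.Eventually.of_forall fun t => neg_nonpos.2 (trHsq_nonneg _)) hloc
    have hcov := eventually_exists_flow hγ (by rw [h0, hσ]) (hpos _ (by rw [h0]; exact hp₀)) hconst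
    filter_upwards [hcov, hCo.mem_nhds hmC] with m hm hmC'
    obtain ⟨t, ht, rfl⟩ := hm
    refine ⟨hmC', ?_⟩
    show u (B.proj (γ t)) = u m₁
    rw [hu, ← hmu]
    refine (show logDet B g (γ t) = logDet B g (γ 0) from ht).trans ?_
    rw [h0]
  have hsub := isPreconnected_connectedComponent.subset_isClopen hclopen ⟨m₁, hm₁, hm₁, rfl⟩
  have hpC : ∀ᶠ q in nhds p, B.proj q ∈ C :=
    B.contMDiff_proj.continuous.continuousAt.eventually (hCo.mem_nhds mem_connectedComponent)
  filter_upwards [hpC] with q hq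
  rw [← hu, ← hu]
  exact (hsub hq).2.trans (hsub mem_connectedComponent).2.symm

theorem trDG_eq_zero (hg : InvariantMetric B g) (hSB : SBVanishes B g H) (hU : IsOpen U)
    (hV : IsUnitHorizontal B g U V) {p : P} (hp : p ∈ B.proj ⁻¹' U) : trDG B g V p = 0 := by
  obtain ⟨γ, rfl, hc, hγ⟩ := exists_flow_line hU hV hp
  have h := hγ.self_of_nhds.hasDerivAt_log_det (g := g)
  exact h.unique ((hasDerivAt_const (0 : ℝ) (logDet B g (γ 0))).congr_of_eventuallyEq
    (hc.eventually (logDet_eventually_eq hg hSB (γ 0))))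

theorem trHsq_eq_zero (hg : InvariantMetric B g) (hSB : SBVanishes B g H) (hU : IsOpen U)
    (hV : IsUnitHorizontal B g U V) {p : P} (hp : p ∈ B.proj ⁻¹' U) : trHsq B g H V p = 0 := by
  obtain ⟨γ, rfl, hc, hγ⟩ := exists_flow_line hU hV hp
  have h := hγ.self_of_nhds.hasDerivAt_trDG_of_SB hU hV (hSB.normSq2_eq_zero hU hV hp)
  have h0 : (fun s => trDG B g V (γ s)) =ᶠ[nhds 0] fun _ => 0 := by
    filter_upwards [hγ] with s hs using trDG_eq_zero hg hSB hU hV hs.1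
  have := h.unique ((hasDerivAt_const (0 : ℝ) (0 : ℝ)).congr_of_eventuallyEq h0)
  linarith

theorem matB_hV_eq_zero (hg : InvariantMetric B g) (hSB : SBVanishes B g H) (hU : IsOpen U)
    (hV : IsUnitHorizontal B g U V) {p : P} (hp : p ∈ B.proj ⁻¹' U) :
    matB (NilBundle.hV B H V p) = 0 :=
  contr2_eq_zero (gram_inv_posDef B g p) (trHsq_eq_zero hg hSB hU hV hp)

theorem matB_ddG_eq (hg : InvariantMetric B g) (hSB : SBVanishes B g H) (hU : IsOpen U)
    (hV : IsUnitHorizontal B g U V) {p : P} (hp : p ∈ B.proj ⁻¹' U) :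
    matB (ddG B g V p) = matB (dG B g V p) * (gram B g p)⁻¹ * matB (dG B g V p) := by
  have h := ddG_matrix_eq (hSB.normSq2_eq_zero hU hV hp)
  rw [matB_hV_eq_zero hg hSB hU hV hp] at h
  simpa [sub_eq_zero] using h

end Bundle

/-! ### Traceless selfadjoint operators in dimension three. -/

section Algebra

/-- Cayley-Hamilton in the form adj N = N² − (tr N) N + ½ ((tr N)² − tr N²), with tr N = 0. -/
theorem sq_eq_adjugate_fin_three (N : Matrix (Fin 3) (Fin 3) ℝ) (h : N.trace = 0) :
    N * N = N.adjugate + (1 / 2 * (N * N).trace) • (1 : Matrix (Fin 3) (Fin 3) ℝ) := by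
  have h' : N 0 0 + N 1 1 + N 2 2 = 0 := by simpa [Matrix.trace, Fin.sum_univ_three] using h
  have e : N 2 2 = - N 0 0 - N 1 1 := by linarith
  rw [adjugate_fin_three]
  ext i j
  fin_cases i <;> fin_cases j <;>
    simp [Matrix.mul_apply, Fin.sum_univ_three, Matrix.trace, e] <;> ring

/-- By Cramer's rule the entries are determinants of `A` with a row replaced by `x`. Such a matrix
still kills `z`, so it is singular. -/
theorem adjugate_mulVec_eq_zero {A : Matrix (Fin 3) (Fin 3) ℝ} (hA : Aᵀ = A) {z x : Fin 3 → ℝ}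
    (hz : z ≠ 0) (hAz : A *ᵥ z = 0) (hx : x ⬝ᵥ z = 0) : A.adjugate *ᵥ x = 0 := by
  rw [← cramer_eq_adjugate_mulVec]
  ext i
  rw [cramer_apply, ← det_transpose, ← updateRow_transpose, hA]
  refine exists_mulVec_eq_zero_iff.1 ⟨z, hz, ?_⟩
  ext j
  by_cases hj : j = i
  · subst hj
    simpa [mulVec] using hx
  · have := congrFun hAz j
    simpa [mulVec, updateRow_ne hj] using this

/-- A traceless selfadjoint operator in dimension three with kernel vector `z` squares to a multiple
of the identity on the orthogonal complement of `z`. -/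
theorem sq_eq_on_orthogonal {G A : Matrix (Fin 3) (Fin 3) ℝ} (hG : G.det ≠ 0) (hGt : Gᵀ = G)
    (hA : Aᵀ = A) {z x : Fin 3 → ℝ} (hz : z ≠ 0) (hAz : A *ᵥ z = 0) (htr : (G⁻¹ * A).trace = 0)
    (hx : x ⬝ᵥ G *ᵥ z = 0) (y : Fin 3 → ℝ) : x ⬝ᵥ (A * G⁻¹ * A) *ᵥ y =
      1 / 2 * (G⁻¹ * A * (G⁻¹ * A)).trace * (x ⬝ᵥ G *ᵥ y) := by
  have h1 := sq_eq_adjugate_fin_three _ htr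
  have e : A * G⁻¹ * A = G * (G⁻¹ * A * (G⁻¹ * A)) := by
    simp only [← Matrix.mul_assoc, mul_nonsing_inv _ (isUnit_iff_ne_zero.2 hG), Matrix.one_mul]
  have e2 : (G⁻¹).adjugate = (G⁻¹).det • G := by
    have := adjugate_mul (G⁻¹)
    have h2 : (G⁻¹).adjugate * G⁻¹ * G = ((G⁻¹).det • (1 : Matrix (Fin 3) (Fin 3) ℝ)) * G := by rw [this]
    rw [Matrix.mul_assoc, nonsing_inv_mul _ (isUnit_iff_ne_zero.2 hG)] at h2
    simpa using h2
  have hx' : (G *ᵥ x) ⬝ᵥ z = 0 := by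
    rw [← hx, dotProduct_mulVec, ← mulVec_transpose, hGt]
  -- The adjugate reverses products and adj(G⁻¹) is a multiple of G, so the pairing factors through
  -- adj(A) applied to G x, and G x is orthogonal to z.
  have h3 : x ⬝ᵥ (G * (G⁻¹ * A).adjugate) *ᵥ y = 0 := by
    rw [adjugate_mul_distrib, e2, ← mulVec_mulVec, dotProduct_mulVec, ← mulVec_transpose, hGt,
      ← mulVec_mulVec, dotProduct_mulVec, ← mulVec_transpose, adjugate_transpose, hA,
      adjugate_mulVec_eq_zero hA hz hAz hx', zero_dotProduct]
  set τ : ℝ := 1 / 2 * (G⁻¹ * A * (G⁻¹ * A)).trace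
  rw [e, h1, Matrix.mul_add, add_mulVec, dotProduct_add, h3, zero_add, Matrix.mul_smul, Matrix.mul_one,
    smul_mulVec, dotProduct_smul, smul_eq_mul]

end Algebra

/-! ### The splitting by the centre, and the second derivative of G. -/

section Bundle

variable {𝒢 P M : Type*}
  [TopologicalSpace 𝒢] [ChartedSpace (EuclideanSpace ℝ (Fin 3)) 𝒢] [Group 𝒢]
  [LieGroup (𝓡 3) ∞ 𝒢]
  [TopologicalSpace P] [ChartedSpace (EuclideanSpace ℝ (Fin 4)) P] [IsManifold (𝓡 4) ∞ P]
  [TopologicalSpace M] [ChartedSpace (EuclideanSpace ℝ (Fin 1)) M] [IsManifold (𝓡 1) ∞ M]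
  {B : PrincipalBundle 𝒢 P M} {g : Metric4 P} {H : ThreeForm P}
  {U : Set M} {V : ∀ p : P, TangentSpace (𝓡 4) p}

variable (𝒢) in
/-- The Lie algebra of the structure group is abelian. -/
def IsAbelianLie : Prop := ∀ x y : Lie3 𝒢, ⁅x, y⁆ = 0

theorem isAbelianLie_of_basis (h : ∀ i j, fibBr (lieBasis 𝒢 i) (lieBasis 𝒢 j) = 0) :
    IsAbelianLie 𝒢 := by
  have := lieGroup_three 𝒢
  have h1 : (LieAlgebra.ad ℝ (Lie3 𝒢) : Lie3 𝒢 →ₗ[ℝ] Module.End ℝ (Lie3 𝒢)) = 0 := by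
    refine (lieBasis 𝒢).ext fun i => (lieBasis 𝒢).ext fun j => ?_
    exact neg_eq_zero.1 (h i j)
  intro x y
  exact congrArg (fun T : Lie3 𝒢 →ₗ[ℝ] Module.End ℝ (Lie3 𝒢) => T x y) h1

theorem fibBr_eq_zero_of_abelian (h : IsAbelianLie 𝒢) (x y : Lie3 𝒢) : fibBr x y = 0 := by
  show -⁅x, y⁆ = 0
  rw [h, neg_zero]

/-- In the nonabelian case, the centre and the derived algebra are spanned by a vector fixed by the
adjoint action. -/
theorem exists_centre_generator [Group.IsNilpotent 𝒢] (h : ¬ IsAbelianLie 𝒢) :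
    ∃ z₀ : EuclideanSpace ℝ (Fin 3), z₀ ≠ 0 ∧ (∀ a : 𝒢, adL a z₀ = z₀) ∧
      (∀ z ∈ centre 𝒢, ∃ c : ℝ, (z : EuclideanSpace ℝ (Fin 3)) = c • z₀) ∧
      ∀ x y : Lie3 𝒢, ∃ c : ℝ, (fibBr x y : EuclideanSpace ℝ (Fin 3)) = c • z₀ := by
  have := lieGroup_three 𝒢
  have : FiniteDimensional ℝ (Lie3 𝒢) :=
    inferInstanceAs (FiniteDimensional ℝ (EuclideanSpace ℝ (Fin 3)))
  obtain ⟨z₀, hz0, hz⟩ := exists_fixed_vector (𝒢 := 𝒢)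
  have hn : ∃ x y : Lie3 𝒢, ⁅x, y⁆ ≠ 0 := by
    unfold IsAbelianLie at h
    push Not at h
    exact h
  obtain ⟨h1, h2⟩ := centre_and_derived_of_unimodular (L := Lie3 𝒢) finrank_lie3 trace_ad_eq_zero
    (z₀ := z₀) hz0 (fun x => bracket_eq_zero_of_fixed hz x) hn
  refine ⟨z₀, hz0, hz, fun z hzc => h1 z fun x => neg_eq_zero.1 (hzc x), fun x y => ?_⟩
  obtain ⟨c, hc⟩ := h2 x y
  refine ⟨-c, ?_⟩
  show -⁅x, y⁆ = -c • z₀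
  rw [hc, neg_smul]
  rfl

variable [T2Space M] [CompactSpace M] [Group.IsNilpotent 𝒢]

/-- In the nonabelian case, `DG` vanishes on the centre. -/
theorem dG_centre_eq_zero (hg : InvariantMetric B g) (hSB : SBVanishes B g H) (hU : IsOpen U)
    (hV : IsUnitHorizontal B g U V) {p : P} (hp : p ∈ B.proj ⁻¹' U) (h : ¬ IsAbelianLie 𝒢)
    (x : Lie3 𝒢) {z : Lie3 𝒢} (hz : z ∈ centre 𝒢) : dG B g V p x z = 0 := by
  obtain ⟨z₀, hz0, hfix, hcen, -⟩ := exists_centre_generator h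
  obtain ⟨c, hc0, hc⟩ := exists_unit_smul B g p hz0
  have hfix' : ∀ a : 𝒢, adL a (c • z₀) = c • z₀ := fun a => by rw [map_smul, hfix]
  obtain ⟨-, h3, h4⟩ := terms_eq_zero_of_SB (H := H) hU hV hp hc
    (hSB U V hU hV p hp _ (mem_centre_of_fixed hfix') hc)
  -- The nonabelian hypothesis enters here: the factor |[,]|² can be cancelled from two of the
  -- summands.
  have hbr : normSqBr B g p ≠ 0 := fun h0 =>
    h (isAbelianLie_of_basis (fibBr_eq_zero_of_normSqBr h0))
  have h3' := (mul_eq_zero.1 h3).resolve_left hbr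
  have h4' := (mul_eq_zero.1 h4).resolve_left hbr
  -- With tr DG = 0 the first of them gives DG(η, η) = 0 for the unit central η. The second then
  -- says that the covector DG(·, η) has norm zero.
  rw [trDG_eq_zero hg hSB hU hV hp] at h3'
  have h5 : dG B g V p (c • z₀) (c • z₀) = 0 := by
    have := pow_eq_zero_iff (two_ne_zero) |>.1 h3'
    linarith
  rw [h5] at h4'
  have h6 : normSq1 B g p (fun x => dG B g V p x (c • z₀)) = 0 := by
    have : (trG B g p fun c' c'' => dG B g V p c' (c • z₀) * dG B g V p c'' (c • z₀)) = 0 := by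
      linarith
    exact this
  rw [normSq1_eq] at h6
  have h7 := inv_dotProduct_eq_zero (gram_posDef B g p) h6
  have h8 : matB (dG B g V p) *ᵥ (c • z₀).ofLp = 0 := by
    ext i
    have h9 := congrFun h7 i
    refine Eq.trans ?_ h9
    refine Eq.trans ?_ (dG_eq_dotProduct hU hV hp (lieBasis 𝒢 i) (c • z₀)).symm
    rw [lieBasis_eq]
    simp
  obtain ⟨d, hd⟩ := hcen z hz
  have h10 : z = (d * c⁻¹) • (c • z₀) := by
    rw [smul_smul, mul_assoc, inv_mul_cancel₀ hc0, mul_one]; exact hd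
  refine (dG_eq_dotProduct hU hV hp x z).trans ?_
  rw [h10, WithLp.ofLp_smul, mulVec_smul, h8]
  simp

theorem mem_centre_of_abelian (h : IsAbelianLie 𝒢) (z : Lie3 𝒢) : z ∈ centre 𝒢 :=
  fun x => fibBr_eq_zero_of_abelian h z x

/-- In the abelian case the complement of the centre is zero; otherwise DG vanishes on the centre in
either argument. -/
theorem dG_perp_centre (hg : InvariantMetric B g) (hSB : SBVanishes B g H) (hU : IsOpen U)
    (hV : IsUnitHorizontal B g U V) {p : P} (hp : p ∈ B.proj ⁻¹' U) {x z : Lie3 𝒢}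
    (hx : x ∈ centrePerp B g p) (hz : z ∈ centre 𝒢) : dG B g V p x z = 0 := by
  by_cases h : IsAbelianLie 𝒢
  · have hx0 : x = (0 : EuclideanSpace ℝ (Fin 3)) := by
      by_contra hne
      exact (fibG_pos B g p hne).ne' (hx x (mem_centre_of_abelian h x))
    refine (dG_eq_dotProduct hU hV hp x z).trans ?_
    rw [hx0]
    simp
  · exact dG_centre_eq_zero hg hSB hU hV hp h x hz

/-- The centre is one fixed linear subspace of 𝔤, so a curve in it has its derivative in it. -/
theorem covDerivSec_mem_centre (hU : IsOpen U) (hV : IsUnitHorizontal B g U V) {p : P}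
    (hp : p ∈ B.proj ⁻¹' U) {η : P → Lie3 𝒢} (hη : IsAdjointSection B U η)
    (hc : ∀ q ∈ B.proj ⁻¹' U, η q ∈ centre 𝒢) : covDerivSec V η p ∈ centre 𝒢 := by
  have := lieGroup_three 𝒢
  obtain ⟨γ, rfl, -, hγ⟩ := exists_flow_line hU hV hp
  have hd : HasDerivAt (F := EuclideanSpace ℝ (Fin 3)) (fun s => η (γ s)) (covDerivSec V η (γ 0)) 0 :=
    hγ.self_of_nhds.hasDerivAt ((hη.smooth.contMDiffAt
      ((isOpen_preimage B hU).mem_nhds hp)).mdifferentiableAt (by norm_num))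
  intro x
  let ℓ : EuclideanSpace ℝ (Fin 3) →ₗ[ℝ] EuclideanSpace ℝ (Fin 3) :=
    -(LinearMap.flip (LieAlgebra.ad ℝ (Lie3 𝒢) : Lie3 𝒢 →ₗ[ℝ] Module.End ℝ (Lie3 𝒢)) x)
  have h1 := (LinearMap.toContinuousLinearMap ℓ).hasFDerivAt.comp_hasDerivAt 0 hd
  have h2 : (LinearMap.toContinuousLinearMap ℓ) ∘ (fun s => η (γ s)) =ᶠ[nhds 0] fun _ => 0 := by
    filter_upwards [hγ] with s hs
    exact hc _ hs.1 x
  exact h1.unique ((hasDerivAt_const (0 : ℝ) (0 : EuclideanSpace ℝ (Fin 3))).congr_of_eventuallyEq h2)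

/-- Differentiating G(η, z) = 0 for a constant central z gives G(Dη, z) + DG(η, z) = 0, and the
second term is zero by `dG_perp_centre`. -/
theorem covDerivSec_mem_centrePerp (hg : InvariantMetric B g) (hSB : SBVanishes B g H)
    (hU : IsOpen U) (hV : IsUnitHorizontal B g U V) {p : P}
    (hp : p ∈ B.proj ⁻¹' U) {η : P → Lie3 𝒢} (hη : IsAdjointSection B U η)
    (hc : ∀ q ∈ B.proj ⁻¹' U, η q ∈ centrePerp B g q) :
    covDerivSec V η p ∈ centrePerp B g p := by
  intro z hz
  have hdz := dG_perp_centre hg hSB hU hV hp (hc p hp) hz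
  obtain ⟨γ, rfl, -, hγ⟩ := exists_flow_line hU hV hp
  have hd : HasDerivAt (F := EuclideanSpace ℝ (Fin 3)) (fun s => η (γ s)) (covDerivSec V η (γ 0)) 0 :=
    hγ.self_of_nhds.hasDerivAt ((hη.smooth.contMDiffAt
      ((isOpen_preimage B hU).mem_nhds hp)).mdifferentiableAt (by norm_num))
  have hdi : ∀ i, HasDerivAt (fun s => (η (γ s) : EuclideanSpace ℝ (Fin 3)).ofLp i)
      ((covDerivSec V η (γ 0) : EuclideanSpace ℝ (Fin 3)).ofLp i) 0 := fun i =>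
    (EuclideanSpace.proj (𝕜 := ℝ) i).hasFDerivAt.comp_hasDerivAt (0 : ℝ) hd
  have h0 := hγ.self_of_nhds
  have h1 : HasDerivAt (fun s => ∑ i, ∑ j, ((η (γ s) : EuclideanSpace ℝ (Fin 3)).ofLp i *
      (z : EuclideanSpace ℝ (Fin 3)).ofLp j) * gram B g (γ s) i j)
      (∑ i, ∑ j, (((covDerivSec V η (γ 0) : EuclideanSpace ℝ (Fin 3)).ofLp i *
        (z : EuclideanSpace ℝ (Fin 3)).ofLp j) * gram B g (γ 0) i j +
        ((η (γ 0) : EuclideanSpace ℝ (Fin 3)).ofLp i *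
        (z : EuclideanSpace ℝ (Fin 3)).ofLp j) * matB (dG B g V (γ 0)) i j)) 0 :=
    HasDerivAt.fun_sum fun i _ => HasDerivAt.fun_sum fun j _ =>
      ((hdi i).mul_const _).fun_mul (h0.hasDerivAt_gram i j)
  have h2 : (fun s => ∑ i, ∑ j, ((η (γ s) : EuclideanSpace ℝ (Fin 3)).ofLp i *
      (z : EuclideanSpace ℝ (Fin 3)).ofLp j) * gram B g (γ s) i j) =ᶠ[nhds 0] fun _ => 0 := by
    filter_upwards [hγ] with s hs
    rw [← sum_eq_dotProduct]
    exact (fibG_eq_dotProduct B g (γ s) (η (γ s)) z).symm.trans (hc _ hs.1 z hz)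
  have h3 := h1.unique ((hasDerivAt_const (0 : ℝ) (0 : ℝ)).congr_of_eventuallyEq h2)
  simp only [Finset.sum_add_distrib] at h3
  rw [← sum_eq_dotProduct, ← sum_eq_dotProduct] at h3
  refine (fibG_eq_dotProduct B g (γ 0) (covDerivSec V η (γ 0)) z).trans ?_
  have h4 := (dG_eq_dotProduct hU hV hp (η (γ 0)) z).symm.trans hdz
  rw [h4, add_zero] at h3
  exact h3

theorem ddG_eq_dGdG (hg : InvariantMetric B g) (hSB : SBVanishes B g H) (hU : IsOpen U)
    (hV : IsUnitHorizontal B g U V) {p : P} (hp : p ∈ B.proj ⁻¹' U) (x y : Lie3 𝒢) :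
    ddG B g V p x y = (x : EuclideanSpace ℝ (Fin 3)).ofLp ⬝ᵥ
      (matB (dG B g V p) * (gram B g p)⁻¹ * matB (dG B g V p)) *ᵥ
        (y : EuclideanSpace ℝ (Fin 3)).ofLp := by
  rw [← matB_ddG_eq hg hSB hU hV hp]
  exact ddG_eq_dotProduct hU hV hp x y

theorem dGdG_eq_dotProduct (hU : IsOpen U) (hV : IsUnitHorizontal B g U V) {p : P}
    (hp : p ∈ B.proj ⁻¹' U) (x y : Lie3 𝒢) :
    dGdG B g V p x y = (x : EuclideanSpace ℝ (Fin 3)).ofLp ⬝ᵥ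
      (matB (dG B g V p) * (gram B g p)⁻¹ * matB (dG B g V p)) *ᵥ
        (y : EuclideanSpace ℝ (Fin 3)).ofLp := by
  have h : ∀ (w : Lie3 𝒢) i, dG B g V p w (lieBasis 𝒢 i) =
      (matB (dG B g V p) *ᵥ (w : EuclideanSpace ℝ (Fin 3)).ofLp) i := by
    intro w i
    rw [dG_symm]
    refine (dG_eq_dotProduct hU hV hp (lieBasis 𝒢 i) w).trans ?_
    rw [lieBasis_eq]
    simp
  have hS : dGdG B g V p x y = (matB (dG B g V p) *ᵥ (x : EuclideanSpace ℝ (Fin 3)).ofLp) ⬝ᵥ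
      (gram B g p)⁻¹ *ᵥ (matB (dG B g V p) *ᵥ (y : EuclideanSpace ℝ (Fin 3)).ofLp) := by
    rw [sum_eq_dotProduct, dGdG, trG_eq]
    refine Finset.sum_congr rfl fun i _ => Finset.sum_congr rfl fun j _ => ?_
    rw [h, h, smul_eq_mul]; ring
  rw [hS, Matrix.mul_assoc, ← mulVec_mulVec, ← mulVec_mulVec, dotProduct_mulVec (v := x.ofLp),
    ← mulVec_transpose, matB_dG_transpose]

theorem normSqDG_eq (p : P) : normSqDG B g V p =
    ((gram B g p)⁻¹ * matB (dG B g V p) * ((gram B g p)⁻¹ * matB (dG B g V p))).trace := by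
  rw [normSqDG, normSq2_eq, contr2_eq_trace (by rw [Matrix.transpose_nonsing_inv, gram_transpose]),
    matB_dG_transpose]
  simp only [Matrix.mul_assoc]

theorem ddG_perp_eq (hg : InvariantMetric B g) (hSB : SBVanishes B g H) (hU : IsOpen U)
    (hV : IsUnitHorizontal B g U V) {p : P} (hp : p ∈ B.proj ⁻¹' U) (h : ¬ IsAbelianLie 𝒢)
    {x : Lie3 𝒢} (hx : x ∈ centrePerp B g p) (y : Lie3 𝒢) :
    ddG B g V p x y = 1 / 2 * normSqDG B g V p * fibG B g p x y := by
  obtain ⟨z₀, hz0, hfix, -, -⟩ := exists_centre_generator h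
  have hzc := mem_centre_of_fixed hfix
  refine (ddG_eq_dGdG hg hSB hU hV hp x y).trans ?_
  have hAz : matB (dG B g V p) *ᵥ z₀.ofLp = 0 := by
    ext i
    have h9 := dG_centre_eq_zero hg hSB hU hV hp h (lieBasis 𝒢 i) hzc
    refine Eq.trans ?_ h9
    refine Eq.trans ?_ (dG_eq_dotProduct hU hV hp (lieBasis 𝒢 i) z₀).symm
    rw [lieBasis_eq]
    simp
  rw [sq_eq_on_orthogonal (gram_det_pos B g p).ne' (gram_transpose B g p) (matB_dG_transpose p)
    (z := z₀.ofLp) (by simpa using hz0) hAz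
    ((trDG_eq p).symm.trans (trDG_eq_zero hg hSB hU hV hp))
    ((fibG_eq_dotProduct B g p x z₀).symm.trans (hx z₀ hzc)), normSqDG_eq]
  congr 1
  exact (fibG_eq_dotProduct B g p x y).symm

end Bundle

/-! ### Invariance of H along V, from closedness. -/

section Bundle

variable {𝒢 P M : Type*}
  [TopologicalSpace 𝒢] [ChartedSpace (EuclideanSpace ℝ (Fin 3)) 𝒢] [Group 𝒢]
  [LieGroup (𝓡 3) ∞ 𝒢]
  [TopologicalSpace P] [ChartedSpace (EuclideanSpace ℝ (Fin 4)) P] [IsManifold (𝓡 4) ∞ P]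
  [TopologicalSpace M] [ChartedSpace (EuclideanSpace ℝ (Fin 1)) M] [IsManifold (𝓡 1) ∞ M]
  {B : PrincipalBundle 𝒢 P M} {g : Metric4 P} {H : ThreeForm P}
  {U : Set M} {V : ∀ p : P, TangentSpace (𝓡 4) p}

theorem chartField_self {n : ℕ} {N : Type*} [TopologicalSpace N]
    [ChartedSpace (EuclideanSpace ℝ (Fin n)) N] [IsManifold (𝓡 n) ∞ N]
    (Y : ∀ p : N, TangentSpace (𝓡 n) p) (p : N) :
    chartField p Y (extChartAt (𝓡 n) p p) = Y p := by
  have := isManifold_one n N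
  unfold chartField
  rw [extChartAt_to_inv, mfderiv_extChartAt_self]
  rfl

theorem chartForm_apply (H : ThreeForm P) (p : P) (x : EuclideanSpace ℝ (Fin 4))
    (u v w : EuclideanSpace ℝ (Fin 4)) :
    chartForm H p x ![u, v, w] = H ((extChartAt (𝓡 4) p).symm x)
      ![mfderiv 𝓘(ℝ, EuclideanSpace ℝ (Fin 4)) (𝓡 4) (extChartAt (𝓡 4) p).symm x u,
        mfderiv 𝓘(ℝ, EuclideanSpace ℝ (Fin 4)) (𝓡 4) (extChartAt (𝓡 4) p).symm x v,
        mfderiv 𝓘(ℝ, EuclideanSpace ℝ (Fin 4)) (𝓡 4) (extChartAt (𝓡 4) p).symm x w] := by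
  refine (ContinuousAlternatingMap.compContinuousLinearMap_apply _ _ _).trans ?_
  congr 1
  ext i : 1
  fin_cases i <;> rfl

theorem chartForm_chartField (H : ThreeForm P) {p : P} {x : EuclideanSpace ℝ (Fin 4)}
    (hx : x ∈ (extChartAt (𝓡 4) p).target) (X Y Z : ∀ p : P, TangentSpace (𝓡 4) p) :
    chartForm H p x ![chartField p X x, chartField p Y x, chartField p Z x] =
      H ((extChartAt (𝓡 4) p).symm x) ![X ((extChartAt (𝓡 4) p).symm x),
        Y ((extChartAt (𝓡 4) p).symm x), Z ((extChartAt (𝓡 4) p).symm x)] := by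
  refine (chartForm_apply H p x _ _ _).trans ?_
  have h := fun W : (∀ p : P, TangentSpace (𝓡 4) p) =>
    mfderiv_chart_symm_apply hx (W ((extChartAt (𝓡 4) p).symm x))
  congr 1
  ext i : 1
  fin_cases i
  · exact h X
  · exact h Y
  · exact h Z

theorem mdifferentiableAt_three_form_apply {X Y Z : ∀ p : P, TangentSpace (𝓡 4) p} {p : P}
    (hH : IsSmoothForm H)
    (hX : ContMDiffAt (𝓡 4) (𝓡 4).tangent ∞ (fun q => (⟨q, X q⟩ : TangentBundle (𝓡 4) P)) p)
    (hY : ContMDiffAt (𝓡 4) (𝓡 4).tangent ∞ (fun q => (⟨q, Y q⟩ : TangentBundle (𝓡 4) P)) p)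
    (hZ : ContMDiffAt (𝓡 4) (𝓡 4).tangent ∞ (fun q => (⟨q, Z q⟩ : TangentBundle (𝓡 4) P)) p) :
    MDifferentiableAt (𝓡 4) 𝓘(ℝ, ℝ) (fun q => H q ![X q, Y q, Z q]) p := by
  have := isManifold_one 4 P
  have hd : ∀ {W : ∀ p : P, TangentSpace (𝓡 4) p}, ContMDiffAt (𝓡 4) (𝓡 4).tangent ∞
      (fun q => (⟨q, W q⟩ : TangentBundle (𝓡 4) P)) p →
      DifferentiableAt ℝ (chartField p W) (extChartAt (𝓡 4) p p) := fun h =>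
    (contMDiffAt_section_iff_chartField.1 h).differentiableAt (by norm_num)
  have h1 : DifferentiableAt ℝ (fun y => chartForm H p y
      (fun i => (![chartField p X, chartField p Y, chartField p Z] : Fin 3 → _) i y))
      (extChartAt (𝓡 4) p p) := by
    refine DifferentiableAt.continuousAlternatingMap_apply
      (((hH p).contDiffAt (chart_target_mem_nhds p)).differentiableAt (by norm_num)) fun i => ?_
    fin_cases i
    exacts [hd hX, hd hY, hd hZ]
  have h2 := h1.mdifferentiableAt.comp p
    (mdifferentiableAt_extChartAt (I := 𝓡 4) (mem_chart_source (EuclideanSpace ℝ (Fin 4)) p))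
  refine h2.congr_of_eventuallyEq ?_
  filter_upwards [extChartAt_source_mem_nhds (I := 𝓡 4) p] with q hq
  have h3 := chartForm_chartField H ((extChartAt (𝓡 4) p).map_source hq) X Y Z
  rw [(extChartAt (𝓡 4) p).left_inv hq] at h3
  refine h3.symm.trans ?_
  simp only [Function.comp_apply]
  congr 1
  ext i : 1
  fin_cases i <;> rfl

/-- An invariant field commutes with the infinitesimal action. -/
theorem fderiv_chartField_vert_comm (hU : IsOpen U) (hV : IsUnitHorizontal B g U V) {p : P}
    (hp : p ∈ B.proj ⁻¹' U) (v : Lie3 𝒢) :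
    fderiv ℝ (chartField p fun q => vert B q v) (extChartAt (𝓡 4) p p)
      (chartField p V (extChartAt (𝓡 4) p p)) =
    fderiv ℝ (chartField p V) (extChartAt (𝓡 4) p p)
      (chartField p (fun q => vert B q v) (extChartAt (𝓡 4) p p)) := by
  have h2 : (2 : ℕ∞ω) ≤ ∞ := WithTop.coe_le_coe.2 (show (2 : ℕ∞) ≤ ⊤ from le_top)
  have hA := contDiffAt_chartAct (q₀ := p) B.contMDiff_act B.act_one
  obtain ⟨L, hL, hL'⟩ := exists_mixed_derivative (hA.of_le h2)
  set x₀ := extChartAt (𝓡 4) p p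
  set s₀ := extChartAt (𝓡 3) (1 : 𝒢) 1
  have hx₀ : x₀ ∈ (extChartAt (𝓡 4) p).target := mem_extChartAt_target p
  have hs₀ : chartAct B.act p (x₀, s₀) = x₀ := by
    simp only [chartAct, x₀, s₀, extChartAt_to_inv, B.act_one]
  have hX : HasFDerivAt (chartField p fun q => vert B q v) (L v) x₀ := by
    have h := hL'.clm_apply (hasFDerivAt_const (v : EuclideanSpace ℝ (Fin 3)) x₀)
    refine (h.congr_of_eventuallyEq ?_).congr_fderiv ?_
    · filter_upwards [chart_target_mem_nhds (n := 4) p] with x hx using chartField_vert B v hx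
    · ext1 u
      exact (congrArg (· + L v u) (ContinuousLinearMap.map_zero
        (fderiv ℝ (fun s => chartAct B.act p (x₀, s)) s₀))).trans (zero_add _)
  have hdV : DifferentiableAt ℝ (chartField p V) x₀ :=
    (contMDiffAt_section_iff_chartField.1 (hV.contMDiffAt hU hp)).differentiableAt (by norm_num)
  have hAs : HasFDerivAt (fun s => chartAct B.act p (x₀, s))
      (fderiv ℝ (fun s => chartAct B.act p (x₀, s)) s₀) s₀ := by
    have h1 : DifferentiableAt ℝ (chartAct B.act p) (x₀, s₀) := hA.differentiableAt (by norm_num)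
    exact (h1.comp s₀ ((differentiableAt_const x₀).prodMk differentiableAt_id)).hasFDerivAt
  have hl : HasFDerivAt (fun s => chartField p V (chartAct B.act p (x₀, s)))
      ((fderiv ℝ (chartField p V) x₀).comp (fderiv ℝ (fun s => chartAct B.act p (x₀, s)) s₀)) s₀ := by
    have h1 : HasFDerivAt (chartField p V) (fderiv ℝ (chartField p V) x₀)
        (chartAct B.act p (x₀, s₀)) := by rw [hs₀]; exact hdV.hasFDerivAt
    exact h1.comp s₀ hAs
  have hr : HasFDerivAt (fun s => fderiv ℝ (fun x => chartAct B.act p (x, s)) x₀ (modelVec (V p)))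
      (L.flip (modelVec (V p))) s₀ := by
    have h := hL.clm_apply (hasFDerivAt_const (modelVec (V p)) s₀)
    refine h.congr_fderiv ?_
    ext1 u
    simp
  -- Invariance of `V` in charts. Differentiation in s at the identity gives D_X V on the left and,
  -- by the symmetry of mixed derivatives, D_V X on the right, where X is the vertical field of v.
  have heq : (fun s => chartField p V (chartAct B.act p (x₀, s))) =ᶠ[nhds s₀]
      fun s => fderiv ℝ (fun x => chartAct B.act p (x, s)) x₀ (modelVec (V p)) := by
    have hc : ∀ᶠ s in nhds s₀, B.act p ((extChartAt (𝓡 3) (1 : 𝒢)).symm s) ∈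
        (extChartAt (𝓡 4) p).source := by
      have h1 : ContinuousAt (fun s => B.act p ((extChartAt (𝓡 3) (1 : 𝒢)).symm s)) s₀ :=
        ((contMDiff_act_left B.contMDiff_act p).continuous.continuousAt).comp
          (continuousAt_extChartAt_symm (1 : 𝒢))
      refine h1.eventually_mem ?_
      have h2 : B.act p ((extChartAt (𝓡 3) (1 : 𝒢)).symm s₀) = p := by
        simp only [s₀, extChartAt_to_inv, B.act_one]
      rw [h2]
      exact extChartAt_source_mem_nhds p
    filter_upwards [hc, chart_target_mem_nhds (n := 3) (1 : 𝒢)] with s hs hst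
    have h1 := fderiv_chartAct_left (q₀ := p) B.contMDiff_act hs
      ((extChartAt (𝓡 3) (1 : 𝒢)).map_target hst) (modelVec (V p))
    rw [(extChartAt (𝓡 3) (1 : 𝒢)).right_inv hst] at h1
    refine Eq.trans ?_ h1.symm
    set a := (extChartAt (𝓡 3) (1 : 𝒢)).symm s
    have h3 : (extChartAt (𝓡 4) p).symm (chartAct B.act p (x₀, s)) = B.act p a := by
      simp only [chartAct, x₀, extChartAt_to_inv]
      exact (extChartAt (𝓡 4) p).left_inv hs
    have h4 : ∀ r, r = B.act p a → (mfderiv (𝓡 4) 𝓘(ℝ, EuclideanSpace ℝ (Fin 4))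
        (extChartAt (𝓡 4) p) r (V r) : EuclideanSpace ℝ (Fin 4)) =
        mfderiv (𝓡 4) 𝓘(ℝ, EuclideanSpace ℝ (Fin 4)) (extChartAt (𝓡 4) p) (B.act p a)
          (V (B.act p a)) := by rintro r rfl; rfl
    refine (h4 _ h3).trans ?_
    exact congrArg (fun u : EuclideanSpace ℝ (Fin 4) => (mfderiv (𝓡 4)
      𝓘(ℝ, EuclideanSpace ℝ (Fin 4)) (extChartAt (𝓡 4) p) (B.act p a) u :
        EuclideanSpace ℝ (Fin 4))) (hV.invariant p hp a).symm
  have hfin := congrArg (fun T : EuclideanSpace ℝ (Fin 3) →L[ℝ] EuclideanSpace ℝ (Fin 4) => T v)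
    ((hl.congr_of_eventuallyEq heq.symm).unique hr)
  rw [hX.fderiv, chartField_vert B v hx₀]
  have hVp : chartField p V x₀ = modelVec (V p) := chartField_self V p
  rw [hVp]
  exact hfin.symm

/-- `H(V, ·, ·) = 0` as soon as it vanishes on vertical vectors. -/
theorem interior_eq_zero (hV : IsUnitHorizontal B g U V) {p : P} (hp : p ∈ B.proj ⁻¹' U)
    (h : matB (NilBundle.hV B H V p) = 0) (u w : EuclideanSpace ℝ (Fin 4)) :
    H p ![V p, u, w] = 0 := by
  let v : EuclideanSpace ℝ (Fin 4) := modelVec (V p)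
  let β : EuclideanSpace ℝ (Fin 4) [⋀^Fin 3]→L[ℝ] ℝ := H p
  have u1 : ∀ a b c d : EuclideanSpace ℝ (Fin 4),
      Function.update ![a, b, c] 1 d = ![a, d, c] := fun a b c d => by
    ext i : 1; fin_cases i <;> rfl
  have u2 : ∀ a b c d : EuclideanSpace ℝ (Fin 4),
      Function.update ![a, b, c] 2 d = ![a, b, d] := fun a b c d => by
    ext i : 1; fin_cases i <;> rfl
  let T : EuclideanSpace ℝ (Fin 4) →ₗ[ℝ] EuclideanSpace ℝ (Fin 4) →ₗ[ℝ] ℝ :=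
    LinearMap.mk₂ ℝ (fun u w => β ![v, u, w])
      (fun a b c => by
        have h := β.map_update_add ![v, a, c] 1 a b
        simp only [u1] at h
        exact h)
      (fun r a c => by
        have h := β.map_update_smul ![v, a, c] 1 r a
        simp only [u1] at h
        exact h)
      (fun a b c => by
        have h := β.map_update_add ![v, a, b] 2 b c
        simp only [u2] at h
        exact h)
      (fun r a c => by
        have h := β.map_update_smul ![v, a, c] 2 r c
        simp only [u2] at h
        exact h)
  have hT : ∀ u w, T u w = β ![v, u, w] := fun _ _ => rfl
  have h1 : ∀ w, T v w = 0 := fun w => three_form_self β v w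
  have h2 : ∀ w, T w v = 0 := fun w => by
    rw [hT, three_form_swap12, three_form_self, neg_zero]
  let L : EuclideanSpace ℝ (Fin 3) →ₗ[ℝ] EuclideanSpace ℝ (Fin 4) := vertL B p
  have h3 : ∀ x y, T (L x) (L y) = 0 := by
    intro x y
    have h4 := bilin_eq_dotProduct (T.compl₁₂ L L) x y
    have e : (Matrix.of fun i j => T.compl₁₂ L L (stdE i) (stdE j)) = 0 := by
      rw [← h]
      ext i j
      simp only [matB, Matrix.of_apply, lieBasis_eq]
      rfl
    rw [e] at h4
    simpa using h4
  obtain ⟨c, x, hu⟩ := exists_decomposition hV hp u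
  obtain ⟨d, y, hw⟩ := exists_decomposition hV hp w
  have h5 : T u w = 0 := by
    rw [hu, hw]
    have h3' : T (vertL B p x) (vertL B p y) = 0 := h3 x y
    have h1' : ∀ w, T (modelVec (V p)) w = 0 := h1
    have h2' : ∀ w, T w (modelVec (V p)) = 0 := h2
    simp [h1', h2', h3']
  exact h5

variable [T2Space M] [CompactSpace M] [Group.IsNilpotent 𝒢]

theorem mdifferentiableAt_fibH (hHs : IsSmoothForm H) (p : P) :
    MDifferentiableAt (𝓡 4) 𝓘(ℝ, ℝ) (fibH B H) p :=
  mdifferentiableAt_three_form_apply hHs (contMDiffAt_vert B _ p) (contMDiffAt_vert B _ p)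
    (contMDiffAt_vert B _ p)

/-- Cartan's formula: tr_g H² = 0 makes ι_V H vanish near p, so L_V H = 0, and the three vertical
fields commute with V. -/
theorem covDeriv_fibH_eq_zero (hg : InvariantMetric B g) (hSB : SBVanishes B g H)
    (hHs : IsSmoothForm H) (hHc : IsClosedForm H) (hU : IsOpen U)
    (hV : IsUnitHorizontal B g U V) {p : P} (hp : p ∈ B.proj ⁻¹' U) :
    covDeriv V (fibH B H) p = 0 := by
  have hdH : MDifferentiableAt (𝓡 4) 𝓘(ℝ, ℝ) (fibH B H) p :=
    mdifferentiableAt_fibH hHs p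
  set x₀ := extChartAt (𝓡 4) p p
  have hx₀ : x₀ ∈ (extChartAt (𝓡 4) p).target := mem_extChartAt_target p
  have dV := fun v => (contMDiffAt_section_iff_chartField.1 (contMDiffAt_vert B v p)).differentiableAt
    (n := ∞) (by norm_num)
  have key := fderiv_closed_form_eq_zero (β := chartForm H p) (V := chartField p V)
    (X := chartField p fun q => vert B q (lieBasis 𝒢 0))
    (Y := chartField p fun q => vert B q (lieBasis 𝒢 1))
    (Z := chartField p fun q => vert B q (lieBasis 𝒢 2)) (x := x₀)
    (((hHs p).contDiffAt (chart_target_mem_nhds p)).differentiableAt (by norm_num))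
    ((contMDiffAt_section_iff_chartField.1 (hV.contMDiffAt hU hp)).differentiableAt (by norm_num))
    (dV _) (dV _) (dV _) (hHc p x₀ hx₀) ?_
    (fderiv_chartField_vert_comm hU hV hp _) (fderiv_chartField_vert_comm hU hV hp _)
    (fderiv_chartField_vert_comm hU hV hp _)
  · have h1 : covDeriv V (fibH B H) p =
        fderiv ℝ (fun x => fibH B H ((extChartAt (𝓡 4) p).symm x)) x₀ (modelVec (V p)) :=
      mfderiv_eq_fderiv_chart hdH (modelVec (V p))
    have h2 : (fun x => fibH B H ((extChartAt (𝓡 4) p).symm x)) =ᶠ[nhds x₀] fun y =>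
        chartForm H p y ![chartField p (fun q => vert B q (lieBasis 𝒢 0)) y,
          chartField p (fun q => vert B q (lieBasis 𝒢 1)) y,
          chartField p (fun q => vert B q (lieBasis 𝒢 2)) y] := by
      filter_upwards [chart_target_mem_nhds (n := 4) p] with x hx
      exact (chartForm_chartField H hx (fun q => vert B q (lieBasis 𝒢 0))
        (fun q => vert B q (lieBasis 𝒢 1)) (fun q => vert B q (lieBasis 𝒢 2))).symm
    rw [h1, h2.fderiv_eq]
    have h3 : chartField p V x₀ = modelVec (V p) := chartField_self V p
    rw [← h3]
    exact key
  · have hpU : ∀ᶠ x in nhds x₀, (extChartAt (𝓡 4) p).symm x ∈ B.proj ⁻¹' U := by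
      refine (continuousAt_extChartAt_symm (I := 𝓡 4) p).eventually_mem ?_
      rw [extChartAt_to_inv]
      exact (isOpen_preimage B hU).mem_nhds hp
    filter_upwards [hpU, chart_target_mem_nhds (n := 4) p] with x hxU hx u w
    refine (chartForm_apply H p x _ _ _).trans ?_
    have h1 : mfderiv 𝓘(ℝ, EuclideanSpace ℝ (Fin 4)) (𝓡 4) (extChartAt (𝓡 4) p).symm x
        (chartField p V x) = V ((extChartAt (𝓡 4) p).symm x) :=
      mfderiv_chart_symm_apply hx (V ((extChartAt (𝓡 4) p).symm x))
    rw [h1]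
    exact interior_eq_zero hV hxU (matB_hV_eq_zero hg hSB hU hV hxU) _ _

end Bundle

/-! ### Constancy of |[,]|², |DG|² and |H^𝔊|². -/

section Bundle

variable {𝒢 P M : Type*}
  [TopologicalSpace 𝒢] [ChartedSpace (EuclideanSpace ℝ (Fin 3)) 𝒢] [Group 𝒢]
  [LieGroup (𝓡 3) ∞ 𝒢]
  [TopologicalSpace P] [ChartedSpace (EuclideanSpace ℝ (Fin 4)) P] [IsManifold (𝓡 4) ∞ P]
  [TopologicalSpace M] [ChartedSpace (EuclideanSpace ℝ (Fin 1)) M] [IsManifold (𝓡 1) ∞ M]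
  {B : PrincipalBundle 𝒢 P M} {g : Metric4 P} {H : ThreeForm P}
  {U : Set M} {V : ∀ p : P, TangentSpace (𝓡 4) p}

/-- An invariant function with vanishing derivative along `V` has vanishing differential. -/
theorem hasMFDerivAt_zero_of_invariant (hV : IsUnitHorizontal B g U V) {p : P}
    (hp : p ∈ B.proj ⁻¹' U) {f : P → ℝ} (hf : MDifferentiableAt (𝓡 4) 𝓘(ℝ, ℝ) f p)
    (hinv : ∀ a, f (B.act p a) = f p) (hfV : covDeriv V f p = 0) :
    HasMFDerivAt (𝓡 4) 𝓘(ℝ, ℝ) f p 0 := by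
  refine hf.hasMFDerivAt.congr_mfderiv ?_
  let D : EuclideanSpace ℝ (Fin 4) →L[ℝ] ℝ := mfderiv (𝓡 4) 𝓘(ℝ, ℝ) f p
  have hvert : ∀ x, D (vertL B p x) = 0 := by
    intro x
    have hf1 : MDifferentiableAt (𝓡 4) 𝓘(ℝ, ℝ) f (B.act p 1) := by rwa [B.act_one]
    have h1 := hf1.hasMFDerivAt.comp 1 (mdifferentiable_act_left B p 1).hasMFDerivAt
    have e : f ∘ (fun a => B.act p a) = fun _ => f p := funext hinv
    rw [e] at h1
    have h2 := hasMFDerivAt_unique h1 (hasMFDerivAt_const (f p) (1 : 𝒢))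
    let D' : EuclideanSpace ℝ (Fin 4) →L[ℝ] ℝ := mfderiv (𝓡 4) 𝓘(ℝ, ℝ) f (B.act p 1)
    have h3 : D' (vertL B p x) = 0 :=
      congrArg (fun T : EuclideanSpace ℝ (Fin 3) →L[ℝ] ℝ => T x) h2
    have h4 : ∀ q, q = p → ∀ u, (mfderiv (𝓡 4) 𝓘(ℝ, ℝ) f q :
        EuclideanSpace ℝ (Fin 4) →L[ℝ] ℝ) u = D u := by rintro q rfl u; rfl
    exact (h4 _ (B.act_one p) _).symm.trans h3
  have hD : D = 0 := by
    ext1 u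
    obtain ⟨c, x, rfl⟩ := exists_decomposition hV hp u
    have hDV : D (modelVec (V p)) = 0 := hfV
    rw [map_add, map_smul, hDV, hvert]
    simp
  exact hD

theorem fibG_smul_smul (p : P) (c d : ℝ) (x y : EuclideanSpace ℝ (Fin 3)) :
    fibG B g p (c • x) (d • y) = c * d * fibG B g p x y := by
  refine (fibG_eq_gL B g p _ _).trans ?_
  rw [fibG_eq_gL B g p x y]
  simp
  ring

theorem fibBr_swap (x y : Lie3 𝒢) : fibBr y x = - fibBr x y := by
  have := lieGroup_three 𝒢
  show -⁅y, x⁆ = - -⁅x, y⁆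
  rw [lie_skew, neg_neg]

/-- The vector dual to a bracket with values in a line is central. -/
theorem dual_mem_centre {z₀ : EuclideanSpace ℝ (Fin 3)} {w : Matrix (Fin 3) (Fin 3) ℝ}
    (hw : ∀ i j, (fibBr (lieBasis 𝒢 i) (lieBasis 𝒢 j) : EuclideanSpace ℝ (Fin 3)) = w i j • z₀)
    (hskew : ∀ i j, w j i = - w i j) :
    (WithLp.toLp 2 ![w 1 2, w 2 0, w 0 1] : EuclideanSpace ℝ (Fin 3)) ∈ centre 𝒢 := by
  have := lieGroup_three 𝒢
  let F : EuclideanSpace ℝ (Fin 3) →ₗ[ℝ] EuclideanSpace ℝ (Fin 3) →ₗ[ℝ] EuclideanSpace ℝ (Fin 3) :=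
    -(LieAlgebra.ad ℝ (Lie3 𝒢) : Lie3 𝒢 →ₗ[ℝ] Module.End ℝ (Lie3 𝒢))
  have hF : ∀ i j, F (stdE i) (stdE j) = w i j • z₀ := hw
  set v : Fin 3 → ℝ := ![w 1 2, w 2 0, w 0 1] with hv
  have hj : ∀ j, F (WithLp.toLp 2 v) (stdE j) = 0 := by
    intro j
    rw [sum_stdE (WithLp.toLp 2 v), map_sum, LinearMap.sum_apply]
    have h1 : ∀ i, F (v i • stdE i) (stdE j) =
        (v i * w i j) • z₀ := by
      intro i
      rw [map_smul, LinearMap.smul_apply, hF, smul_smul]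
    rw [Finset.sum_congr rfl fun i _ => h1 i, ← Finset.sum_smul]
    have h0 : ∀ i, w i i = 0 := fun i => by have := hskew i i; linarith
    -- A skew 3 × 3 matrix annihilates its dual vector.
    have h2 : ∑ i, v i * w i j = 0 := by
      rw [Fin.sum_univ_three, hv]
      fin_cases j <;> simp [h0, hskew 0 1, hskew 0 2, hskew 1 2] <;> ring
    rw [h2, zero_smul]
  have hFv : F (WithLp.toLp 2 v) = 0 := (lieBasis 𝒢).ext hj
  intro x
  exact congrArg (fun T : EuclideanSpace ℝ (Fin 3) →ₗ[ℝ] EuclideanSpace ℝ (Fin 3) => T x) hFv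

/-- In the nonabelian case `|[,]|²` is a constant multiple of `G(z₀, z₀)² / det G`. -/
theorem exists_normSqBr_eq [Group.IsNilpotent 𝒢] (B : PrincipalBundle 𝒢 P M) (g : Metric4 P) :
    ∃ (c : ℝ) (z₀ : Lie3 𝒢), (¬ IsAbelianLie 𝒢 ∨ c = 0) ∧ (∀ a : 𝒢, adL a z₀ = z₀) ∧
      ∀ p, normSqBr B g p = c * fibG B g p z₀ z₀ ^ 2 * ((gram B g p).det)⁻¹ := by
  by_cases h : IsAbelianLie 𝒢
  -- The coefficient 0 replaces the vanishing of DG on the centre, which holds only in the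
  -- nonabelian case.
  · refine ⟨0, (0 : EuclideanSpace ℝ (Fin 3)), Or.inr rfl, fun a => map_zero _, fun p => ?_⟩
    have h0 : fibG B g p (0 : EuclideanSpace ℝ (Fin 3)) (0 : EuclideanSpace ℝ (Fin 3)) = 0 :=
      (fibG_eq_dotProduct B g p 0 0).trans (by simp)
    unfold normSqBr
    simp only [trG_eq, fibBr_eq_zero_of_abelian h]
    have h0' : fibG B g p (0 : Lie3 𝒢) (0 : Lie3 𝒢) = 0 := h0
    simp [h0']
  · obtain ⟨z₀, hz0, hfix, hcen, hder⟩ := exists_centre_generator h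
    choose w hw using fun i j => hder (lieBasis 𝒢 i) (lieBasis 𝒢 j)
    have hskew : ∀ i j, w j i = - w i j := by
      intro i j
      have h1 := hw j i
      rw [fibBr_swap, hw i j] at h1
      have h2 : (w j i + w i j) • z₀ = 0 := by rw [add_smul, ← h1]; exact neg_add_cancel _
      have := (smul_eq_zero.1 h2).resolve_right hz0
      linarith
    obtain ⟨c, hc⟩ := hcen _ (dual_mem_centre (w := Matrix.of w) hw hskew)
    refine ⟨2 * c ^ 2, z₀, Or.inl h, hfix, fun p => ?_⟩
    have h1 : normSqBr B g p = fibG B g p z₀ z₀ * contr2 (gram B g p)⁻¹ (Matrix.of w) := by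
      unfold normSqBr
      simp only [trG_eq, contr2, smul_eq_mul, Finset.mul_sum]
      refine Finset.sum_congr rfl fun i _ => Finset.sum_congr rfl fun j _ =>
        Finset.sum_congr rfl fun k _ => Finset.sum_congr rfl fun l _ => ?_
      have h2 : fibG B g p (fibBr (lieBasis 𝒢 i) (lieBasis 𝒢 k))
          (fibBr (lieBasis 𝒢 j) (lieBasis 𝒢 l)) = w i k * w j l * fibG B g p z₀ z₀ := by
        rw [hw, hw]
        exact fibG_smul_smul p _ _ _ _
      rw [h2, Matrix.of_apply, Matrix.of_apply]
      ring
    rw [h1, double_contraction (gram_posDef B g p) (Matrix.of w) hskew]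
    have h3 := (fibG_eq_dotProduct B g p
      (WithLp.toLp 2 ![(Matrix.of w) 1 2, (Matrix.of w) 2 0, (Matrix.of w) 0 1]) _).symm.trans
      ((congrArg (fun u : EuclideanSpace ℝ (Fin 3) => fibG B g p u u) hc).trans
        (fibG_smul_smul p c c z₀ z₀))
    rw [h3]
    ring

/-- Translation by `a` changes the vertical basis by Ad a, and a form of top degree on 𝔤 then scales
by det Ad a = 1. -/
theorem fibH_act [Group.IsNilpotent 𝒢] (hH : InvariantForm B H) (a : 𝒢) (p : P) :
    fibH B H (B.act p a) = fibH B H p := by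
  let β : EuclideanSpace ℝ (Fin 4) [⋀^Fin 3]→L[ℝ] ℝ := H p
  let α : EuclideanSpace ℝ (Fin 3) [⋀^Fin 3]→ₗ[ℝ] ℝ :=
    β.toAlternatingMap.compLinearMap (vertL B p : EuclideanSpace ℝ (Fin 3) →ₗ[ℝ] EuclideanSpace ℝ (Fin 4))
  let e := (EuclideanSpace.basisFun (Fin 3) ℝ).toBasis
  have he : ∀ i, e i = lieBasis 𝒢 i := fun i => rfl
  have h1 : fibH B H p = α e := by
    show H p _ = H p _
    congr 1
    ext i : 1
    fin_cases i <;> rfl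
  have h2 : fibH B H (B.act p a) = α ((adL a : EuclideanSpace ℝ (Fin 3) →ₗ[ℝ] _) ∘ e) := by
    have h3 := congrArg (fun T : EuclideanSpace ℝ (Fin 4) [⋀^Fin 3]→L[ℝ] ℝ =>
      T fun i => vertL B p (adL a (e i))) (hH a p)
    refine Eq.trans ?_ h3
    show H (B.act p a) _ = H (B.act p a) _
    congr 1
    ext i : 1
    fin_cases i
    · exact vert_act B p a (e 0)
    · exact vert_act B p a (e 1)
    · exact vert_act B p a (e 2)
  rw [h1, h2, α.eq_smul_basis_det e, AlternatingMap.smul_apply, AlternatingMap.smul_apply,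
    Module.Basis.det_comp, det_adL, one_mul]

variable [T2Space M] [CompactSpace M] [Group.IsNilpotent 𝒢]

theorem FlowsAt.hasDerivAt_inv_det (hg : InvariantMetric B g) (hSB : SBVanishes B g H)
    (hU : IsOpen U) (hV : IsUnitHorizontal B g U V) {γ : ℝ → P} {t : ℝ} (h : FlowsAt B U V γ t) :
    HasDerivAt (fun s => ((gram B g (γ s)).det)⁻¹) 0 t := by
  have hd := (gram_det_pos B g (γ t)).ne'
  have h1 := (hasDerivAt_det_curve (G := fun s => gram B g (γ s)) h.hasDerivAt_gram hd).fun_inv hd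
  rw [← trDG_eq, trDG_eq_zero hg hSB hU hV h.1] at h1
  simpa using h1

/-- In c G(z₀, z₀)² / det G the determinant is constant along V, and so is G(z₀, z₀) unless c = 0.
-/
theorem hasMFDerivAt_normSqBr (hg : InvariantMetric B g) (hSB : SBVanishes B g H) (hU : IsOpen U)
    (hV : IsUnitHorizontal B g U V) {p : P} (hp : p ∈ B.proj ⁻¹' U) :
    HasMFDerivAt (𝓡 4) 𝓘(ℝ, ℝ) (normSqBr B g) p 0 := by
  obtain ⟨c, z₀, hc, hfix, hN⟩ := exists_normSqBr_eq B g
  have hzz : c * dG B g V p z₀ z₀ = 0 := by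
    rcases hc with h | rfl
    · rw [dG_centre_eq_zero hg hSB hU hV hp h z₀ (mem_centre_of_fixed hfix), mul_zero]
    · rw [zero_mul]
  have hf : MDifferentiableAt (𝓡 4) 𝓘(ℝ, ℝ) (normSqBr B g) p := by
    rw [show normSqBr B g = _ from funext hN]
    have h1 := contMDiff_fibG B g z₀ z₀ p
    exact ((contMDiffAt_const.mul (h1.pow 2)).mul ((contMDiffAt_det_gram B g p).inv₀
      (gram_det_pos B g p).ne')).mdifferentiableAt (by norm_num)
  refine hasMFDerivAt_zero_of_invariant hV hp hf (fun a => ?_) ?_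
  · rw [hN, hN, det_gram_act hg]
    have h1 : fibG B g (B.act p a) z₀ z₀ = fibG B g p z₀ z₀ := by
      refine (fibG_act hg a p z₀ z₀).trans ?_
      rw [hfix a]
    rw [h1]
  · obtain ⟨γ, rfl, -, hγ⟩ := exists_flow_line hU hV hp
    have h0 := hγ.self_of_nhds
    have h1 := h0.hasDerivAt (mdifferentiableAt_fibG (B := B) (g := g) z₀ z₀ (γ 0))
    have h2 := ((h1.fun_pow 2).const_mul c).fun_mul (h0.hasDerivAt_inv_det hg hSB hU hV)
    have h3 := h0.hasDerivAt hf
    simp only [hN] at h3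
    rw [h3.unique h2]
    have hzz' : c * covDeriv V (fun q => fibG B g q z₀ z₀) (γ 0) = 0 := hzz
    simp only [mul_zero, add_zero]
    linear_combination (2 * fibG B g (γ 0) z₀ z₀ ^ (2 - 1) * ((gram B g (γ 0)).det)⁻¹) * hzz'

theorem contMDiffAt_trG {T : P → Lie3 𝒢 → Lie3 𝒢 → ℝ} {p : P}
    (hT : ∀ i j, ContMDiffAt (𝓡 4) 𝓘(ℝ, ℝ) ∞ (fun q => T q (lieBasis 𝒢 i) (lieBasis 𝒢 j)) p) :
    ContMDiffAt (𝓡 4) 𝓘(ℝ, ℝ) ∞ (fun q => trG B g q (T q)) p := by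
  simp only [trG_eq, smul_eq_mul, inv_def, Ring.inverse_eq_inv', Matrix.smul_apply]
  refine contMDiffAt_finsetSum fun i _ => contMDiffAt_finsetSum fun j _ => ?_
  exact (((contMDiffAt_det_gram B g p).inv₀ (gram_det_pos B g p).ne').mul
    (contMDiffAt_adjugate_gram B g i j p)).mul (hT i j)

/-- |DG|² = tr N² for N = G⁻¹ A. Along the fibres N is conjugated by Ad, which preserves the trace;
along V its derivative G⁻¹ (D_v A − A G⁻¹ A) is zero. -/
theorem hasMFDerivAt_normSqDG (hg : InvariantMetric B g) (hSB : SBVanishes B g H) (hU : IsOpen U)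
    (hV : IsUnitHorizontal B g U V) {p : P} (hp : p ∈ B.proj ⁻¹' U) :
    HasMFDerivAt (𝓡 4) 𝓘(ℝ, ℝ) (normSqDG B g V) p 0 := by
  have hdG : ∀ x y, ContMDiffAt (𝓡 4) 𝓘(ℝ, ℝ) ∞ (fun q => dG B g V q x y) p := fun x y =>
    (contMDiffOn_dG hU hV x y).contMDiffAt ((isOpen_preimage B hU).mem_nhds hp)
  have hf : MDifferentiableAt (𝓡 4) 𝓘(ℝ, ℝ) (normSqDG B g V) p := by
    refine ContMDiffAt.mdifferentiableAt (n := ∞) ?_ (by norm_num)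
    exact contMDiffAt_trG
      (T := fun q x x' => trG B g q fun y y' => dG B g V q x y * dG B g V q x' y')
      fun i j => contMDiffAt_trG
        (T := fun q y y' => dG B g V q (lieBasis 𝒢 i) y * dG B g V q (lieBasis 𝒢 j) y')
        fun k l => (hdG _ _).mul (hdG _ _)
  refine hasMFDerivAt_zero_of_invariant hV hp hf (fun a => ?_) ?_
  · have hR : IsUnit (adMat a).det := by rw [det_adMat]; exact isUnit_one
    have hRt : IsUnit ((adMat a)ᵀ).det := by rwa [det_transpose]
    have hSA : (gram B g (B.act p a))⁻¹ * matB (dG B g V (B.act p a)) =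
        (adMat a)⁻¹ * ((gram B g p)⁻¹ * matB (dG B g V p)) * adMat a := by
      rw [gram_act hg, dG_matrix_act hg hU hV a hp, Matrix.mul_inv_rev, Matrix.mul_inv_rev]
      simp only [Matrix.mul_assoc]
      rw [nonsing_inv_mul_cancel_left _ _ hRt]
    rw [normSqDG_eq, normSqDG_eq, hSA]
    set N := (gram B g p)⁻¹ * matB (dG B g V p)
    have e : (adMat a)⁻¹ * N * adMat a * ((adMat a)⁻¹ * N * adMat a) =
        (adMat a)⁻¹ * (N * N * adMat a) := by
      simp only [Matrix.mul_assoc]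
      rw [mul_nonsing_inv_cancel_left _ _ hR]
    rw [e, Matrix.trace_mul_comm, mul_nonsing_inv_cancel_right _ _ hR]
  · obtain ⟨γ, rfl, -, hγ⟩ := exists_flow_line hU hV hp
    have h0 := hγ.self_of_nhds
    have h1 := h0.hasDerivAt_inv_dG hU hV
    rw [matB_ddG_eq hg hSB hU hV hp, sub_self, Matrix.mul_zero] at h1
    have h2 := hasDerivAt_trace_entry (hasDerivAt_mul_entry
      (F := fun s => (gram B g (γ s))⁻¹ * matB (dG B g V (γ s)))
      (K := fun s => (gram B g (γ s))⁻¹ * matB (dG B g V (γ s))) h1 h1)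
    have h3 := h0.hasDerivAt hf
    simp only [normSqDG_eq] at h3
    rw [h3.unique h2]
    simp

theorem hasMFDerivAt_normSqHfib (hg : InvariantMetric B g) (hSB : SBVanishes B g H)
    (hHs : IsSmoothForm H) (hHc : IsClosedForm H) (hH : InvariantForm B H) (hU : IsOpen U)
    (hV : IsUnitHorizontal B g U V) {p : P} (hp : p ∈ B.proj ⁻¹' U) :
    HasMFDerivAt (𝓡 4) 𝓘(ℝ, ℝ) (normSqHfib B g H) p 0 := by
  have hN : ∀ q, normSqHfib B g H q = 6 * ((gram B g q).det)⁻¹ * fibH B H q ^ 2 := fun q => by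
    rw [normSqHfib_eq, det_nonsing_inv, Ring.inverse_eq_inv']
  have hk := mdifferentiableAt_fibH (B := B) hHs p
  have hf : MDifferentiableAt (𝓡 4) 𝓘(ℝ, ℝ) (normSqHfib B g H) p := by
    rw [show normSqHfib B g H = _ from funext hN]
    have h1 : MDifferentiableAt (𝓡 4) 𝓘(ℝ, ℝ) (fun q => 6 * ((gram B g q).det)⁻¹) p :=
      (contMDiffAt_const.mul ((contMDiffAt_det_gram B g p).inv₀
        (gram_det_pos B g p).ne')).mdifferentiableAt (n := ∞) (by norm_num)
    exact h1.mul (hk.pow 2)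
  refine hasMFDerivAt_zero_of_invariant hV hp hf (fun a => ?_) ?_
  · rw [hN, hN, det_gram_act hg, fibH_act hH]
  · have hk0 := covDeriv_fibH_eq_zero hg hSB hHs hHc hU hV hp
    obtain ⟨γ, rfl, -, hγ⟩ := exists_flow_line hU hV hp
    have h0 := hγ.self_of_nhds
    have h1 := h0.hasDerivAt hk
    rw [hk0] at h1
    have h2 := ((h0.hasDerivAt_inv_det hg hSB hU hV).const_mul 6).fun_mul (h1.fun_pow 2)
    have h3 := h0.hasDerivAt hf
    simp only [hN] at h3
    rw [h3.unique h2]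
    simp

end Bundle

end NilBundle

end

theorem proposition4p3 {𝒢 P M : Type*}
    [TopologicalSpace 𝒢] [ChartedSpace (EuclideanSpace ℝ (Fin 3)) 𝒢] [Group 𝒢]
    [LieGroup (𝓡 3) ∞ 𝒢] [Group.IsNilpotent 𝒢]
    [TopologicalSpace P] [ChartedSpace (EuclideanSpace ℝ (Fin 4)) P] [IsManifold (𝓡 4) ∞ P]
    [TopologicalSpace M] [ChartedSpace (EuclideanSpace ℝ (Fin 1)) M] [IsManifold (𝓡 1) ∞ M]
    [T2Space M] [CompactSpace M]
    (B : NilBundle.PrincipalBundle 𝒢 P M)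
    (g : NilBundle.Metric4 P) (H : NilBundle.ThreeForm P)
    (hg : NilBundle.InvariantMetric B g)
    (hHsmooth : NilBundle.IsSmoothForm H) (hHclosed : NilBundle.IsClosedForm H)
    (hH : NilBundle.InvariantForm B H)
    (hSB : NilBundle.SBVanishes B g H)
    (U : Set M) (hU : IsOpen U) (V : ∀ p : P, TangentSpace (𝓡 4) p)
    (hV : NilBundle.IsUnitHorizontal B g U V) (p : P) (hp : p ∈ B.proj ⁻¹' U) :
    -- `D` preserves sections of the centre and of its orthogonal complement
    (∀ η : P → NilBundle.Lie3 𝒢, NilBundle.IsAdjointSection B U η →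
      (∀ q ∈ B.proj ⁻¹' U, η q ∈ NilBundle.centre 𝒢) →
      NilBundle.covDerivSec V η p ∈ NilBundle.centre 𝒢) ∧
    (∀ η : P → NilBundle.Lie3 𝒢, NilBundle.IsAdjointSection B U η →
      (∀ q ∈ B.proj ⁻¹' U, η q ∈ NilBundle.centrePerp B g q) →
      NilBundle.covDerivSec V η p ∈ NilBundle.centrePerp B g p) ∧
    -- `DG` is block diagonal for this splitting
    (∀ x ∈ NilBundle.centrePerp B g p, ∀ z ∈ NilBundle.centre 𝒢,
      NilBundle.dG B g V p x z = 0) ∧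
    -- `DG(·,·) = 0` and `tr_g H² = 0`
    NilBundle.trDG B g V p = 0 ∧
    NilBundle.trHsq B g H V p = 0 ∧
    -- `(D_· DG)_· (x, y) = D_·G(x, ·) D_·G(y, ·)`
    (∀ x y : NilBundle.Lie3 𝒢, NilBundle.ddG B g V p x y = NilBundle.dGdG B g V p x y) ∧
    -- `D|[,]|² = 0`, `D|DG|² = 0`, `D|H^𝔊|² = 0`
    HasMFDerivAt (𝓡 4) 𝓘(ℝ, ℝ) (NilBundle.normSqBr B g) p 0 ∧
    HasMFDerivAt (𝓡 4) 𝓘(ℝ, ℝ) (NilBundle.normSqDG B g V) p 0 ∧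
    HasMFDerivAt (𝓡 4) 𝓘(ℝ, ℝ) (NilBundle.normSqHfib B g H) p 0 ∧
    -- the nonabelian case
    ((∃ a ∈ connectedComponent (1 : 𝒢), ∃ b ∈ connectedComponent (1 : 𝒢), a * b ≠ b * a) →
      (∀ z ∈ NilBundle.centre 𝒢, ∀ z' ∈ NilBundle.centre 𝒢, NilBundle.dG B g V p z z' = 0) ∧
      (∀ x ∈ NilBundle.centrePerp B g p, ∀ y ∈ NilBundle.centrePerp B g p,
        NilBundle.ddG B g V p x y
          = 1 / 2 * NilBundle.normSqDG B g V p * NilBundle.fibG B g p x y)) := by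
  refine ⟨fun η hη hc => NilBundle.covDerivSec_mem_centre hU hV hp hη hc,
    fun η hη hc => NilBundle.covDerivSec_mem_centrePerp hg hSB hU hV hp hη hc,
    fun x hx z hz => NilBundle.dG_perp_centre hg hSB hU hV hp hx hz,
    NilBundle.trDG_eq_zero hg hSB hU hV hp, NilBundle.trHsq_eq_zero hg hSB hU hV hp,
    fun x y => (NilBundle.ddG_eq_dGdG hg hSB hU hV hp x y).trans
      (NilBundle.dGdG_eq_dotProduct hU hV hp x y).symm,
    NilBundle.hasMFDerivAt_normSqBr hg hSB hU hV hp,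
    NilBundle.hasMFDerivAt_normSqDG hg hSB hU hV hp,
    NilBundle.hasMFDerivAt_normSqHfib hg hSB hHsmooth hHclosed hH hU hV hp, ?_⟩
  rintro ⟨a, ha, b, hb, hab⟩
  -- The hypothesis concerns the identity component, since the Lie algebra does not see
  -- noncommutativity between components.
  have h : ¬ NilBundle.IsAbelianLie 𝒢 := fun h =>
    hab (NilBundle.commute_of_bracket_eq_zero h ha hb)
  exact ⟨fun z _ z' hz' => NilBundle.dG_centre_eq_zero hg hSB hU hV hp h z hz',
    fun x hx y _ => NilBundle.ddG_perp_eq hg hSB hU hV hp h hx y⟩
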